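/- **Conventions.** A grid diagram $\mathbb G$ of index $n$ is an $n\times n$ grid with one $O$ and one $X$ in each row and column, in different squares; it is given by permutations $\sigma_{\mathbb O},\sigma_{\mathbb X}$ (the marking in column $i$ lies in row $\sigma(i)$; columns are numbered from the left and rows from the bottom). Opposite sides of the grid are identified. Grid states are the bijections between vertical and horizontal circles. $GC^-(\mathbb G)$ is the free $\mathbb F_2[U]$-module on the grid states, with differential $$\partial^-_{\mathbb G}\,\mathbf x=\sum_{\mathbf y}\ \sum_{r\in \mathrm{Rect}^0(\mathbf x,\mathbf y),\ r\cap\mathbb X=\emptyset}U^{|r\cap\mathbb O|}\,\mathbf y ,$$ where $\mathrm{Rect}^0(\mathbf x,\mathbf y)$ is the set of empty rectangles on the torus from $\mathbf x$ to $\mathbf y$ (lower left and upper right corners in $\mathbf x$, no point of $\mathbf x$ in the interior). Its homology is $GH^-(\mathbb G)$. The Maslov and Alexander gradings are given by $$M_{\mathbb O}(\mathbf x)=\mathcal J(\mathbf x,\mathbf x)-2\mathcal J(\mathbf x,\mathbb O)+\mathcal J(\mathbb O,\mathbb O)+1,\qquad A(\mathbf x)=\tfrac12\bigl(M_{\mathbb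 O}(\mathbf x)-M_{\mathbb X}(\mathbf x)\bigr)-\tfrac{n-1}2,$$ where $\mathcal J$ is the symmetrization of the function $\mathcal I(P,Q)$ that counts the pairs in $P\times Q$ whose second point lies to the north-east of the first in the planar grid; $U$ has Maslov degree $-2$ and Alexander degree $-1$. An element is homogeneous if it is so for both gradings, and a class is torsion if some power of $U$ kills it. Let $[\mathbf x_\tau]$ be a homogeneous non-torsion class of $GH^-(\mathbb G)$ of the largest possible Alexander grading, which is $-\tau$. A cycle that is such a representative is called a $\tau$-cycle. Let $-\mathbb G$ be the diagram obtained from $\mathbb G$ by reflection in a horizontal axis and exchange of the $X$- and $O$-markings; a grid state $\mathbf x$ of $\mathbb G$ has a reflection $\mathbf x^*$, a grid state of $-\mathbb G$. A chain $d\in GC^-(-\mathbb G)$ *stands for $[\mathbf x_\tau]$* if it is homogeneous of Alexander grading $-\tau$ and pairs to $1$ with every $\tau$-cycle, where the pairing with values in $\mathbb F_2=\mathbb F_2[U]/U$ is the bilinear one for which the reflected states $\mathbf x^*$ are dual to the states $\mathbf x$. (If a single grid state $\mathbf x$ has Alexander grading $-\tau$, and none has a larger one, then $d=\mathbf x^*$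 is the only such chain.) Define * $\varepsilon(\mathbb G)=-1$ if there is a chain $d$ standing for $[\mathbf x_\tau]$ with $U^kd\in\operatorname{Im}\partial^-_{-\mathbb G}$ for some $k\ge0$; * $\varepsilon(\mathbb G)=0$ if there is none such, but some $d$ standing for $[\mathbf x_\tau]$ lies in $\operatorname{Ker}\partial^-_{-\mathbb G}$; * $\varepsilon(\mathbb G)=1$ if no $d$ standing for $[\mathbf x_\tau]$ lies in $\operatorname{Ker}\partial^-_{-\mathbb G}$. For coprime integers $p\ge 1$ and $q\neq0$ let $\mathbb G_{-p,q}$ be the standard grid diagram, of index $p+|q|$, of the $(-p,q)$ torus knot: for $q>0$ it has $\sigma_{\mathbb O}=(1,2,\dots,p+q)$ and $\sigma_{\mathbb X}=(p+1,\dots,p+q,1,\dots,p)$, and for $q<0$ it is $-\mathbb G_{-p,|q|}$. **Theorem 1.2.** Let $p\ge1$ and $q\ne0$ be coprime integers, with $p\geq 2$ if $|q|>1$. Then $[\mathbf x_\tau]$ exists for $\mathbb G_{-p,q}$, and $$\varepsilon(\mathbb G_{-p,q})=\begin{cases}-1& q>1,\\ 0& |q|=1,\\ 1& q<-1.\end{cases}$$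 -/

import Mathlib

/-- A (toroidal) grid diagram of grid index `n`.  Columns are numbered from left to right and rows
from bottom to top; `O i` and `X i` are the rows of the O-marking and of the X-marking in column
`i`.  No square carries two markings. -/
structure GridDiagram (n : ℕ) where
  O : Equiv.Perm (Fin n)
  X : Equiv.Perm (Fin n)
  ne : ∀ i, O i ≠ X i

namespace GridDiagram

variable {n : ℕ}

/-- Grid states: bijections from vertical circles to horizontal circles.  The circles with number
`k` are the left edge of column `k` and the bottom edge of row `k`. -/
abbrev State (n : ℕ) : Type := Equiv.Perm (Fin n)

/-- The (numbers of the) columns, or rows, met when one moves on the torus in the positive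
direction from the circle `a` to the circle `b`. -/
def arc (a b : Fin n) : Finset (Fin n) :=
  Finset.univ.filter fun c => (c - a).val < (b - a).val

/-- An ordered pair `r = (i, j)` of distinct vertical circles gives the rectangle on the torus with
left edge on `i`, right edge on `j`, lower left corner `(i, x i)` and upper right corner
`(j, x j)`.  It goes from `x` to the state `x * swap i j`.  These are the rectangles
from `x` to `y`. -/
def rect (x y : State n) : Finset (Fin n × Fin n) :=
  Finset.univ.filter fun r => r.1 ≠ r.2 ∧ y = x * Equiv.swap r.1 r.2

/-- The interior of the rectangle `r` starting at `x` contains no point of `x`. -/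
def IsEmptyRect (x : State n) (r : Fin n × Fin n) : Prop :=
  ∀ k, ¬ (k ∈ (arc r.1 r.2).erase r.1 ∧ x k ∈ (arc (x r.1) (x r.2)).erase (x r.1))

/-- The number of markings, placed in the squares `(k, S k)`, inside the rectangle `r` starting
at `x`. -/
def count (S : Equiv.Perm (Fin n)) (x : State n) (r : Fin n × Fin n) : ℕ :=
  (Finset.univ.filter fun k => k ∈ arc r.1 r.2 ∧ S k ∈ arc (x r.1) (x r.2)).card

/-- The free `𝔽₂[U]`-module generated by the grid states. -/
abbrev Chain (n : ℕ) : Type := State n → Polynomial (ZMod 2)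

open Classical in
/-- The differential of the unblocked grid complex `GC⁻(G)` over `𝔽₂[U]`: it sends a grid state `x`
to the sum over all `y` and all empty rectangles `r` from `x` to `y` without X-markings of
`U ^ |r ∩ 𝕆| • y`. -/
noncomputable def boundary (G : GridDiagram n) :
    Chain n →ₗ[Polynomial (ZMod 2)] Chain n where
  toFun c y := ∑ x, c x * ∑ r ∈ (rect x y).filter (fun r => IsEmptyRect x r ∧ count G.X x r = 0),
    (Polynomial.X : Polynomial (ZMod 2)) ^ count G.O x r
  map_add' c d := by
    funext y
    simp [add_mul, Finset.sum_add_distrib]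
  map_smul' a c := by
    funext y
    simp [Finset.mul_sum, mul_assoc]

/-- The points of a grid state in the fundamental domain `[0, n) × [0, n)`. -/
def points (x : State n) (i : Fin n) : ℚ × ℚ := ((i.val : ℚ), ((x i).val : ℚ))

/-- The centres of the marked squares. -/
def centers (S : Equiv.Perm (Fin n)) (i : Fin n) : ℚ × ℚ :=
  ((i.val : ℚ) + 1 / 2, ((S i).val : ℚ) + 1 / 2)

/-- The number of pairs in `P × Q` whose second member lies to the north-east of the first. -/
def countNE (P Q : Fin n → ℚ × ℚ) : ℚ :=
  ∑ i, ∑ j, if (P i).1 < (Q j).1 ∧ (P i).2 < (Q j).2 then 1 else 0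

/-- The symmetrization of `countNE`. -/
def symNE (P Q : Fin n → ℚ × ℚ) : ℚ := (countNE P Q + countNE Q P) / 2

/-- The Maslov function with respect to a set of markings. -/
def maslovOf (S : Equiv.Perm (Fin n)) (x : State n) : ℚ :=
  symNE (points x) (points x) - 2 * symNE (points x) (centers S) + symNE (centers S) (centers S) + 1

/-- The Maslov grading of a grid state. -/
def maslov (G : GridDiagram n) (x : State n) : ℚ := maslovOf G.O x

/-- The Alexander grading of a grid state. -/
def alexander (G : GridDiagram n) (x : State n) : ℚ :=
  (maslovOf G.O x - maslovOf G.X x) / 2 - ((n : ℚ) - 1) / 2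

/-- `c` is homogeneous of Alexander grading `a`, where `U` lowers this grading by `1`. -/
def AlexanderHomogeneous (G : GridDiagram n) (a : ℚ) (c : Chain n) : Prop :=
  ∀ x k, (c x).coeff k ≠ 0 → G.alexander x - k = a

/-- `c` is homogeneous of Maslov grading `m`, where `U` lowers this grading by `2`. -/
def MaslovHomogeneous (G : GridDiagram n) (m : ℚ) (c : Chain n) : Prop :=
  ∀ x k, (c x).coeff k ≠ 0 → G.maslov x - 2 * k = m

/-- `c` becomes a boundary after multiplication by some power of `U`. -/
def IsUPowerBoundary (G : GridDiagram n) (c : Chain n) : Prop :=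
  ∃ (k : ℕ) (z : Chain n), G.boundary z = (Polynomial.X : Polynomial (ZMod 2)) ^ k • c

/-- `c` is a cycle, homogeneous for both gradings, of Alexander grading `a`, whose class in
`GH⁻(G)` is not torsion. -/
def IsNontorsionCycle (G : GridDiagram n) (a : ℚ) (c : Chain n) : Prop :=
  G.boundary c = 0 ∧ G.AlexanderHomogeneous a c ∧ (∃ m, G.MaslovHomogeneous m c) ∧
    ¬ G.IsUPowerBoundary c

/-- `c` is a cycle representing the generator `[x_τ]`: a homogeneous non-torsion class of the
largest possible Alexander grading `a = -τ`. -/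
def IsTauCycle (G : GridDiagram n) (a : ℚ) (c : Chain n) : Prop :=
  G.IsNontorsionCycle a c ∧ ∀ b d, G.IsNontorsionCycle b d → b ≤ a

/-- The diagram `-G` of the mirror reverse: reflect `G` in a horizontal axis and interchange the
X- and O-markings. -/
def neg (G : GridDiagram n) : GridDiagram n where
  O := Fin.revPerm * G.X
  X := Fin.revPerm * G.O
  ne i h := G.ne i (Fin.revPerm.injective h).symm

/-- The reflected grid state: the horizontal circle `k` goes to the circle `n - k` modulo `n`. -/
def reflect (x : State n) : State n := finRotate n * Fin.revPerm * x

/-- The pairing of chains of `G` and of `-G` modulo `U`, under which each grid state of `G` is dual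
to its reflection. -/
noncomputable def pairing (c d : Chain n) : ZMod 2 :=
  ∑ x : State n, (c x).coeff 0 * (d (reflect x)).coeff 0

/-- `d` is a chain of `GC⁻(-G)` that stands for the class `[x_τ]` of `GH⁻(G)`.  The reflected
complex is the horizontal complex of `G` with all arrows reversed, that is, its dual; so `d` is
required to have the Alexander grading `-τ` of `x_τ` and to pair to `1` with each cycle that
represents `[x_τ]`.  If a single grid state `x` has Alexander grading `-τ` and none has a larger
one, then `d` is the reflection of `x`. -/
def IsTransport (G : GridDiagram n) (d : Chain n) : Prop :=
  ∃ a, (∃ c, G.IsTauCycle a c) ∧ G.neg.AlexanderHomogeneous a d ∧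
    ∀ c, G.IsTauCycle a c → pairing c d = 1

/-- `[x_τ]`, seen in `-G`, lies in the kernel of the differential of `-G`. -/
def TauInKer (G : GridDiagram n) : Prop :=
  ∃ d, G.IsTransport d ∧ G.neg.boundary d = 0

/-- `[x_τ]`, seen in `-G`, lies in the image of the differential of `-G` (after multiplication by
some power of `U`). -/
def TauInIm (G : GridDiagram n) : Prop :=
  ∃ d, G.IsTransport d ∧ G.neg.IsUPowerBoundary d

open Classical in
/-- The invariant `ε` of a grid diagram: `-1` if `[x_τ]` is in the image, `0` if it is in the kernel
but not in the image, and `1` if it is not in the kernel.  (`TauInIm` implies `TauInKer`, since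
chains have no `U`-torsion.) -/
noncomputable def epsilon (G : GridDiagram n) : ℤ :=
  if G.TauInIm then -1 else if G.TauInKer then 0 else 1

/-- The grid diagram of index `p + q` with `σ_𝕆 = (1, 2, …, p + q)` and
`σ_𝕏 = (p + 1, …, p + q, 1, …, p)`. -/
def torus (p q : ℕ) (hp : 0 < p) (hq : 0 < q) : GridDiagram (p + q) where
  O := 1
  X := finRotate (p + q) ^ p
  ne := by
    have key : ∀ (m k : ℕ) (i : Fin (m + 1)), ((finRotate (m + 1) ^ k) i).val =
        (i.val + k) % (m + 1) := by
      intro m k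
      induction k with
      | zero => intro i; simp [Nat.mod_eq_of_lt i.isLt]
      | succ k ih =>
        intro i
        rw [pow_succ', Equiv.Perm.mul_apply, finRotate_apply, Fin.val_add, ih]
        simp [← add_assoc]
    intro i h
    obtain ⟨m, hm⟩ : ∃ m, p + q = m + 1 := ⟨p + q - 1, by omega⟩
    have h2 : ∀ (N : ℕ) (_ : N = m + 1) (i : Fin N),
        ((finRotate N ^ p) i).val = (i.val + p) % N := by
      intro N hN
      subst hN
      exact key m p
    have h3 := congrArg Fin.val h
    rw [h2 _ hm i, Equiv.Perm.one_apply] at h3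
    have hi := i.isLt
    rcases lt_or_ge (i.val + p) (p + q) with h4 | h4
    · rw [Nat.mod_eq_of_lt h4] at h3
      omega
    · rw [Nat.mod_eq_sub_mod h4, Nat.mod_eq_of_lt (by omega)] at h3
      omega

/-- The standard grid diagram `𝔾_{-p,q}`, of grid index `p + |q|`, of the `(-p, q)` torus knot.
For `q < 0` it is the mirror reverse of the diagram for `(-p, |q|)`. -/
def negTorus (p : ℕ) (q : ℤ) (hp : 0 < p) (hq : q ≠ 0) : GridDiagram (p + q.natAbs) :=
  if 0 < q then torus p q.natAbs hp (Int.natAbs_pos.mpr hq)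
  else (torus p q.natAbs hp (Int.natAbs_pos.mpr hq)).neg

end GridDiagram

namespace GridDiagram

/-! ### Arcs and the cyclic order. -/

variable {n : ℕ}

/-! An Alexander-homogeneous chain is determined by its value at U = 1. There, cycles and boundaries
up to powers of U become linear algebra over 𝔽₂: the differential of `G` is multiplication of row
vectors by `avoidMatrix G.X`, and after reflection that of `-G` is multiplication of column vectors
by `avoidMatrix G.O` (`boundary_homogenize`, `isUPowerBoundary_iff`,
`vecMul_avoidMatrix_reflect_eq_iff`). In the torus diagram both sets of markings are lines on the
torus: 𝕆 is the diagonal and 𝕏 a translate of it.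

For q > 0 the state at the lower left corners of 𝕏 is the only one of largest Alexander grading
(`belowCount_sub_le`). It is a cycle because every rectangle out of it contains an X, and it is not
a boundary because the rectangles into it cancel in pairs. Hence its reflection is the only chain
standing for the class. If p, q ≥ 2, interchanging two adjacent points of this state gives a state
into which only one O-free rectangle leads, and that one starts at 𝕏 (`avoidMatrix_mulVec_shift`).
So the reflected state is a boundary up to powers of U, and ε = -1.

The other cases need the cohomology of `avoidMatrix 1`. Among pairs of consecutive rectangles
everything cancels except thin annuli (`sum_pairTerm`). Therefore `avoidMatrix` squares to zero and
commutes with the operators `hitMatrix` (rectangles with one given marking) and `throughMatrix`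
(rectangles through a given square), while these two satisfy a Clifford relation up to homotopy. The
X-squares link the O-markings into a walk, which meets every column because p and q are coprime.
Starting at the diagonal state and composing along n - 1 steps of this walk gives a cocycle,
`staircase`; it is not a coboundary since hit operators undo it step by step
(`avoidMatrix_mulVec_ne_staircase`). Its Alexander gradings are at least A(1) + n - 1. Above that
level every cocycle is a coboundary: cycles are generated from the diagonal state by at most n - 1
hit operators, each of which costs at most one unit of grading (`exists_cycle_decomposition_fixing`,
`dotProduct_eq_zero_of_fixing`). So the reflected staircase is a τ-cycle of `-G`.

If |q| = 1, the state 𝕏 has grading A(1) + n - 1, so the staircase is this state; it is a cocycle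
but not a coboundary, and ε = 0 for both mirror images. If q < -1, the part of the staircase in the
lowest possible grading agrees with that of `hitStaircase`, which is built by operators commuting
with `avoidMatrix G.X`. For that matrix the diagonal state is a coboundary, by the adjacent-points
argument with the two lines exchanged. So every cycle is orthogonal to `hitStaircase`, none can
stand for the class (`not_tauInKer_neg`), and ε = 1. -/

theorem mem_arc {a b c : Fin n} :
    c ∈ arc a b ↔ (a ≤ c ∧ c < b) ∨ (b < a ∧ (a ≤ c ∨ c < b)) := by
  have hsub : ∀ u v : Fin n, (u - v).val = if v ≤ u then u.val - v.val else n + u.val - v.val := by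
    intro u v
    split_ifs with h
    · exact Fin.sub_val_of_le h
    · exact Fin.coe_sub_iff_lt.mpr (not_le.mp h)
  simp only [arc, Finset.mem_filter, Finset.mem_univ, true_and, hsub]
  have := a.isLt
  have := b.isLt
  have := c.isLt
  simp only [Fin.le_def, Fin.lt_def]
  split_ifs <;> omega

/-- `b` lies strictly between `a` and `c` in the cyclic order. -/
def CycBtw (a b c : Fin n) : Prop := (a < b ∧ b < c) ∨ (b < c ∧ c < a) ∨ (c < a ∧ a < b)

theorem mem_arc_erase {a b c : Fin n} : c ∈ (arc a b).erase a ↔ CycBtw a c b := by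
  rw [Finset.mem_erase, mem_arc, CycBtw]
  simp only [Fin.le_def, Fin.lt_def, Ne, Fin.ext_iff]
  omega

theorem left_mem_arc {a b : Fin n} (h : a ≠ b) : a ∈ arc a b := by
  rw [mem_arc]
  simp only [Fin.le_def, Fin.lt_def, Ne, Fin.ext_iff] at *
  omega

theorem right_notMem_arc (a b : Fin n) : b ∉ arc a b := by
  rw [mem_arc]
  simp only [Fin.le_def, Fin.lt_def]
  omega

theorem isEmptyRect_iff {x : State n} {r : Fin n × Fin n} :
    IsEmptyRect x r ↔ ∀ k, ¬ (CycBtw r.1 k r.2 ∧ CycBtw (x r.1) (x k) (x r.2)) := by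
  simp only [IsEmptyRect, mem_arc_erase]

theorem CycBtw.rotate {a b c : Fin n} : CycBtw b c a ↔ CycBtw a b c := by
  simp only [CycBtw, Fin.lt_def]
  omega

theorem CycBtw.swap_iff {a b c : Fin n} (hab : a ≠ b) (hbc : b ≠ c) (hac : a ≠ c) :
    CycBtw a c b ↔ ¬ CycBtw a b c := by
  simp only [CycBtw, Fin.lt_def, Ne, Fin.ext_iff] at *
  omega

theorem not_cycBtw_left (a b : Fin n) : ¬ CycBtw a a b := by
  simp only [CycBtw, Fin.lt_def]
  omega

theorem not_cycBtw_right (a b : Fin n) : ¬ CycBtw a b b := by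
  simp only [CycBtw, Fin.lt_def]
  omega

theorem CycBtw.split {a b c m : Fin n} (h : CycBtw a b c) (hm : m ≠ b) :
    CycBtw a m c ↔ CycBtw a m b ∨ CycBtw b m c := by
  simp only [CycBtw, Fin.lt_def, Ne, Fin.ext_iff] at *
  omega

/-- The indicator function of an arc. -/
def arcInd (a b c : Fin n) : ℕ := if c ∈ arc a b then 1 else 0

theorem CycBtw.arcInd_add {a b c : Fin n} (h : CycBtw a b c) (m : Fin n) :
    arcInd a c m = arcInd a b m + arcInd b c m := by
  have h1 : (m ∈ arc a c ↔ m ∈ arc a b ∨ m ∈ arc b c) ∧ ¬ (m ∈ arc a b ∧ m ∈ arc b c) := by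
    simp only [mem_arc]
    simp only [CycBtw, Fin.le_def, Fin.lt_def] at *
    omega
  simp only [arcInd]
  by_cases h2 : m ∈ arc a b <;> by_cases h3 : m ∈ arc b c <;> simp_all

theorem arcInd_add_arcInd {a b : Fin n} (h : a ≠ b) (m : Fin n) :
    arcInd a b m + arcInd b a m = 1 := by
  have h1 : (m ∈ arc a b ↔ ¬ m ∈ arc b a) := by
    simp only [mem_arc]
    simp only [Fin.le_def, Fin.lt_def, Ne, Fin.ext_iff] at *
    omega
  simp only [arcInd]
  by_cases h2 : m ∈ arc b a <;> simp_all

/-! ### Domains and pairs of consecutive rectangles. -/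

/-- The multiplicity of the square `s` in the rectangle `r` starting at `x`. -/
def dom (x : State n) (r : Fin n × Fin n) (s : Fin n × Fin n) : ℕ :=
  arcInd r.1 r.2 s.1 * arcInd (x r.1) (x r.2) s.2

theorem count_eq_sum_dom (S : Equiv.Perm (Fin n)) (x : State n) (r : Fin n × Fin n) :
    count S x r = ∑ k, dom x r (k, S k) := by
  simp only [count, dom, arcInd, Finset.card_filter]
  refine Finset.sum_congr rfl fun k _ => ?_
  by_cases h2 : k ∈ arc r.1 r.2 <;> by_cases h3 : S k ∈ arc (x r.1) (x r.2) <;> simp [h2, h3]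

theorem dom_eq_ite (x : State n) (r s : Fin n × Fin n) :
    dom x r s = if s.1 ∈ arc r.1 r.2 ∧ s.2 ∈ arc (x r.1) (x r.2) then 1 else 0 := by
  simp only [dom, arcInd]
  by_cases h2 : s.1 ∈ arc r.1 r.2 <;> by_cases h3 : s.2 ∈ arc (x r.1) (x r.2) <;> simp [h2, h3]

/-- The state at the other end of a rectangle starting at `x`. -/
abbrev move (x : State n) (r : Fin n × Fin n) : State n := x * Equiv.swap r.1 r.2

/-- The rectangles `r` from `x` and `s` from the other end of `r` are both empty. -/
def EmptyPair (x : State n) (r s : Fin n × Fin n) : Prop :=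
  IsEmptyRect x r ∧ IsEmptyRect (move x r) s

/-- The domain of a pair of consecutive rectangles. -/
def pairDom (x : State n) (r s : Fin n × Fin n) : Fin n × Fin n → ℕ := dom x r + dom (move x r) s

/-- No point of `x` outside the columns `i, j, k` is strictly inside the given rectangle. -/
def FreeOff (x : State n) (i j k a b u v : Fin n) : Prop :=
  ∀ m, m ≠ i → m ≠ j → m ≠ k → ¬ (CycBtw a m b ∧ CycBtw u (x m) v)

/-- Separates the three moving columns, where the states differ, from the others, where emptiness
depends on `x` alone. -/
theorem isEmptyRect_iff_freeOff {x y : State n} {i j k a b : Fin n}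
    (h : ∀ m, m ≠ i → m ≠ j → m ≠ k → y m = x m) :
    IsEmptyRect y (a, b) ↔ (∀ m, m = i ∨ m = j ∨ m = k → ¬ (CycBtw a m b ∧ CycBtw (y a) (y m) (y b)))
      ∧ FreeOff x i j k a b (y a) (y b) := by
  rw [isEmptyRect_iff]
  constructor
  · intro H
    refine ⟨fun m _ => H m, fun m h1 h2 h3 => ?_⟩
    rw [← h m h1 h2 h3]
    exact H m
  · rintro ⟨H1, H2⟩ m
    by_cases hm : m = i ∨ m = j ∨ m = k
    · exact H1 m hm
    · push Not at hm
      have := H2 m hm.1 hm.2.1 hm.2.2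
      rwa [← h m hm.1 hm.2.1 hm.2.2] at this

theorem FreeOff.split_col {x : State n} {i j k a b c u v : Fin n} (h : CycBtw a b c)
    (hb : b = i ∨ b = j ∨ b = k) :
    FreeOff x i j k a c u v ↔ FreeOff x i j k a b u v ∧ FreeOff x i j k b c u v := by
  have key : ∀ m, m ≠ i → m ≠ j → m ≠ k → (CycBtw a m c ↔ CycBtw a m b ∨ CycBtw b m c) := by
    intro m h1 h2 h3
    exact h.split (by rintro rfl; tauto)
  constructor
  · intro H
    refine ⟨fun m h1 h2 h3 => ?_, fun m h1 h2 h3 => ?_⟩ <;>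
    · have := H m h1 h2 h3
      rw [key m h1 h2 h3] at this
      tauto
  · rintro ⟨H1, H2⟩ m h1 h2 h3
    have := H1 m h1 h2 h3
    have := H2 m h1 h2 h3
    rw [key m h1 h2 h3]
    tauto

theorem FreeOff.split_row {x : State n} {i j k a b c u v : Fin n} (h : CycBtw (x a) (x b) (x c))
    (hb : b = i ∨ b = j ∨ b = k) :
    FreeOff x i j k u v (x a) (x c) ↔
      FreeOff x i j k u v (x a) (x b) ∧ FreeOff x i j k u v (x b) (x c) := by
  have key : ∀ m, m ≠ i → m ≠ j → m ≠ k →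
      (CycBtw (x a) (x m) (x c) ↔ CycBtw (x a) (x m) (x b) ∨ CycBtw (x b) (x m) (x c)) := by
    intro m h1 h2 h3
    exact h.split (fun hh => by have := x.injective hh; subst this; tauto)
  constructor
  · intro H
    refine ⟨fun m h1 h2 h3 => ?_, fun m h1 h2 h3 => ?_⟩ <;>
    · have := H m h1 h2 h3
      rw [key m h1 h2 h3] at this
      tauto
  · rintro ⟨H1, H2⟩ m h1 h2 h3
    have := H1 m h1 h2 h3
    have := H2 m h1 h2 h3
    rw [key m h1 h2 h3]
    tauto

/-! ### The two decompositions of an L-shaped domain. -/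

section ThreeColumns

variable {x : State n} {i j k : Fin n}

/-- Reads both conditions off the initial state: among the moving columns only the one that is not a
side of the rectangle can obstruct it. The next three lemmas treat the other ways to share one
column. -/
theorem emptyPair_right_iff (hjk : j ≠ k) (hik : i ≠ k) :
    EmptyPair x (i, j) (j, k) ↔
      (¬ (CycBtw i k j ∧ CycBtw (x i) (x k) (x j)) ∧ FreeOff x i j k i j (x i) (x j)) ∧
      (¬ (CycBtw j i k ∧ CycBtw (x i) (x j) (x k)) ∧ FreeOff x i j k j k (x i) (x k)) := by
  have hi : move x (i, j) i = x j := by simp [move]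
  have hj : move x (i, j) j = x i := by simp [move]
  have hm : ∀ m, m ≠ i → m ≠ j → move x (i, j) m = x m := fun m h1 h2 => by
    simp [move, Equiv.swap_apply_of_ne_of_ne h1 h2]
  have hk := hm k hik.symm hjk.symm
  rw [EmptyPair, isEmptyRect_iff_freeOff (x := x) (i := i) (j := j) (k := k) (fun _ _ _ _ => rfl),
    isEmptyRect_iff_freeOff (x := x) (i := i) (j := j) (k := k) (fun m h1 h2 _ => hm m h1 h2)]
  simp only [forall_eq_or_imp, forall_eq, hi, hj, hk, not_cycBtw_left, not_cycBtw_right,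
    and_false, not_false_eq_true, true_and, and_true]

theorem emptyPair_same_left_iff (hjk : j ≠ k) (hik : i ≠ k) :
    EmptyPair x (i, j) (i, k) ↔
      (¬ (CycBtw i k j ∧ CycBtw (x i) (x k) (x j)) ∧ FreeOff x i j k i j (x i) (x j)) ∧
      (¬ (CycBtw i j k ∧ CycBtw (x j) (x i) (x k)) ∧ FreeOff x i j k i k (x j) (x k)) := by
  have hi : move x (i, j) i = x j := by simp [move]
  have hj : move x (i, j) j = x i := by simp [move]
  have hm : ∀ m, m ≠ i → m ≠ j → move x (i, j) m = x m := fun m h1 h2 => by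
    simp [move, Equiv.swap_apply_of_ne_of_ne h1 h2]
  have hk := hm k hik.symm hjk.symm
  rw [EmptyPair, isEmptyRect_iff_freeOff (x := x) (i := i) (j := j) (k := k) (fun _ _ _ _ => rfl),
    isEmptyRect_iff_freeOff (x := x) (i := i) (j := j) (k := k) (fun m h1 h2 _ => hm m h1 h2)]
  simp only [forall_eq_or_imp, forall_eq, hi, hj, hk, not_cycBtw_left, not_cycBtw_right,
    and_false, not_false_eq_true, true_and, and_true]

theorem emptyPair_left_iff (hjk : j ≠ k) (hik : i ≠ k) :
    EmptyPair x (i, j) (k, i) ↔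
      (¬ (CycBtw i k j ∧ CycBtw (x i) (x k) (x j)) ∧ FreeOff x i j k i j (x i) (x j)) ∧
      (¬ (CycBtw k j i ∧ CycBtw (x k) (x i) (x j)) ∧ FreeOff x i j k k i (x k) (x j)) := by
  have hi : move x (i, j) i = x j := by simp [move]
  have hj : move x (i, j) j = x i := by simp [move]
  have hm : ∀ m, m ≠ i → m ≠ j → move x (i, j) m = x m := fun m h1 h2 => by
    simp [move, Equiv.swap_apply_of_ne_of_ne h1 h2]
  have hk := hm k hik.symm hjk.symm
  rw [EmptyPair, isEmptyRect_iff_freeOff (x := x) (i := i) (j := j) (k := k) (fun _ _ _ _ => rfl),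
    isEmptyRect_iff_freeOff (x := x) (i := i) (j := j) (k := k) (fun m h1 h2 _ => hm m h1 h2)]
  simp only [forall_eq_or_imp, forall_eq, hi, hj, hk, not_cycBtw_left, not_cycBtw_right,
    and_false, not_false_eq_true, true_and, and_true]

theorem emptyPair_same_right_iff (hjk : j ≠ k) (hik : i ≠ k) :
    EmptyPair x (i, j) (k, j) ↔
      (¬ (CycBtw i k j ∧ CycBtw (x i) (x k) (x j)) ∧ FreeOff x i j k i j (x i) (x j)) ∧
      (¬ (CycBtw k i j ∧ CycBtw (x k) (x j) (x i)) ∧ FreeOff x i j k k j (x k) (x i)) := by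
  have hi : move x (i, j) i = x j := by simp [move]
  have hj : move x (i, j) j = x i := by simp [move]
  have hm : ∀ m, m ≠ i → m ≠ j → move x (i, j) m = x m := fun m h1 h2 => by
    simp [move, Equiv.swap_apply_of_ne_of_ne h1 h2]
  have hk := hm k hik.symm hjk.symm
  rw [EmptyPair, isEmptyRect_iff_freeOff (x := x) (i := i) (j := j) (k := k) (fun _ _ _ _ => rfl),
    isEmptyRect_iff_freeOff (x := x) (i := i) (j := j) (k := k) (fun m h1 h2 _ => hm m h1 h2)]
  simp only [forall_eq_or_imp, forall_eq, hi, hj, hk, not_cycBtw_left, not_cycBtw_right,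
    and_false, not_false_eq_true, true_and, and_true]

theorem freeOff_rotate {a b u v : Fin n} :
    FreeOff x j k i a b u v ↔ FreeOff x i j k a b u v := by
  constructor <;> intro H m h1 h2 h3 <;> apply H <;> assumption

theorem freeOff_flip {a b u v : Fin n} :
    FreeOff x i k j a b u v ↔ FreeOff x i j k a b u v := by
  constructor <;> intro H m h1 h2 h3 <;> apply H <;> assumption

/-- The data of the six cyclic relations among three distinct elements. -/
theorem cycBtw_cases (hij : i ≠ j) (hjk : j ≠ k) (hik : i ≠ k) :
    (CycBtw j k i ↔ CycBtw i j k) ∧ (CycBtw k i j ↔ CycBtw i j k) ∧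
    (CycBtw i k j ↔ ¬ CycBtw i j k) ∧ (CycBtw k j i ↔ ¬ CycBtw i j k) ∧
    (CycBtw j i k ↔ ¬ CycBtw i j k) := by
  simp only [CycBtw, Fin.lt_def, Ne, Fin.ext_iff] at *
  omega

/-- The two sides are the two cuts of one L-shaped domain at its reflex corner. If the cyclic orders
of columns and rows do not fit, the third point obstructs; if they do, both cuts require the same
three subrectangles to be free. B, C and E are the other positions of the corner. -/
theorem emptyPair_exchange_A (hij : i ≠ j) (hjk : j ≠ k) (hik : i ≠ k) :
    (EmptyPair x (i, j) (j, k) ∧ CycBtw (x i) (x j) (x k)) ↔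
      (EmptyPair x (j, k) (i, k) ∧ CycBtw i j k) := by
  rw [emptyPair_right_iff hjk hik, emptyPair_same_right_iff hik.symm hij.symm]
  obtain ⟨c1, c2, c3, c4, c5⟩ := cycBtw_cases hij hjk hik
  obtain ⟨r1, r2, r3, r4, r5⟩ := cycBtw_cases (x.injective.ne hij) (x.injective.ne hjk)
    (x.injective.ne hik)
  simp only [c3, c5, r3, r5, freeOff_rotate]
  by_cases hc : CycBtw i j k <;> by_cases hr : CycBtw (x i) (x j) (x k) <;>
    simp only [hc, hr, and_true, and_false, not_true, not_false_eq_true, true_and, false_and,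
      and_self]
  rw [FreeOff.split_col hc (by simp), FreeOff.split_row hr (by simp)]
  clear c1 c2 c3 c4 c5 r1 r2 r3 r4 r5
  tauto

theorem emptyPair_exchange_B (hij : i ≠ j) (hjk : j ≠ k) (hik : i ≠ k) :
    (EmptyPair x (i, j) (j, k) ∧ ¬ CycBtw (x i) (x j) (x k)) ↔
      (EmptyPair x (i, k) (i, j) ∧ CycBtw i j k) := by
  rw [emptyPair_right_iff hjk hik, emptyPair_same_left_iff hjk.symm hij]
  obtain ⟨c1, c2, c3, c4, c5⟩ := cycBtw_cases hij hjk hik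
  obtain ⟨r1, r2, r3, r4, r5⟩ := cycBtw_cases (x.injective.ne hij) (x.injective.ne hjk)
    (x.injective.ne hik)
  simp only [c3, c5, r2, r3, freeOff_flip]
  by_cases hc : CycBtw i j k <;> by_cases hr : CycBtw (x i) (x j) (x k) <;>
    simp only [hc, hr, and_true, and_false, not_true, not_false_eq_true, true_and, false_and,
      and_self]
  rw [FreeOff.split_col hc (by simp), FreeOff.split_row (r3.mpr hr) (by simp)]
  clear c1 c2 c3 c4 c5 r1 r2 r3 r4 r5
  tauto

theorem emptyPair_exchange_C (hij : i ≠ j) (hjk : j ≠ k) (hik : i ≠ k) :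
    (EmptyPair x (i, j) (i, k) ∧ CycBtw i j k) ↔
      (EmptyPair x (j, k) (i, j) ∧ CycBtw (x i) (x j) (x k)) := by
  rw [emptyPair_left_iff hik.symm hij.symm, emptyPair_same_left_iff hjk hik]
  obtain ⟨c1, c2, c3, c4, c5⟩ := cycBtw_cases hij hjk hik
  obtain ⟨r1, r2, r3, r4, r5⟩ := cycBtw_cases (x.injective.ne hij) (x.injective.ne hjk)
    (x.injective.ne hik)
  simp only [c3, c5, r3, r5, freeOff_rotate]
  by_cases hc : CycBtw i j k <;> by_cases hr : CycBtw (x i) (x j) (x k) <;>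
    simp only [hc, hr, and_true, and_false, not_true, not_false_eq_true, true_and, false_and,
      and_self]
  rw [FreeOff.split_col hc (by simp), FreeOff.split_row hr (by simp)]
  clear c1 c2 c3 c4 c5 r1 r2 r3 r4 r5
  tauto

theorem emptyPair_exchange_E (hij : i ≠ j) (hjk : j ≠ k) (hik : i ≠ k) :
    (EmptyPair x (i, j) (k, i) ∧ ¬ CycBtw (x i) (x j) (x k)) ↔
      (EmptyPair x (k, j) (i, j) ∧ CycBtw i j k) := by
  rw [emptyPair_left_iff hjk hik, emptyPair_same_right_iff hij.symm hik.symm]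
  obtain ⟨c1, c2, c3, c4, c5⟩ := cycBtw_cases hij hjk hik
  obtain ⟨r1, r2, r3, r4, r5⟩ := cycBtw_cases (x.injective.ne hij) (x.injective.ne hjk)
    (x.injective.ne hik)
  have hflip : ∀ a b u v, FreeOff x k j i a b u v ↔ FreeOff x i j k a b u v := by
    intro a b u v
    rw [← freeOff_rotate, ← freeOff_flip, freeOff_flip, freeOff_flip]
    constructor <;> intro H m h1 h2 h3 <;> apply H <;> assumption
  simp only [c2, c3, c4, r2, r3, hflip]
  by_cases hc : CycBtw i j k <;> by_cases hr : CycBtw (x i) (x j) (x k) <;>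
    simp only [hc, hr, and_true, and_false, not_true, not_false_eq_true, true_and, false_and,
      and_self]
  rw [FreeOff.split_col (c2.mpr hc) (by simp), FreeOff.split_row (r3.mpr hr) (by simp)]
  clear c1 c2 c3 c4 c5 r1 r2 r3 r4 r5
  tauto

end ThreeColumns

section ThreeColumns

variable {x : State n} {i j k : Fin n}

theorem move_exchange_A (hij : i ≠ j) (hjk : j ≠ k) (hik : i ≠ k) :
    move (move x (i, j)) (j, k) = move (move x (j, k)) (i, k) := by
  ext m
  simp only [move, Equiv.Perm.mul_apply, Equiv.swap_apply_def]
  split_ifs <;> simp_all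

theorem move_exchange_B (hij : i ≠ j) (hjk : j ≠ k) (hik : i ≠ k) :
    move (move x (i, j)) (j, k) = move (move x (i, k)) (i, j) := by
  ext m
  simp only [move, Equiv.Perm.mul_apply, Equiv.swap_apply_def]
  split_ifs <;> simp_all

theorem move_exchange_C (hij : i ≠ j) (hjk : j ≠ k) (hik : i ≠ k) :
    move (move x (i, j)) (i, k) = move (move x (j, k)) (i, j) := by
  ext m
  simp only [move, Equiv.Perm.mul_apply, Equiv.swap_apply_def]
  split_ifs <;> simp_all

theorem move_exchange_E (hij : i ≠ j) (hjk : j ≠ k) (hik : i ≠ k) :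
    move (move x (i, j)) (k, i) = move (move x (k, j)) (i, j) := by
  ext m
  simp only [move, Equiv.Perm.mul_apply, Equiv.swap_apply_def]
  split_ifs <;> simp_all

theorem pairDom_exchange_A (hij : i ≠ j) (hik : i ≠ k)
    (hc : CycBtw i j k) (hr : CycBtw (x i) (x j) (x k)) :
    pairDom x (i, j) (j, k) = pairDom x (j, k) (i, k) := by
  funext s
  have h1 : k ≠ j := by rintro rfl; exact not_cycBtw_right _ _ hc
  simp only [pairDom, Pi.add_apply, dom, move, Equiv.Perm.mul_apply,
    Equiv.swap_apply_right, Equiv.swap_apply_of_ne_of_ne hij hik,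
    Equiv.swap_apply_of_ne_of_ne hik.symm h1, hc.arcInd_add, hr.arcInd_add]
  ring

theorem pairDom_exchange_B (hij : i ≠ j) (hik : i ≠ k)
    (hc : CycBtw i j k) (hr : CycBtw (x i) (x k) (x j)) :
    pairDom x (i, j) (j, k) = pairDom x (i, k) (i, j) := by
  funext s
  have h1 : k ≠ j := by rintro rfl; exact not_cycBtw_right _ _ hc
  simp only [pairDom, Pi.add_apply, dom, move, Equiv.Perm.mul_apply, Equiv.swap_apply_left,
    Equiv.swap_apply_right, Equiv.swap_apply_of_ne_of_ne hij.symm h1.symm,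
    Equiv.swap_apply_of_ne_of_ne hik.symm h1, hc.arcInd_add, hr.arcInd_add]
  ring

theorem pairDom_exchange_C (hij : i ≠ j) (hik : i ≠ k)
    (hc : CycBtw i j k) (hr : CycBtw (x i) (x j) (x k)) :
    pairDom x (i, j) (i, k) = pairDom x (j, k) (i, j) := by
  funext s
  have h1 : k ≠ j := by rintro rfl; exact not_cycBtw_right _ _ hc
  simp only [pairDom, Pi.add_apply, dom, move, Equiv.Perm.mul_apply, Equiv.swap_apply_left,
    Equiv.swap_apply_of_ne_of_ne hij hik,
    Equiv.swap_apply_of_ne_of_ne hik.symm h1, hc.arcInd_add, hr.arcInd_add]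
  ring

theorem pairDom_exchange_E (hij : i ≠ j) (hik : i ≠ k)
    (hc : CycBtw k i j) (hr : CycBtw (x i) (x k) (x j)) :
    pairDom x (i, j) (k, i) = pairDom x (k, j) (i, j) := by
  funext s
  have h1 : k ≠ j := by
    rintro rfl
    simp only [CycBtw, Fin.lt_def] at hc
    omega
  simp only [pairDom, Pi.add_apply, dom, move, Equiv.Perm.mul_apply, Equiv.swap_apply_left,
    Equiv.swap_apply_right, Equiv.swap_apply_of_ne_of_ne hik hij,
    Equiv.swap_apply_of_ne_of_ne hik.symm h1, hc.arcInd_add, hr.arcInd_add]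
  ring

end ThreeColumns

theorem CycBtw.right_of_not {a b c d : Fin n} (h1 : CycBtw a b c) (h2 : ¬ CycBtw a d c)
    (ha : d ≠ a) (hc : d ≠ c) : CycBtw b c d := by
  simp only [CycBtw, Fin.lt_def, Ne, Fin.ext_iff] at *
  omega

theorem CycBtw.left_of_not {a b c d : Fin n} (h1 : CycBtw a b c) (h2 : ¬ CycBtw a d c)
    (ha : d ≠ a) (hc : d ≠ c) : CycBtw d a b := by
  simp only [CycBtw, Fin.lt_def, Ne, Fin.ext_iff] at *
  omega

/-- An obstruction created by reversing the order would be a corner of one of the rectangles. As the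
other corners do not obstruct in the given order, the rectangles would overlap corner in corner, and
this produces an obstruction in the given order as well. -/
theorem EmptyPair.comm {x : State n} {i j k l : Fin n} (hki : k ≠ i) (hkj : k ≠ j)
    (hli : l ≠ i) (hlj : l ≠ j) (h : EmptyPair x (i, j) (k, l)) :
    EmptyPair x (k, l) (i, j) := by
  have hi : move x (i, j) i = x j := by simp [move]
  have hj : move x (i, j) j = x i := by simp [move]
  have hm : ∀ m, m ≠ i → m ≠ j → move x (i, j) m = x m := fun m h1 h2 => by
    simp [move, Equiv.swap_apply_of_ne_of_ne h1 h2]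
  have hk' : move x (k, l) k = x l := by simp [move]
  have hl' : move x (k, l) l = x k := by simp [move]
  have hm' : ∀ m, m ≠ k → m ≠ l → move x (k, l) m = x m := fun m h1 h2 => by
    simp [move, Equiv.swap_apply_of_ne_of_ne h1 h2]
  obtain ⟨E1, E2⟩ := h
  rw [isEmptyRect_iff] at E1 E2
  simp only [hm k hki hkj, hm l hli hlj] at E1 E2
  have xki := x.injective.ne hki
  have xkj := x.injective.ne hkj
  have xli := x.injective.ne hli
  have xlj := x.injective.ne hlj
  have E2i := E2 i
  have E2j := E2 j
  rw [hi] at E2i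
  rw [hj] at E2j
  have E1k := E1 k
  have E1l := E1 l
  constructor
  · rw [isEmptyRect_iff]
    rintro m ⟨h1, h2⟩
    dsimp only at h1 h2
    by_cases hmi : m = i
    · subst hmi
      have h3 : ¬ CycBtw k j l := fun h => E2j ⟨h, h2⟩
      have h4 : ¬ CycBtw (x k) (x j) (x l) := fun h => E2i ⟨h1, h⟩
      exact E1l ⟨h1.right_of_not h3 hkj.symm hlj.symm, h2.right_of_not h4 xkj.symm xlj.symm⟩
    by_cases hmj : m = j
    · subst hmj
      have h3 : ¬ CycBtw k i l := fun h => E2i ⟨h, h2⟩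
      have h4 : ¬ CycBtw (x k) (x i) (x l) := fun h => E2j ⟨h1, h⟩
      exact E1k ⟨h1.left_of_not h3 hki.symm hli.symm, h2.left_of_not h4 xki.symm xli.symm⟩
    have := E2 m
    rw [hm m hmi hmj] at this
    exact this ⟨h1, h2⟩
  · rw [isEmptyRect_iff]
    rintro m ⟨h1, h2⟩
    dsimp only at h1 h2
    rw [hm' i hki.symm hli.symm, hm' j hkj.symm hlj.symm] at h2
    by_cases hmk : m = k
    · subst hmk
      rw [hk'] at h2
      have h3 : ¬ CycBtw i l j := fun h => E1l ⟨h, h2⟩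
      have h4 : ¬ CycBtw (x i) (x m) (x j) := fun h => E1k ⟨h1, h⟩
      exact E2j ⟨h1.right_of_not h3 hli hlj, h2.left_of_not h4 xki xkj⟩
    by_cases hml : m = l
    · subst hml
      rw [hl'] at h2
      have h3 : ¬ CycBtw i k j := fun h => E1k ⟨h, h2⟩
      have h4 : ¬ CycBtw (x i) (x m) (x j) := fun h => E1l ⟨h1, h⟩
      exact E2i ⟨h1.left_of_not h3 hki hkj, h2.right_of_not h4 xli xlj⟩
    rw [hm' m hmk hml] at h2
    exact E1 m ⟨h1, h2⟩

theorem pairDom_comm {x : State n} {i j k l : Fin n} (hki : k ≠ i) (hkj : k ≠ j)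
    (hli : l ≠ i) (hlj : l ≠ j) : pairDom x (i, j) (k, l) = pairDom x (k, l) (i, j) := by
  funext s
  simp only [pairDom, Pi.add_apply, dom, move, Equiv.Perm.mul_apply,
    Equiv.swap_apply_of_ne_of_ne hki hkj, Equiv.swap_apply_of_ne_of_ne hli hlj,
    Equiv.swap_apply_of_ne_of_ne hki.symm hli.symm, Equiv.swap_apply_of_ne_of_ne hkj.symm hlj.symm]
  ring

theorem move_comm {x : State n} {i j k l : Fin n} (hki : k ≠ i) (hkj : k ≠ j)
    (hli : l ≠ i) (hlj : l ≠ j) : move (move x (i, j)) (k, l) = move (move x (k, l)) (i, j) := by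
  ext m
  simp only [move, Equiv.Perm.mul_apply, Equiv.swap_apply_def]
  split_ifs <;> simp_all

/-! ### Thin annuli. -/

section Annuli

/-- The cyclic successor. -/
def next (i : Fin n) : Fin n :=
  if h : i.val + 1 < n then ⟨i.val + 1, h⟩ else ⟨0, by have := i.isLt; omega⟩

theorem val_next (i : Fin n) : (next i).val = if i.val + 1 < n then i.val + 1 else 0 := by
  unfold next
  split_ifs <;> rfl

theorem next_ne (hn : 2 ≤ n) (i : Fin n) : i ≠ next i := by
  rw [Ne, Fin.ext_iff, val_next]
  have := i.isLt
  split_ifs <;> omega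

theorem forall_not_cycBtw_iff {i j : Fin n} (hij : i ≠ j) :
    (∀ k, ¬ CycBtw i k j) ↔ j = next i := by
  have hi := i.isLt
  have hj := j.isLt
  constructor
  · intro h
    have := h (next i)
    rw [Fin.ext_iff, val_next]
    simp only [CycBtw, Fin.lt_def, val_next, Ne, Fin.ext_iff] at *
    split_ifs at * <;> omega
  · rintro h k
    have hk := k.isLt
    rw [Fin.ext_iff, val_next] at h
    simp only [CycBtw, Fin.lt_def, Ne, Fin.ext_iff] at *
    split_ifs at * <;> omega

theorem arcInd_next (hn : 2 ≤ n) (i m : Fin n) :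
    arcInd i (next i) m = if m = i then 1 else 0 := by
  have h : m ∈ arc i (next i) ↔ m = i := by
    rw [mem_arc]
    have hi := i.isLt
    have hm := m.isLt
    simp only [Fin.le_def, Fin.lt_def, Fin.ext_iff, val_next]
    split_ifs <;> omega
  simp only [arcInd, h]

variable {x : State n} {i j : Fin n}

/-- The two rectangles have the same columns and complementary rows, so together they contain every
point in a column strictly between `i` and `j`. In `emptyPair_flip_iff` rows and columns change
roles. -/
theorem emptyPair_self_iff (hij : i ≠ j) : EmptyPair x (i, j) (i, j) ↔ j = next i := by
  have hi : move x (i, j) i = x j := by simp [move]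
  have hj : move x (i, j) j = x i := by simp [move]
  have hm : ∀ m, m ≠ i → m ≠ j → move x (i, j) m = x m := fun m h1 h2 => by
    simp [move, Equiv.swap_apply_of_ne_of_ne h1 h2]
  rw [← forall_not_cycBtw_iff hij, EmptyPair, isEmptyRect_iff, isEmptyRect_iff, ← forall_and]
  refine forall_congr' fun m => ?_
  by_cases hmi : m = i
  · subst hmi
    simp [not_cycBtw_left]
  by_cases hmj : m = j
  · subst hmj
    simp [not_cycBtw_right]
  simp only [hi, hj, hm m hmi hmj]
  have h1 : CycBtw (x j) (x m) (x i) ↔ ¬ CycBtw (x i) (x m) (x j) := by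
    have a1 := x.injective.ne hmi
    have a2 := x.injective.ne hmj
    have a3 := x.injective.ne hij
    simp only [CycBtw, Fin.lt_def, Ne, Fin.ext_iff] at *
    omega
  rw [h1]
  tauto

theorem emptyPair_flip_iff (hij : i ≠ j) : EmptyPair x (i, j) (j, i) ↔ x j = next (x i) := by
  have hi : move x (i, j) i = x j := by simp [move]
  have hj : move x (i, j) j = x i := by simp [move]
  have hm : ∀ m, m ≠ i → m ≠ j → move x (i, j) m = x m := fun m h1 h2 => by
    simp [move, Equiv.swap_apply_of_ne_of_ne h1 h2]
  have hs : (∀ k, ¬ CycBtw (x i) k (x j)) ↔ ∀ m, ¬ CycBtw (x i) (x m) (x j) := x.surjective.forall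
  rw [← forall_not_cycBtw_iff (x.injective.ne hij), hs, EmptyPair, isEmptyRect_iff, isEmptyRect_iff,
    ← forall_and]
  refine forall_congr' fun m => ?_
  by_cases hmi : m = i
  · subst hmi
    simp [not_cycBtw_left, not_cycBtw_right]
  by_cases hmj : m = j
  · subst hmj
    simp [not_cycBtw_left, not_cycBtw_right]
  simp only [hi, hj, hm m hmi hmj]
  have h1 : CycBtw j m i ↔ ¬ CycBtw i m j := by
    simp only [CycBtw, Fin.lt_def, Ne, Fin.ext_iff] at *
    omega
  rw [h1]
  tauto

/-- The vertical annulus over the column `i`. -/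
def colAnnulus (i : Fin n) (s : Fin n × Fin n) : ℕ := if s.1 = i then 1 else 0

/-- The horizontal annulus over the row `i`. -/
def rowAnnulus (i : Fin n) (s : Fin n × Fin n) : ℕ := if s.2 = i then 1 else 0

theorem pairDom_self (hn : 2 ≤ n) : pairDom x (i, next i) (i, next i) = colAnnulus i := by
  funext s
  have := arcInd_add_arcInd (x.injective.ne (next_ne hn i)) s.2
  simp only [pairDom, Pi.add_apply, dom, move, Equiv.Perm.mul_apply, Equiv.swap_apply_left,
    Equiv.swap_apply_right, ← mul_add, this, colAnnulus, arcInd_next hn, mul_one]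

theorem pairDom_flip (hn : 2 ≤ n) (hij : i ≠ j) (h : x j = next (x i)) :
    pairDom x (i, j) (j, i) = rowAnnulus (x i) := by
  funext s
  have := arcInd_add_arcInd hij s.1
  simp only [pairDom, Pi.add_apply, dom, move, Equiv.Perm.mul_apply, Equiv.swap_apply_left,
    Equiv.swap_apply_right, ← add_mul, this, rowAnnulus, h, arcInd_next hn, one_mul]

end Annuli

/-! ### Cancellation among pairs of consecutive rectangles. -/

section Composition

open Classical in
/-- The contribution of the pair of rectangles `(i, j)`, `(k, l)` from `x`. -/
noncomputable def pairTerm (F : (Fin n × Fin n → ℕ) → ZMod 2) (c : State n → ZMod 2) (x : State n)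
    (i j k l : Fin n) : ZMod 2 :=
  if (i ≠ j ∧ k ≠ l) ∧ EmptyPair x (i, j) (k, l) then
    F (pairDom x (i, j) (k, l)) * c (move (move x (i, j)) (k, l)) else 0

variable (F : (Fin n × Fin n → ℕ) → ZMod 2) (c : State n → ZMod 2) (x : State n)

theorem pairTerm_comm {i j k l : Fin n} (hki : k ≠ i) (hkj : k ≠ j)
    (hli : l ≠ i) (hlj : l ≠ j) : pairTerm F c x i j k l = pairTerm F c x k l i j := by
  have h : EmptyPair x (i, j) (k, l) ↔ EmptyPair x (k, l) (i, j) :=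
    ⟨EmptyPair.comm hki hkj hli hlj, EmptyPair.comm hki.symm hli.symm hkj.symm hlj.symm⟩
  have h' : ((i ≠ j ∧ k ≠ l) ∧ EmptyPair x (i, j) (k, l)) ↔
      ((k ≠ l ∧ i ≠ j) ∧ EmptyPair x (k, l) (i, j)) := and_congr and_comm h
  simp only [pairTerm, pairDom_comm hki hkj hli hlj, move_comm hki hkj hli hlj]
  by_cases hp : (i ≠ j ∧ k ≠ l) ∧ EmptyPair x (i, j) (k, l)
  · rw [if_pos hp, if_pos (h'.mp hp)]
  · rw [if_neg hp, if_neg (fun hq => hp (h'.mpr hq))]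

open Classical in
theorem sum_pairTerm_three {i j k : Fin n} (hij : i ≠ j) (hjk : j ≠ k) (hik : i ≠ k) :
    (if CycBtw (x i) (x j) (x k) then pairTerm F c x i j j k else 0) =
      (if CycBtw i j k then pairTerm F c x j k i k else 0) ∧
    (if CycBtw (x i) (x j) (x k) then 0 else pairTerm F c x i j j k) =
      (if CycBtw i j k then pairTerm F c x i k i j else 0) ∧
    (if CycBtw i j k then pairTerm F c x i j i k else 0) =
      (if CycBtw (x i) (x j) (x k) then pairTerm F c x j k i j else 0) ∧
    (if CycBtw (x i) (x j) (x k) then 0 else pairTerm F c x i j k i) =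
      (if CycBtw i j k then pairTerm F c x k j i j else 0) := by
  have hA := emptyPair_exchange_A (x := x) hij hjk hik
  have hB := emptyPair_exchange_B (x := x) hij hjk hik
  have hC := emptyPair_exchange_C (x := x) hij hjk hik
  have hE := emptyPair_exchange_E (x := x) hij hjk hik
  have hr : ¬ CycBtw (x i) (x j) (x k) → CycBtw (x i) (x k) (x j) :=
    (CycBtw.swap_iff (x.injective.ne hij) (x.injective.ne hjk) (x.injective.ne hik)).mpr
  have hrot : CycBtw i j k → CycBtw k i j := CycBtw.rotate.mp
  simp only [pairTerm, ne_eq, hij, hjk, hik, hjk.symm, hik.symm, not_false_eq_true, and_self, true_and,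
    move_exchange_A hij hjk hik, move_exchange_C hij hjk hik,
    move_exchange_E hij hjk hik]
  rw [← move_exchange_A hij hjk hik, ← move_exchange_B hij hjk hik]
  refine ⟨?_, ?_, ?_, ?_⟩
  · by_cases h1 : CycBtw i j k <;> by_cases h2 : CycBtw (x i) (x j) (x k) <;>
      simp only [h1, h2, if_true, if_false, and_true, and_false, iff_false, false_iff] at hA ⊢
    · simp only [hA, pairDom_exchange_A hij hik h1 h2]
    · simp only [hA, if_false]
    · simp only [hA, if_false]
  · by_cases h1 : CycBtw i j k <;> by_cases h2 : CycBtw (x i) (x j) (x k) <;>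
      simp only [h1, h2, if_true, if_false, and_true, and_false, iff_false, false_iff, not_true,
        not_false_eq_true] at hB ⊢
    · simp only [hB, if_false]
    · simp only [hB, pairDom_exchange_B hij hik h1 (hr h2)]
    · simp only [hB, if_false]
  · by_cases h1 : CycBtw i j k <;> by_cases h2 : CycBtw (x i) (x j) (x k) <;>
      simp only [h1, h2, if_true, if_false, and_true, and_false, iff_false, false_iff] at hC ⊢
    · simp only [hC, pairDom_exchange_C hij hik h1 h2]
    · simp only [hC, if_false]
    · simp only [hC, if_false]
  · by_cases h1 : CycBtw i j k <;> by_cases h2 : CycBtw (x i) (x j) (x k) <;>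
      simp only [h1, h2, if_true, if_false, and_true, and_false, iff_false, false_iff, not_true,
        not_false_eq_true] at hE ⊢
    · simp only [hE, if_false]
    · simp only [hE, pairDom_exchange_E hij hik (hrot h1) (hr h2)]
    · simp only [hE, if_false]

theorem sum_symm_eq_zero {P : Type*} [Fintype P] (u : P → P → ZMod 2)
    (h1 : ∀ p q, u p q = u q p) (h2 : ∀ p, u p p = 0) : ∑ p, ∑ q, u p q = 0 := by
  classical
  rw [← Fintype.sum_prod_type']
  refine Finset.sum_involution (fun a _ => a.swap) ?_ ?_ (fun _ _ => Finset.mem_univ _)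
    (fun a _ => a.swap_swap)
  · rintro ⟨p, q⟩ _
    simp only [Prod.swap_prod_mk, h1 q p]
    exact CharTwo.add_self_eq_zero _
  · rintro ⟨p, q⟩ _ h3 h4
    simp only [Prod.swap_prod_mk, Prod.mk.injEq] at h4
    rw [h4.1, h2] at h3
    exact h3 rfl

theorem sum_rotate (f : Fin n → Fin n → Fin n → ZMod 2) :
    ∑ i, ∑ j, ∑ k, f j k i = ∑ i, ∑ j, ∑ k, f i j k := by
  rw [Finset.sum_comm]
  exact Finset.sum_congr rfl fun j _ => Finset.sum_comm

theorem sum_flip (f : Fin n → Fin n → Fin n → ZMod 2) :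
    ∑ i, ∑ j, ∑ k, f i k j = ∑ i, ∑ j, ∑ k, f i j k :=
  Finset.sum_congr rfl fun _ _ => Finset.sum_comm

/-- The three columns are distinct. -/
def Distinct3 (i j k : Fin n) : Prop := i ≠ j ∧ j ≠ k ∧ i ≠ k

-- Two rectangles can share exactly one column in four ways. Each splits in two by the cyclic order
-- of the rows or of the columns, and the exchanges A, B, C, E match the eight classes in pairs up
-- to relabelling, so the sum cancels modulo 2.
open Classical in
theorem sum_three_eq_zero (F : (Fin n × Fin n → ℕ) → ZMod 2) (c : State n → ZMod 2)
    (x : State n) :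
    ∑ i, ∑ j, ∑ k, (if Distinct3 i j k then pairTerm F c x i j j k + pairTerm F c x i j i k +
      pairTerm F c x i j k i + pairTerm F c x i j k j else 0) = 0 := by
  set a1 : Fin n → Fin n → Fin n → ZMod 2 := fun i j k => if Distinct3 i j k then
    (if CycBtw (x i) (x j) (x k) then pairTerm F c x i j j k else 0) else 0 with ha1
  set a2 : Fin n → Fin n → Fin n → ZMod 2 := fun i j k => if Distinct3 i j k then
    (if CycBtw (x i) (x j) (x k) then 0 else pairTerm F c x i j j k) else 0 with ha2
  set b1 : Fin n → Fin n → Fin n → ZMod 2 := fun i j k => if Distinct3 i j k then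
    (if CycBtw i j k then pairTerm F c x i j i k else 0) else 0 with hb1
  set b2 : Fin n → Fin n → Fin n → ZMod 2 := fun i j k => if Distinct3 i j k then
    (if CycBtw i j k then 0 else pairTerm F c x i j i k) else 0 with hb2
  set c1 : Fin n → Fin n → Fin n → ZMod 2 := fun i j k => if Distinct3 i j k then
    (if CycBtw (x i) (x j) (x k) then pairTerm F c x i j k i else 0) else 0 with hc1
  set c2 : Fin n → Fin n → Fin n → ZMod 2 := fun i j k => if Distinct3 i j k then
    (if CycBtw (x i) (x j) (x k) then 0 else pairTerm F c x i j k i) else 0 with hc2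
  set d1 : Fin n → Fin n → Fin n → ZMod 2 := fun i j k => if Distinct3 i j k then
    (if CycBtw i j k then pairTerm F c x i j k j else 0) else 0 with hd1
  set d2 : Fin n → Fin n → Fin n → ZMod 2 := fun i j k => if Distinct3 i j k then
    (if CycBtw i j k then 0 else pairTerm F c x i j k j) else 0 with hd2
  have rot : ∀ i j k : Fin n, Distinct3 j k i ↔ Distinct3 i j k := by
    intro i j k; simp only [Distinct3]; tauto
  have flp : ∀ i j k : Fin n, Distinct3 i k j ↔ Distinct3 i j k := by
    intro i j k; simp only [Distinct3]; tauto
  have e1 : ∀ i j k, a1 i j k = d1 j k i := by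
    intro i j k
    simp only [ha1, hd1, rot i j k]
    by_cases h : Distinct3 i j k
    · simp only [h, if_true, CycBtw.rotate (a := i) (b := j) (c := k)]
      exact (sum_pairTerm_three F c x h.1 h.2.1 h.2.2).1
    · simp only [h, if_false]
  have e2 : ∀ i j k, a2 i j k = b2 i k j := by
    intro i j k
    simp only [ha2, hb2, flp i j k]
    by_cases h : Distinct3 i j k
    · simp only [h, if_true, CycBtw.swap_iff h.1 h.2.1 h.2.2, ite_not]
      exact (sum_pairTerm_three F c x h.1 h.2.1 h.2.2).2.1
    · simp only [h, if_false]
  have e3 : ∀ i j k, b1 i j k = c1 j k i := by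
    intro i j k
    simp only [hb1, hc1, rot i j k]
    by_cases h : Distinct3 i j k
    · simp only [h, if_true, CycBtw.rotate (a := x i) (b := x j) (c := x k)]
      exact (sum_pairTerm_three F c x h.1 h.2.1 h.2.2).2.2.1
    · simp only [h, if_false]
  have e4 : ∀ i j k, c2 i j k = d2 k j i := by
    intro i j k
    have hd : Distinct3 k j i ↔ Distinct3 i j k := by simp only [Distinct3]; tauto
    simp only [hc2, hd2, hd]
    by_cases h : Distinct3 i j k
    · have h5 : CycBtw k j i ↔ ¬ CycBtw i j k := (cycBtw_cases h.1 h.2.1 h.2.2).2.2.2.1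
      simp only [h, if_true, h5, ite_not]
      exact (sum_pairTerm_three F c x h.1 h.2.1 h.2.2).2.2.2
    · simp only [h, if_false]
  have tot : ∀ i j k, (if Distinct3 i j k then pairTerm F c x i j j k + pairTerm F c x i j i k +
      pairTerm F c x i j k i + pairTerm F c x i j k j else 0) =
      (a1 i j k + a2 i j k) + (b1 i j k + b2 i j k) + (c1 i j k + c2 i j k) +
        (d1 i j k + d2 i j k) := by
    intro i j k
    simp only [ha1, ha2, hb1, hb2, hc1, hc2, hd1, hd2]
    split_ifs <;> ring
  simp only [tot, Finset.sum_add_distrib]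
  simp only [e1, e2, e3, e4]
  rw [sum_rotate d1, sum_flip b2, sum_rotate c1]
  have h4 : ∑ i, ∑ j, ∑ k, d2 k j i = ∑ i, ∑ j, ∑ k, d2 i j k :=
    (sum_flip (fun a b c => d2 b c a)).trans (sum_rotate d2)
  rw [h4]
  generalize ∑ i, ∑ j, ∑ k, d1 i j k = D1
  generalize ∑ i, ∑ j, ∑ k, d2 i j k = D2
  generalize ∑ i, ∑ j, ∑ k, b2 i j k = B2
  generalize ∑ i, ∑ j, ∑ k, c1 i j k = C1
  have := CharTwo.add_self_eq_zero (D1 + B2 + C1 + D2)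
  rw [← this]
  ring

-- With the same pair of columns one returns to `x`. In equal order this forces adjacent columns, in
-- opposite order adjacent rows; the domain is then a thin annulus, and each annulus arises once.
open Classical in
theorem sum_pairTerm_two (F : (Fin n × Fin n → ℕ) → ZMod 2) (c : State n → ZMod 2) (x : State n)
    (hn : 2 ≤ n) :
    ∑ i, ∑ j, (pairTerm F c x i j i j + pairTerm F c x i j j i) =
      (∑ i, F (colAnnulus i) + ∑ i, F (rowAnnulus i)) * c x := by
  have hmm : ∀ i j, move (move x (i, j)) (i, j) = x := fun i j => by
    simp [move, mul_assoc]
  have hmm' : ∀ i j, move (move x (i, j)) (j, i) = x := fun i j => by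
    simp [move, mul_assoc, Equiv.swap_comm j i]
  have h1 : ∀ i j, pairTerm F c x i j i j = if j = next i then F (colAnnulus i) * c x else 0 := by
    intro i j
    by_cases hij : i = j
    · subst hij
      simp [pairTerm, next_ne hn i]
    · simp only [pairTerm, ne_eq, hij, not_false_eq_true, and_self, true_and,
        emptyPair_self_iff hij, hmm]
      split_ifs with h
      · rw [h, pairDom_self hn]
      · rfl
  have h2 : ∀ i j, pairTerm F c x i j j i =
      if j = x.symm (next (x i)) then F (rowAnnulus (x i)) * c x else 0 := by
    intro i j
    simp only [Equiv.eq_symm_apply]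
    by_cases hij : i = j
    · subst hij
      simp [pairTerm, next_ne hn (x i)]
    · simp only [pairTerm, ne_eq, hij, Ne.symm hij, not_false_eq_true, and_self, true_and,
        emptyPair_flip_iff hij, hmm']
      split_ifs with h
      · rw [pairDom_flip hn hij h]
      · rfl
  simp only [h1, h2, Finset.sum_add_distrib, Finset.sum_ite_eq', Finset.mem_univ, if_true,
    add_mul, Finset.sum_mul]
  rw [Equiv.sum_comp x (fun i => F (rowAnnulus i) * c x)]

/-- The sum over all pairs of consecutive empty rectangles of a function of their domain: only the
annuli contribute. -/
theorem sum_pairTerm (F : (Fin n × Fin n → ℕ) → ZMod 2) (c : State n → ZMod 2) (x : State n)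
    (hn : 2 ≤ n) :
    ∑ i, ∑ j, ∑ k, ∑ l, pairTerm F c x i j k l =
      (∑ i, F (colAnnulus i) + ∑ i, F (rowAnnulus i)) * c x := by
  classical
  set u : Fin n × Fin n → Fin n × Fin n → ZMod 2 := fun p q =>
    if q.1 ≠ p.1 ∧ q.1 ≠ p.2 ∧ q.2 ≠ p.1 ∧ q.2 ≠ p.2 then
      pairTerm F c x p.1 p.2 q.1 q.2 else 0 with hu
  have hu0 : ∑ p, ∑ q, u p q = 0 := by
    refine sum_symm_eq_zero u (fun p q => ?_) (fun p => by simp [hu])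
    simp only [hu]
    by_cases h : q.1 ≠ p.1 ∧ q.1 ≠ p.2 ∧ q.2 ≠ p.1 ∧ q.2 ≠ p.2
    · have h' : p.1 ≠ q.1 ∧ p.1 ≠ q.2 ∧ p.2 ≠ q.1 ∧ p.2 ≠ q.2 :=
        ⟨h.1.symm, h.2.2.1.symm, h.2.1.symm, h.2.2.2.symm⟩
      rw [if_pos h, if_pos h']
      exact pairTerm_comm F c x h.1 h.2.1 h.2.2.1 h.2.2.2
    · have h' : ¬ (p.1 ≠ q.1 ∧ p.1 ≠ q.2 ∧ p.2 ≠ q.1 ∧ p.2 ≠ q.2) := fun h' =>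
        h ⟨h'.1.symm, h'.2.2.1.symm, h'.2.1.symm, h'.2.2.2.symm⟩
      rw [if_neg h, if_neg h']
  simp only [Fintype.sum_prod_type] at hu0
  have z1 : ∀ i k l, pairTerm F c x i i k l = 0 := by intros; simp [pairTerm]
  have z2 : ∀ i j k, pairTerm F c x i j k k = 0 := by intros; simp [pairTerm]
  -- The three groups of terms are the cases in which the second rectangle shares none, one or both
  -- of the columns `i`, `j`.
  have split : ∀ i j k l, pairTerm F c x i j k l = u (i, j) (k, l) +
      ((if k = j then (if Distinct3 i j l then pairTerm F c x i j j l else 0) else 0) +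
      (if k = i then (if Distinct3 i j l then pairTerm F c x i j i l else 0) else 0) +
      (if l = i then (if Distinct3 i j k then pairTerm F c x i j k i else 0) else 0) +
      (if l = j then (if Distinct3 i j k then pairTerm F c x i j k j else 0) else 0)) +
      ((if k = i then (if l = j then pairTerm F c x i j i j else 0) else 0) +
      (if k = j then (if l = i then pairTerm F c x i j j i else 0) else 0)) := by
    intro i j k l
    simp only [hu, Distinct3]
    by_cases hij : i = j
    · subst hij
      simp [z1]
    by_cases hkl : k = l
    · subst hkl
      by_cases h1 : k = i
      · subst h1; simp [z2, hij]
      · by_cases h2 : k = j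
        · subst h2; simp [z2, hij, Ne.symm hij]
        · simp [z2, h1, h2]
    by_cases h1 : k = i
    · subst h1
      by_cases h4 : l = j
      · subst h4; simp [hij]
      · simp [hij, h4, Ne.symm hkl, Ne.symm h4, hkl]
    · by_cases h2 : k = j
      · subst h2
        by_cases h3 : l = i
        · subst h3; simp [hkl, hij]
        · simp [hij, h1, h3, hkl, Ne.symm hkl, Ne.symm h3]
      · by_cases h3 : l = i
        · subst h3; simp [hij, h1, h2, Ne.symm h1, Ne.symm h2]
        · by_cases h4 : l = j
          · subst h4; simp [hij, h1, h2, h3, Ne.symm h1, Ne.symm h2]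
          · simp [h1, h2, h3, h4]
  have s1 : ∀ (a : Fin n) (h : Fin n → ZMod 2),
      ∑ k, ∑ l, (if k = a then h l else 0) = ∑ l, h l := by
    intro a h
    rw [Finset.sum_comm]
    simp
  rw [Finset.sum_congr rfl fun i _ => Finset.sum_congr rfl fun j _ => Finset.sum_congr rfl
    fun k _ => Finset.sum_congr rfl fun l _ => split i j k l]
  simp only [Finset.sum_add_distrib, s1, hu0, zero_add, Finset.sum_ite_eq',
    Finset.mem_univ, if_true]
  rw [← sum_pairTerm_two F c x hn]
  simp only [Finset.sum_add_distrib]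
  rw [add_eq_right]
  refine Eq.trans ?_ (sum_three_eq_zero F c x)
  simp only [← Finset.sum_add_distrib]
  refine Finset.sum_congr rfl fun i _ => Finset.sum_congr rfl fun j _ =>
    Finset.sum_congr rfl fun k _ => ?_
  split_ifs <;> simp

end Composition

/-! ### Weighted incidence matrices and their commutation relations. -/

open Classical in
/-- The matrix whose entry at `(x, y)` is the sum of `φ` over the domains of all empty rectangles
from `x` to `y`. -/
noncomputable def rectMatrix (φ : (Fin n × Fin n → ℕ) → ZMod 2) :
    Matrix (State n) (State n) (ZMod 2) :=
  fun x y => ∑ r ∈ (rect x y).filter (IsEmptyRect x), φ (dom x r)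

open Classical in
theorem sum_rectMatrix_mul (φ : (Fin n × Fin n → ℕ) → ZMod 2) (x : State n)
    (g : State n → ZMod 2) :
    ∑ y, rectMatrix φ x y * g y =
      ∑ i, ∑ j, if i ≠ j ∧ IsEmptyRect x (i, j) then φ (dom x (i, j)) * g (move x (i, j)) else 0 := by
  have h1 : ∀ y, rectMatrix φ x y * g y = ∑ r : Fin n × Fin n,
      if y = move x r then
        (if r.1 ≠ r.2 ∧ IsEmptyRect x r then φ (dom x r) * g (move x r) else 0) else 0 := by
    intro y
    rw [rectMatrix, Finset.sum_mul, rect, Finset.filter_filter, Finset.sum_filter]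
    refine Finset.sum_congr rfl fun r _ => ?_
    by_cases h2 : y = move x r
    · subst h2
      simp [move]
    · rw [if_neg h2, if_neg]
      rintro ⟨⟨_, h3⟩, _⟩
      exact h2 h3
  simp only [h1]
  rw [Finset.sum_comm]
  simp only [Finset.sum_ite_eq', Finset.mem_univ, if_true]
  rw [Fintype.sum_prod_type]

/-- The common source of the relations below: once the weights of a pair combine to a function of
the total domain, only the annuli survive. -/
theorem rectMatrix_comp {ι : Type*} [Fintype ι] (hn : 2 ≤ n)
    (φ ψ : ι → (Fin n × Fin n → ℕ) → ZMod 2) (F : (Fin n × Fin n → ℕ) → ZMod 2)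
    (h : ∀ D E : Fin n × Fin n → ℕ, (∀ s, D s ≤ 1) → (∀ s, E s ≤ 1) →
      ∑ a, φ a D * ψ a E = F (D + E)) :
    ∑ a, rectMatrix (φ a) * rectMatrix (ψ a) =
      (∑ i, F (colAnnulus i) + ∑ i, F (rowAnnulus i)) • (1 : Matrix (State n) (State n) (ZMod 2)) := by
  classical
  have hd : ∀ (x : State n) r s, dom x r s ≤ 1 := by
    intro x r s
    rw [dom_eq_ite]
    split_ifs <;> simp
  ext x z
  have key := sum_pairTerm F (Pi.single z 1) x hn
  rw [Matrix.smul_apply, smul_eq_mul, Matrix.one_apply]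
  rw [Pi.single_apply] at key
  rw [← key]
  rw [Matrix.sum_apply]
  simp only [Matrix.mul_apply]
  have h2 : ∀ a, ∑ y, rectMatrix (φ a) x y * rectMatrix (ψ a) y z =
      ∑ i, ∑ j, ∑ k, ∑ l, if (i ≠ j ∧ k ≠ l) ∧ EmptyPair x (i, j) (k, l) then
        (φ a (dom x (i, j)) * ψ a (dom (move x (i, j)) (k, l))) *
          (Pi.single z 1 : State n → ZMod 2) (move (move x (i, j)) (k, l)) else 0 := by
    intro a
    have h3 : ∀ y, rectMatrix (ψ a) y z =
        ∑ w, rectMatrix (ψ a) y w * (Pi.single z 1 : State n → ZMod 2) w := by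
      intro y
      simp [Pi.single_apply]
    rw [sum_rectMatrix_mul]
    refine Finset.sum_congr rfl fun i _ => Finset.sum_congr rfl fun j _ => ?_
    rw [h3, sum_rectMatrix_mul]
    by_cases h4 : i ≠ j ∧ IsEmptyRect x (i, j)
    · rw [if_pos h4, Finset.mul_sum]
      refine Finset.sum_congr rfl fun k _ => ?_
      rw [Finset.mul_sum]
      refine Finset.sum_congr rfl fun l _ => ?_
      simp only [EmptyPair, ne_eq, h4.1, h4.2, not_false_eq_true, true_and, mul_ite, mul_zero,
        mul_assoc]
    · rw [if_neg h4, eq_comm]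
      refine Finset.sum_eq_zero fun k _ => Finset.sum_eq_zero fun l _ => if_neg ?_
      rintro ⟨⟨h5, _⟩, h6, _⟩
      exact h4 ⟨h5, h6⟩
  simp only [h2]
  rw [Finset.sum_comm]
  refine Finset.sum_congr rfl fun i _ => ?_
  rw [Finset.sum_comm]
  refine Finset.sum_congr rfl fun j _ => ?_
  rw [Finset.sum_comm]
  refine Finset.sum_congr rfl fun k _ => ?_
  rw [Finset.sum_comm]
  refine Finset.sum_congr rfl fun l _ => ?_
  rw [pairTerm]
  split_ifs with h4
  · rw [← Finset.sum_mul, h _ _ (hd _ _) (hd _ _)]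
    rfl
  · simp

open Classical in
/-- The indicator of the domains without a square of `S`. -/
noncomputable def avoidWeight (S : State n) (D : Fin n × Fin n → ℕ) : ZMod 2 :=
  if ∀ k, D (k, S k) = 0 then 1 else 0

open Classical in
/-- The indicator of the domains whose only square in `S` is the one in column `j`. -/
noncomputable def hitWeight (S : State n) (j : Fin n) (D : Fin n × Fin n → ℕ) : ZMod 2 :=
  if D (j, S j) = 1 ∧ ∀ k, k ≠ j → D (k, S k) = 0 then 1 else 0

theorem avoidWeight_add (S : State n) (D E : Fin n × Fin n → ℕ) :
    avoidWeight S (D + E) = avoidWeight S D * avoidWeight S E := by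
  simp only [avoidWeight, Pi.add_apply, Nat.add_eq_zero_iff, forall_and]
  split_ifs <;> simp_all

/-- A single hit of the total domain belongs to exactly one summand, which gives a Leibniz rule over
`avoidWeight`. -/
theorem hitWeight_add (S : State n) (j : Fin n) (D E : Fin n × Fin n → ℕ) :
    hitWeight S j (D + E) = hitWeight S j D * avoidWeight S E + avoidWeight S D * hitWeight S j E := by
  classical
  have h : ∀ D : Fin n × Fin n → ℕ, (∀ k, D (k, S k) = 0) ↔
      (D (j, S j) = 0 ∧ ∀ k, k ≠ j → D (k, S k) = 0) := by
    intro D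
    refine ⟨fun h => ⟨h j, fun k _ => h k⟩, fun h k => ?_⟩
    by_cases hk : k = j
    · rw [hk]; exact h.1
    · exact h.2 k hk
  simp only [hitWeight, avoidWeight, h, Pi.add_apply, Nat.add_eq_zero_iff]
  have h3 : (∀ k, k ≠ j → D (k, S k) = 0 ∧ E (k, S k) = 0) ↔
      (∀ k, k ≠ j → D (k, S k) = 0) ∧ ∀ k, k ≠ j → E (k, S k) = 0 :=
    ⟨fun h => ⟨fun k hk => (h k hk).1, fun k hk => (h k hk).2⟩,
      fun h k hk => ⟨h.1 k hk, h.2 k hk⟩⟩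
  simp only [h3]
  rcases Classical.propComplete (∀ k, k ≠ j → D (k, S k) = 0) with h1 | h1 <;>
    rcases Classical.propComplete (∀ k, k ≠ j → E (k, S k) = 0) with h2 | h2 <;>
    simp only [h1, h2, and_true, and_false, if_false, mul_zero, zero_mul, add_zero]
  rcases Nat.eq_zero_or_pos (D (j, S j)) with hD | hD
  · simp [hD]
  · rcases Nat.eq_zero_or_pos (E (j, S j)) with hE | hE
    · simp [hE, hD.ne']
    · have : ¬ (D (j, S j) + E (j, S j) = 1) := by omega
      simp [this, hD.ne', hE.ne']

/-- The incidence matrix of the empty rectangles that avoid `S`. -/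
noncomputable def avoidMatrix (S : State n) : Matrix (State n) (State n) (ZMod 2) :=
  rectMatrix (avoidWeight S)

/-- The incidence matrix of the empty rectangles whose only square in `S` is in column `j`. -/
noncomputable def hitMatrix (S : State n) (j : Fin n) : Matrix (State n) (State n) (ZMod 2) :=
  rectMatrix (hitWeight S j)

/-- The incidence matrix of the empty rectangles that avoid `S` and contain the square `s`. -/
noncomputable def throughMatrix (S : State n) (s : Fin n × Fin n) :
    Matrix (State n) (State n) (ZMod 2) :=
  rectMatrix fun D => avoidWeight S D * (D s : ZMod 2)

/-- The incidence matrix of the empty rectangles that contain the square `s` and whose only square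
in `S` is in column `j`. -/
noncomputable def hitThroughMatrix (S : State n) (j : Fin n) (s : Fin n × Fin n) :
    Matrix (State n) (State n) (ZMod 2) :=
  rectMatrix fun D => hitWeight S j D * (D s : ZMod 2)

/-- A permutation meets every column and every row, so no thin annulus avoids it. -/
theorem avoidWeight_colAnnulus (S : State n) (i : Fin n) : avoidWeight S (colAnnulus i) = 0 := by
  rw [avoidWeight, if_neg]
  intro h
  simpa [colAnnulus] using h i

theorem avoidWeight_rowAnnulus (S : State n) (i : Fin n) : avoidWeight S (rowAnnulus i) = 0 := by
  rw [avoidWeight, if_neg]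
  intro h
  simpa [rowAnnulus] using h (S.symm i)

theorem hitWeight_colAnnulus (S : State n) (i j : Fin n) :
    hitWeight S j (colAnnulus i) = if i = j then 1 else 0 := by
  rw [hitWeight]
  refine if_congr ⟨fun h => ?_, ?_⟩ rfl rfl
  · by_contra hij
    have := h.2 i hij
    simp [colAnnulus] at this
  · rintro rfl
    simp [colAnnulus]

theorem hitWeight_rowAnnulus (S : State n) (i j : Fin n) :
    hitWeight S j (rowAnnulus i) = if i = S j then 1 else 0 := by
  rw [hitWeight]
  refine if_congr ⟨fun h => ?_, ?_⟩ rfl rfl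
  · by_contra hij
    have := h.2 (S.symm i) (fun hh => hij (by rw [← hh]; simp))
    simp [rowAnnulus] at this
  · rintro rfl
    simp [rowAnnulus]

theorem avoidMatrix_mul_self (hn : 2 ≤ n) (S : State n) : avoidMatrix S * avoidMatrix S = 0 := by
  have := rectMatrix_comp hn (fun _ : Unit => avoidWeight S) (fun _ => avoidWeight S)
    (avoidWeight S) (fun D E _ _ => by simp [avoidWeight_add])
  rw [avoidMatrix]
  simpa [avoidWeight_colAnnulus, avoidWeight_rowAnnulus] using this

theorem eq_of_add_eq_zero' {α : Type*} [Fintype α] {M N : Matrix α α (ZMod 2)} (h : M + N = 0) :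
    M = N := by
  ext i j
  have := congrFun (congrFun h i) j
  exact CharTwo.add_eq_zero.mp this

/-- The marking in column `j` lies in one vertical and one horizontal annulus, and the two
contributions cancel modulo 2. -/
theorem avoidMatrix_mul_hitMatrix (hn : 2 ≤ n) (S : State n) (j : Fin n) :
    avoidMatrix S * hitMatrix S j = hitMatrix S j * avoidMatrix S := by
  have := rectMatrix_comp hn ![avoidWeight S, hitWeight S j] ![hitWeight S j, avoidWeight S]
    (hitWeight S j) (fun D E _ _ => by simp [hitWeight_add, add_comm])
  refine eq_of_add_eq_zero' ?_
  simp only [Fin.sum_univ_two, Matrix.cons_val_zero, Matrix.cons_val_one, hitWeight_colAnnulus,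
    hitWeight_rowAnnulus, Finset.sum_ite_eq', Finset.mem_univ, if_true] at this
  rw [avoidMatrix, hitMatrix, this, CharTwo.add_self_eq_zero, zero_smul]

/-- The multiplicity at `s` is additive and `avoidWeight` multiplicative; the annuli contribute
nothing, since all of them meet `S`. -/
theorem avoidMatrix_mul_throughMatrix (hn : 2 ≤ n) (S : State n) (s : Fin n × Fin n) :
    avoidMatrix S * throughMatrix S s = throughMatrix S s * avoidMatrix S := by
  have := rectMatrix_comp hn ![avoidWeight S, fun D => avoidWeight S D * (D s : ZMod 2)]
    ![fun D => avoidWeight S D * (D s : ZMod 2), avoidWeight S]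
    (fun D => avoidWeight S D * (D s : ZMod 2))
    (fun D E _ _ => by simp [avoidWeight_add]; ring)
  refine eq_of_add_eq_zero' ?_
  simp only [Fin.sum_univ_two, Matrix.cons_val_zero, Matrix.cons_val_one, avoidWeight_colAnnulus,
    avoidWeight_rowAnnulus, zero_mul, Finset.sum_const_zero, add_zero, zero_smul] at this
  rw [avoidMatrix, throughMatrix, this]

/-- The anticommutation relation, up to a homotopy. -/
theorem hitMatrix_mul_throughMatrix (hn : 2 ≤ n) (S : State n) (j : Fin n) (s : Fin n × Fin n) :
    hitMatrix S j * throughMatrix S s + throughMatrix S s * hitMatrix S j =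
      ((if s.1 = j then 1 else 0) + (if s.2 = S j then 1 else 0) : ZMod 2) •
          (1 : Matrix (State n) (State n) (ZMod 2)) +
        (avoidMatrix S * hitThroughMatrix S j s + hitThroughMatrix S j s * avoidMatrix S) := by
  -- The last two pairs of weights complete the Leibniz expansion of the hit weight times the
  -- multiplicity at `s`; they become the homotopy.
  have := rectMatrix_comp hn
    ![hitWeight S j, fun D => avoidWeight S D * (D s : ZMod 2), avoidWeight S,
      fun D => hitWeight S j D * (D s : ZMod 2)]
    ![fun D => avoidWeight S D * (D s : ZMod 2), hitWeight S j,
      fun D => hitWeight S j D * (D s : ZMod 2), avoidWeight S]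
    (fun D => hitWeight S j D * (D s : ZMod 2))
    (fun D E _ _ => by simp [hitWeight_add, Fin.sum_univ_four]; ring)
  rw [Fin.sum_univ_four] at this
  replace this : hitMatrix S j * throughMatrix S s + throughMatrix S s * hitMatrix S j +
      avoidMatrix S * hitThroughMatrix S j s + hitThroughMatrix S j s * avoidMatrix S = _ := this
  simp only [hitWeight_colAnnulus, hitWeight_rowAnnulus, ite_mul,
    zero_mul, one_mul, Finset.sum_ite_eq', Finset.mem_univ, if_true] at this
  have e : (((colAnnulus j s : ℕ) : ZMod 2) + ((rowAnnulus (S j) s : ℕ) : ZMod 2)) =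
      ((if s.1 = j then 1 else 0) + (if s.2 = S j then 1 else 0) : ZMod 2) := by
    simp [colAnnulus, rowAnnulus]
  rw [e] at this
  rw [← this]
  ext x y
  simp only [Matrix.add_apply]
  generalize (avoidMatrix S * hitThroughMatrix S j s) x y = a
  generalize (hitThroughMatrix S j s * avoidMatrix S) x y = b
  have h2 : ∀ u : ZMod 2, u + u = 0 := CharTwo.add_self_eq_zero
  linear_combination (-1 : ZMod 2) * h2 a - h2 b

/-! ### Change of the gradings along a rectangle. -/

/-- The number of pairs `k < i` with `S k < x i`. -/
def belowCount (S x : State n) : ℚ := ∑ i, ∑ k, if k < i ∧ S k < x i then 1 else 0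

theorem sum_ite_lt (x y : State n) :
    (∑ i, ∑ k, if x k < y i then (1 : ℚ) else 0) = ∑ i : Fin n, ∑ k, if k < i then 1 else 0 := by
  rw [← Equiv.sum_comp y (fun i => ∑ k, if k < i then (1 : ℚ) else 0)]
  refine Finset.sum_congr rfl fun i _ => ?_
  exact Equiv.sum_comp x (fun k => if k < y i then (1 : ℚ) else 0)

/-- By inclusion-exclusion, the count of centres to the north-east of the points differs from that
to the south-west by a constant depending on `n` only. -/
theorem maslovOf_eq (S x : State n) :
    maslovOf S x = belowCount x x - 2 * belowCount S x + belowCount S S +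
      (2 * (∑ i : Fin n, ∑ k, if k < i then (1 : ℚ) else 0) - n ^ 2 + 1) := by
  have hp : symNE (points x) (points x) = belowCount x x := by
    have : countNE (points x) (points x) = belowCount x x := by
      rw [countNE, belowCount, Finset.sum_comm]
      simp [points]
    rw [symNE, this]; ring
  have hc : symNE (centers S) (centers S) = belowCount S S := by
    have : countNE (centers S) (centers S) = belowCount S S := by
      rw [countNE, belowCount, Finset.sum_comm]
      simp [centers]
    rw [symNE, this]; ring
  have half : ∀ a b : ℕ, (a : ℚ) < b + 1 / 2 ↔ a ≤ b := by
    intro a b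
    constructor
    · intro h
      by_contra h2
      have : (b : ℚ) + 1 ≤ a := by exact_mod_cast Nat.lt_of_not_le h2
      linarith
    · intro h
      have : (a : ℚ) ≤ b := by exact_mod_cast h
      linarith
  have half' : ∀ a b : ℕ, (a : ℚ) + 1 / 2 < b ↔ a < b := by
    intro a b
    rw [← not_le, ← not_le, not_iff_not]
    constructor
    · intro h
      by_contra h2
      have : (a : ℚ) + 1 ≤ b := by exact_mod_cast Nat.lt_of_not_le h2
      linarith
    · intro h
      have : (b : ℚ) ≤ a := by exact_mod_cast h
      linarith
  have h1 : countNE (centers S) (points x) = belowCount S x := by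
    rw [countNE, belowCount, Finset.sum_comm]
    simp only [points, centers, half', Fin.lt_def]
  have h2 : countNE (points x) (centers S) =
      n ^ 2 - 2 * (∑ i : Fin n, ∑ k, if k < i then (1 : ℚ) else 0) + belowCount S x := by
    have e : ∀ i k : Fin n, (if (points x i).1 < (centers S k).1 ∧ (points x i).2 < (centers S k).2
        then (1 : ℚ) else 0) = 1 - (if k < i then 1 else 0) - (if S k < x i then 1 else 0) +
        (if k < i ∧ S k < x i then 1 else 0) := by
      intro i k
      simp only [points, centers, half, Fin.lt_def]
      by_cases a : k.val < i.val <;> by_cases b : (S k).val < (x i).val <;>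
        simp [a, b, Nat.not_le.mpr, Nat.not_lt.mp]
    simp only [countNE, e, Finset.sum_add_distrib, Finset.sum_sub_distrib, sum_ite_lt, belowCount]
    simp
    ring
  rw [maslovOf, hp, hc, symNE, h1, h2]
  ring

theorem belowCount_sub_right {x : State n} {a b : Fin n} (hab : a < b) (hx : x a < x b)
    (S : State n) :
    belowCount S x - belowCount S (move x (a, b)) =
      ∑ k, (if a ≤ k ∧ k < b ∧ x a ≤ S k ∧ S k < x b then (1 : ℚ) else 0) := by
  rw [belowCount, belowCount, ← Finset.sum_sub_distrib,
    Fintype.sum_eq_add a b hab.ne (fun m hm => by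
      simp [move, Equiv.swap_apply_of_ne_of_ne hm.1 hm.2])]
  simp only [← Finset.sum_sub_distrib, ← Finset.sum_add_distrib]
  refine Finset.sum_congr rfl fun k _ => ?_
  simp only [move, Equiv.Perm.mul_apply, Equiv.swap_apply_left, Equiv.swap_apply_right,
    Fin.lt_def, Fin.le_def] at *
  split_ifs <;> first | omega | norm_num

theorem belowCount_sub_left {x : State n} {a b : Fin n} (hab : a < b) (hx : x a < x b)
    (y : State n) :
    belowCount x y - belowCount (move x (a, b)) y =
      ∑ m, (if a < m ∧ m ≤ b ∧ x a < y m ∧ y m ≤ x b then (1 : ℚ) else 0) := by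
  rw [belowCount, belowCount, ← Finset.sum_sub_distrib]
  refine Finset.sum_congr rfl fun m _ => ?_
  rw [← Finset.sum_sub_distrib, Fintype.sum_eq_add a b hab.ne (fun m hm => by
      simp [move, Equiv.swap_apply_of_ne_of_ne hm.1 hm.2])]
  simp only [move, Equiv.Perm.mul_apply, Equiv.swap_apply_left, Equiv.swap_apply_right,
    Fin.lt_def, Fin.le_def] at *
  split_ifs <;> first | omega | norm_num

theorem belowCount_self_sub {x : State n} {a b : Fin n} (hab : a < b) (hx : x a < x b) :
    belowCount x x - belowCount (move x (a, b)) (move x (a, b)) =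
      2 * ∑ k, (if a ≤ k ∧ k < b ∧ x a ≤ x k ∧ x k < x b then (1 : ℚ) else 0) - 1 := by
  have h1 := belowCount_sub_right hab hx x
  have h2 := belowCount_sub_left hab hx (move x (a, b))
  -- The two half-open counts differ by the initial corner `(a, x a)` alone.
  have h3 : (∑ k, (if a ≤ k ∧ k < b ∧ x a ≤ x k ∧ x k < x b then (1 : ℚ) else 0)) -
      ∑ m, (if a < m ∧ m ≤ b ∧ x a < move x (a, b) m ∧ move x (a, b) m ≤ x b then (1 : ℚ) else 0)
      = 1 := by
    rw [← Finset.sum_sub_distrib, Fintype.sum_eq_single a]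
    · simp only [lt_self_iff_false, false_and, if_false, le_refl, hab, hx, true_and, if_true,
        sub_zero]
    · intro m hm
      by_cases hb : m = b
      · subst hb
        simp [move]
      · have e : move x (a, b) m = x m := by simp [move, Equiv.swap_apply_of_ne_of_ne hm hb]
        have n1 : x m ≠ x a := x.injective.ne hm
        have n2 : x m ≠ x b := x.injective.ne hb
        rw [e, sub_eq_zero]
        simp only [Fin.lt_def, Fin.le_def, Ne, Fin.ext_iff] at *
        refine if_congr ?_ rfl rfl
        omega
  linarith

theorem arcInd_of_lt {a b : Fin n} (hab : a < b) (k : Fin n) :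
    arcInd a b k = if a ≤ k ∧ k < b then 1 else 0 := by
  have : k ∈ arc a b ↔ a ≤ k ∧ k < b := by
    rw [mem_arc]
    simp only [Fin.lt_def, Fin.le_def] at *
    omega
  simp only [arcInd, this]

theorem maslovOf_sub_of_lt {x : State n} {a b : Fin n} (hab : a < b) (hx : x a < x b)
    (S : State n) :
    maslovOf S x - maslovOf S (move x (a, b)) =
      2 * (∑ k, (arcInd a b k : ℚ) * arcInd (x a) (x b) (x k)) - 1 -
        2 * ∑ k, (arcInd a b k : ℚ) * arcInd (x a) (x b) (S k) := by
  have e : ∀ T : State n, (∑ k, (arcInd a b k : ℚ) * arcInd (x a) (x b) (T k)) =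
      ∑ k, (if a ≤ k ∧ k < b ∧ x a ≤ T k ∧ T k < x b then (1 : ℚ) else 0) := by
    intro T
    refine Finset.sum_congr rfl fun k _ => ?_
    rw [arcInd_of_lt hab, arcInd_of_lt hx]
    by_cases h1 : a ≤ k ∧ k < b <;> by_cases h2 : x a ≤ T k ∧ T k < x b
    · rw [if_pos h1, if_pos h2, if_pos ⟨h1.1, h1.2, h2⟩]; simp
    · rw [if_pos h1, if_neg h2, if_neg (fun h => h2 h.2.2)]; simp
    · rw [if_neg h1, if_pos h2, if_neg (fun h => h1 ⟨h.1, h.2.1⟩)]; simp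
    · rw [if_neg h1, if_neg h2, if_neg (fun h => h2 h.2.2)]; simp
  rw [e, e, maslovOf_eq, maslovOf_eq, ← belowCount_sub_right hab hx S]
  have := belowCount_self_sub hab hx
  linarith

/-- A rectangle crossing the cuts of the torus is complementary, in columns, in rows or in both, to
a planar one. Passing to the complement produces correction terms for `x` and for `S`, and these
balance. -/
theorem maslovOf_sub {x : State n} {i j : Fin n} (hij : i ≠ j) (S : State n) :
    maslovOf S x - maslovOf S (move x (i, j)) =
      2 * (∑ k, (arcInd i j k : ℚ) * arcInd (x i) (x j) (x k)) - 1 -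
        2 * ∑ k, (arcInd i j k : ℚ) * arcInd (x i) (x j) (S k) := by
  set y := move x (i, j) with hy
  have hxy : move y (i, j) = x := by simp [hy, move, mul_assoc]
  have hxy' : move y (j, i) = x := by simp [hy, move, mul_assoc, Equiv.swap_comm j i]
  have hy' : move x (j, i) = y := by simp [hy, move, Equiv.swap_comm j i]
  have hyi : y i = x j := by simp [hy, move]
  have hyj : y j = x i := by simp [hy, move]
  have hu : ∀ k, (arcInd j i k : ℚ) = 1 - arcInd i j k := by
    intro k
    have := arcInd_add_arcInd hij k
    have : (arcInd i j k : ℚ) + arcInd j i k = 1 := by exact_mod_cast this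
    linarith
  have hv : ∀ k, (arcInd (x j) (x i) k : ℚ) = 1 - arcInd (x i) (x j) k := by
    intro k
    have := arcInd_add_arcInd (x.injective.ne hij) k
    have : (arcInd (x i) (x j) k : ℚ) + arcInd (x j) (x i) k = 1 := by exact_mod_cast this
    linarith
  have hswap : (∑ k, (arcInd i j k : ℚ) * arcInd (x i) (x j) (y k)) =
      (∑ k, (arcInd i j k : ℚ) * arcInd (x i) (x j) (x k)) - 1 := by
    suffices (∑ k, (arcInd i j k : ℚ) * arcInd (x i) (x j) (x k)) -
        (∑ k, (arcInd i j k : ℚ) * arcInd (x i) (x j) (y k)) = 1 by linarith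
    rw [← Finset.sum_sub_distrib, Fintype.sum_eq_single i]
    · simp [hyi, arcInd, left_mem_arc hij, left_mem_arc (x.injective.ne hij), right_notMem_arc]
    · intro m hm
      by_cases hb : m = j
      · subst hb
        simp [arcInd, right_notMem_arc]
      · simp [hy, move, Equiv.swap_apply_of_ne_of_ne hm hb]
  have hrow : ∀ T : State n, (∑ k, (arcInd (x i) (x j) (T k) : ℚ)) =
      ∑ k, (arcInd (x i) (x j) k : ℚ) :=
    fun T => Equiv.sum_comp T (fun k => (arcInd (x i) (x j) k : ℚ))
  rcases lt_or_gt_of_ne hij with h1 | h1 <;> rcases lt_or_gt_of_ne (x.injective.ne hij) with h2 | h2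
  · exact maslovOf_sub_of_lt h1 h2 S
  · have := maslovOf_sub_of_lt (x := y) h1 (by rw [hyi, hyj]; exact h2) S
    rw [hxy, hyi, hyj] at this
    simp only [hv, mul_sub, mul_one, Finset.sum_sub_distrib, hswap] at this
    linarith
  · have := maslovOf_sub_of_lt (x := y) h1 (by rw [hyi, hyj]; exact h2) S
    rw [hxy', hyi, hyj] at this
    simp only [hu, sub_mul, one_mul, Finset.sum_sub_distrib, hswap, hrow] at this
    linarith
  · have := maslovOf_sub_of_lt (x := x) h1 h2 S
    rw [hy'] at this
    simp only [hu, hv, mul_sub, mul_one, sub_mul, one_mul, Finset.sum_sub_distrib, hrow] at this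
    linarith

/-- For an empty rectangle the half-open count of points of `x` sees only the initial corner. -/
theorem maslovOf_sub_of_isEmptyRect {x : State n} {i j : Fin n} (hij : i ≠ j)
    (h : IsEmptyRect x (i, j)) (S : State n) :
    maslovOf S x - maslovOf S (move x (i, j)) = 1 - 2 * ∑ k, (dom x (i, j) (k, S k) : ℚ) := by
  have h1 : (∑ k, (arcInd i j k : ℚ) * arcInd (x i) (x j) (x k)) = 1 := by
    rw [Fintype.sum_eq_single i]
    · simp [arcInd, left_mem_arc hij, left_mem_arc (x.injective.ne hij)]
    · intro m hm
      have h2 := h m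
      simp only [Finset.mem_erase, ne_eq, hm, x.injective.ne hm, not_false_eq_true, true_and] at h2
      simp only [arcInd]
      by_cases h3 : m ∈ arc i j
      · have h4 : x m ∉ arc (x i) (x j) := fun h4 => h2 ⟨h3, h4⟩
        simp [h4]
      · simp [h3]
  rw [maslovOf_sub hij, h1]
  simp only [dom, Nat.cast_mul]
  ring

theorem alexander_sub_of_isEmptyRect (G : GridDiagram n) {x : State n} {i j : Fin n} (hij : i ≠ j)
    (h : IsEmptyRect x (i, j)) :
    G.alexander x - G.alexander (move x (i, j)) =
      ∑ k, (dom x (i, j) (k, G.X k) : ℚ) - ∑ k, (dom x (i, j) (k, G.O k) : ℚ) := by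
  have h1 := maslovOf_sub_of_isEmptyRect hij h G.O
  have h2 := maslovOf_sub_of_isEmptyRect hij h G.X
  rw [alexander, alexander]
  linarith

theorem alexander_eq (G : GridDiagram n) (x : State n) :
    G.alexander x = belowCount G.X x - belowCount G.O x +
      (belowCount G.O G.O - belowCount G.X G.X) / 2 - ((n : ℚ) - 1) / 2 := by
  rw [alexander, maslovOf_eq, maslovOf_eq]
  ring

theorem exists_int_alexander_sub (G : GridDiagram n) (x y : State n) :
    ∃ m : ℤ, G.alexander x - G.alexander y = m := by
  have h : ∀ S x : State n, ∃ m : ℤ, belowCount S x = m := by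
    intro S x
    exact ⟨∑ i, ∑ k, if k < i ∧ S k < x i then 1 else 0, by simp [belowCount]⟩
  obtain ⟨a, ha⟩ := h G.X x
  obtain ⟨b, hb⟩ := h G.O x
  obtain ⟨c, hc⟩ := h G.X y
  obtain ⟨d, hd⟩ := h G.O y
  refine ⟨a - b - (c - d), ?_⟩
  rw [alexander_eq, alexander_eq, ha, hb, hc, hd]
  push_cast
  ring

theorem val_reflect (x : State n) (i : Fin n) :
    (reflect x i).val = if (x i).val = 0 then 0 else n - (x i).val := by
  obtain ⟨m, rfl⟩ : ∃ m, n = m + 1 := ⟨n - 1, by have := i.isLt; omega⟩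
  simp only [reflect, Equiv.Perm.mul_apply, finRotate_apply, Fin.revPerm_apply, Fin.val_add,
    Fin.val_rev]
  have := (x i).isLt
  split_ifs with h
  · simp [h]
  · rw [Fin.val_one']
    rcases m with _ | m
    · omega
    · rw [Nat.mod_eq_of_lt (a := 1) (by omega), Nat.mod_eq_of_lt (by omega)]
      omega

theorem belowCount_revPerm_reflect (O X x : State n) :
    belowCount (Fin.revPerm * O) (reflect x) - belowCount (Fin.revPerm * X) (reflect x) =
      belowCount X x - belowCount O x := by
  simp only [belowCount, ← Finset.sum_sub_distrib]
  refine Finset.sum_congr rfl fun i _ => Finset.sum_congr rfl fun k _ => ?_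
  have h1 := (x i).isLt
  have h2 := (O k).isLt
  have h3 := (X k).isLt
  simp only [Fin.lt_def, val_reflect, Equiv.Perm.mul_apply, Fin.revPerm_apply, Fin.val_rev]
  split_ifs <;> first | omega | norm_num

theorem belowCount_revPerm_self (S : State n) :
    belowCount (Fin.revPerm * S) (Fin.revPerm * S) =
      (∑ i : Fin n, ∑ k, if k < i then (1 : ℚ) else 0) - belowCount S S := by
  simp only [belowCount, ← Finset.sum_sub_distrib]
  refine Finset.sum_congr rfl fun i _ => Finset.sum_congr rfl fun k _ => ?_
  have h2 := (S i).isLt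
  have h3 := (S k).isLt
  by_cases hk : k = i
  · subst hk; simp
  have h4 := S.injective.ne hk
  simp only [Fin.lt_def, Equiv.Perm.mul_apply, Fin.revPerm_apply, Fin.val_rev, Ne,
    Fin.ext_iff] at *
  split_ifs <;> first | omega | norm_num

theorem alexander_neg_reflect (G : GridDiagram n) (x : State n) :
    G.neg.alexander (reflect x) = G.alexander x := by
  have h := belowCount_revPerm_reflect G.O G.X x
  have h1 := belowCount_revPerm_self G.O
  have h2 := belowCount_revPerm_self G.X
  rw [alexander_eq, alexander_eq]
  simp only [neg]
  linarith

/-! ### The state of largest Alexander grading. -/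

section Shift

variable {p q : ℕ} {X : State n}

/-- The second count is min(i, j), an upper bound for the first. Equality means that the smaller of
the sets `k < i` and `S k < j` lies in the other; for `i = j` the two inclusions are equivalent by
cardinality. -/
theorem sum_below_eq_zero_iff (S : State n) (i j : Fin n) :
    (∑ k, ((if k < i ∧ S k < j then (1 : ℚ) else 0) - if k < i ∧ k < j then 1 else 0)) ≤ 0 ∧
    ((∑ k, ((if k < i ∧ S k < j then (1 : ℚ) else 0) - if k < i ∧ k < j then 1 else 0)) = 0 ↔
      ((i ≤ j → ∀ k < i, S k < j) ∧ (j ≤ i → ∀ k, S k < j → k < i))) := by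
  rcases le_total i j with h | h
  · have e : ∀ k, ((if k < i ∧ S k < j then (1 : ℚ) else 0) - if k < i ∧ k < j then 1 else 0) =
        - (if k < i ∧ ¬ S k < j then 1 else 0) := by
      intro k
      simp only [Fin.lt_def, Fin.le_def] at *
      split_ifs <;> first | omega | norm_num
    have h0 : ∀ k, (0 : ℚ) ≤ if k < i ∧ ¬ S k < j then 1 else 0 := by
      intro k; split_ifs <;> norm_num
    simp only [e, Finset.sum_neg_distrib, neg_nonpos, neg_eq_zero]
    refine ⟨Finset.sum_nonneg fun k _ => h0 k, ?_⟩
    rw [Finset.sum_eq_zero_iff_of_nonneg (fun k _ => h0 k)]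
    constructor
    · intro H
      have H' : ∀ k < i, S k < j := by
        intro k hk
        by_contra h5
        have := H k (Finset.mem_univ k)
        rw [if_pos ⟨hk, h5⟩] at this
        norm_num at this
      refine ⟨fun _ => H', fun hji => ?_⟩
      obtain rfl := le_antisymm h hji
      have hs : (Finset.univ.filter fun k => k < i).map S.toEmbedding =
          Finset.univ.filter fun k => k < i := by
        refine Finset.eq_of_subset_of_card_le ?_ (by rw [Finset.card_map])
        intro y hy
        simp only [Finset.mem_map, Finset.mem_filter, Finset.mem_univ, true_and] at hy ⊢
        obtain ⟨k, hk, rfl⟩ := hy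
        exact H' k hk
      intro k hk
      have : S k ∈ (Finset.univ.filter fun k => k < i).map S.toEmbedding := by
        rw [hs]; simpa using hk
      simpa using this
    · rintro ⟨H, _⟩ k _
      exact if_neg fun h5 => h5.2 (H h k h5.1)
  · have e : (∑ k, ((if k < i ∧ S k < j then (1 : ℚ) else 0) - if k < i ∧ k < j then 1 else 0)) =
        - ∑ k, (if S k < j ∧ ¬ k < i then 1 else 0) := by
      have h1 : (∑ k, if k < i ∧ k < j then (1 : ℚ) else 0) = ∑ k, if S k < j then 1 else 0 := by
        rw [Equiv.sum_comp S (fun k => if k < j then (1 : ℚ) else 0)]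
        refine Finset.sum_congr rfl fun k _ => if_congr ?_ rfl rfl
        exact ⟨fun h5 => h5.2, fun h5 => ⟨lt_of_lt_of_le h5 h, h5⟩⟩
      rw [Finset.sum_sub_distrib, h1, ← Finset.sum_sub_distrib, ← Finset.sum_neg_distrib]
      refine Finset.sum_congr rfl fun k _ => ?_
      split_ifs <;> first | tauto | norm_num
    have h0 : ∀ k, (0 : ℚ) ≤ if S k < j ∧ ¬ k < i then 1 else 0 := by
      intro k; split_ifs <;> norm_num
    rw [e, neg_nonpos, neg_eq_zero]
    refine ⟨Finset.sum_nonneg fun k _ => h0 k, ?_⟩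
    rw [Finset.sum_eq_zero_iff_of_nonneg (fun k _ => h0 k)]
    constructor
    · intro H
      have H' : ∀ k, S k < j → k < i := by
        intro k hk
        by_contra h5
        have := H k (Finset.mem_univ k)
        rw [if_pos ⟨hk, h5⟩] at this
        norm_num at this
      refine ⟨fun hji => ?_, fun _ => H'⟩
      obtain rfl := le_antisymm h hji
      have hs : (Finset.univ.filter fun k => k < j).map S.symm.toEmbedding =
          Finset.univ.filter fun k => k < j := by
        refine Finset.eq_of_subset_of_card_le ?_ (by rw [Finset.card_map])
        intro y hy
        simp only [Finset.mem_map, Finset.mem_filter, Finset.mem_univ, true_and] at hy ⊢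
        obtain ⟨k, hk, rfl⟩ := hy
        exact H' _ (by simpa using hk)
      intro k hk
      have : k ∈ (Finset.univ.filter fun k => k < j).map S.symm.toEmbedding := by
        rw [hs]; simpa using hk
      simpa [Equiv.symm_apply_eq] using this
    · rintro ⟨_, H⟩ k _
      exact if_neg fun h5 => h5.2 (H h k h5.1)

/-- The jump of `X` between columns `q - 1` and `q` forces `x` to vanish at `q`, to lie on or above
`X` in the columns from 1 to `q - 1`, and on or below it after `q`. Injectivity then gives equality,
working outwards from the jump; column 0 receives the remaining value. -/
theorem eq_of_forall_below (hp : 0 < p) (hq : 0 < q) (hn : n = p + q)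
    (hX : ∀ k, (X k).val = (k.val + p) % n) (x : State n)
    (h : ∀ i, (i ≤ x i → ∀ k < i, X k < x i) ∧ (x i ≤ i → ∀ k, X k < x i → k < i)) : x = X := by
  have hX1 : ∀ k : Fin n, k.val < q → (X k).val = k + p := by
    intro k hk
    rw [hX, Nat.mod_eq_of_lt (by omega)]
  have hX2 : ∀ k : Fin n, q ≤ k.val → (X k).val = k - q := by
    intro k hk
    have := k.isLt
    rw [hX, Nat.mod_eq_sub_mod (by omega), Nat.mod_eq_of_lt (by omega)]
    omega
  simp only [Fin.lt_def, Fin.le_def] at h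
  have hlt : ∀ i, (x i).val < n := fun i => (x i).isLt
  have hXq : (X ⟨q, by omega⟩).val = 0 := by rw [hX2 ⟨q, by omega⟩ le_rfl]; simp
  have hXq' : (X ⟨q - 1, by omega⟩).val = n - 1 := by
    rw [hX1 ⟨q - 1, by omega⟩ (show q - 1 < q by omega)]
    show q - 1 + p = n - 1
    omega
  have habove : ∀ i : Fin n, q ≤ i.val → (x i).val < i.val := by
    intro i hi
    by_contra hc
    have := (h i).1 (not_lt.mp hc) ⟨q - 1, by omega⟩ (show q - 1 < i.val by omega)
    have := hlt i
    omega
  have hbelow : ∀ i : Fin n, i.val ≤ q → (x i).val ≤ i.val → (x i).val = 0 := by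
    intro i hi h1
    by_contra hc
    have : q < i.val := (h i).2 h1 ⟨q, by omega⟩ (by omega)
    omega
  have hq0 : (x ⟨q, by omega⟩).val = 0 :=
    hbelow _ le_rfl (habove ⟨q, by omega⟩ le_rfl).le
  have hne : ∀ i : Fin n, i.val ≠ q → (x i).val ≠ 0 := by
    intro i hi h0
    have : x i = x ⟨q, by omega⟩ := Fin.ext (by rw [h0, hq0])
    exact hi (congrArg Fin.val (x.injective this))
  have hlow : ∀ i : Fin n, 1 ≤ i.val → i.val < q → i.val + p ≤ (x i).val := by
    intro i h1 h2
    have h5 := hne i (by omega)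
    have h6 : i.val ≤ (x i).val := by
      by_contra hc
      exact h5 (hbelow i h2.le (not_le.mp hc).le)
    have h7 := (h i).1 h6 ⟨i.val - 1, by omega⟩ (show i.val - 1 < i.val by omega)
    rw [hX1 ⟨i.val - 1, by omega⟩ (show i.val - 1 < q by omega)] at h7
    have h8 : i.val - 1 + p < (x i).val := h7
    omega
  have hhigh : ∀ i : Fin n, q < i.val → (x i).val + q ≤ i.val := by
    intro i h1
    have h5 := hne i (by omega)
    have h6 := hlt i
    have h7 := i.isLt
    have h8 := habove i h1.le
    by_cases h9 : (x i).val ≤ p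
    · have b : (X ⟨(x i).val - 1 + q, by omega⟩).val = (x i).val - 1 + q - q :=
        hX2 _ (Nat.le_add_left _ _)
      have h4 : (x i).val - 1 + q < i.val := (h i).2 h8.le ⟨(x i).val - 1 + q, by omega⟩ (by omega)
      omega
    · have b : (X ⟨n - 1, by omega⟩).val = n - 1 - q := hX2 _ (show q ≤ n - 1 by omega)
      have h4 : n - 1 < i.val := (h i).2 h8.le ⟨n - 1, by omega⟩ (by omega)
      omega
  have elow : ∀ d : ℕ, ∀ i : Fin n, i.val + 1 + d = q → 1 ≤ i.val → (x i).val = i.val + p := by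
    intro d
    induction d using Nat.strong_induction_on with
    | _ d ih =>
      intro i hi h1
      by_contra hc
      have h2 := hlow i h1 (by omega)
      have h3 := hlt i
      have := ih (q - 1 - ((x i).val - p)) (by omega) ⟨(x i).val - p, by omega⟩ (by simp; omega)
        (by simp; omega)
      have h4 : x ⟨(x i).val - p, by omega⟩ = x i := Fin.ext (by rw [this]; simp; omega)
      have h5 := congrArg Fin.val (x.injective h4)
      simp only at h5
      omega
  have ehigh : ∀ d : ℕ, ∀ i : Fin n, i.val = q + d → (x i).val = d := by
    intro d
    induction d using Nat.strong_induction_on with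
    | _ d ih =>
      intro i hi
      rcases Nat.eq_zero_or_pos d with rfl | hd
      · have : i = ⟨q, by omega⟩ := Fin.ext (by simpa using hi)
        rw [this, hq0]
      by_contra hc
      have h2 := hhigh i (by omega)
      have h3 := i.isLt
      have := ih (x i).val (by omega) ⟨q + (x i).val, by omega⟩ rfl
      have h5 := congrArg Fin.val (x.injective (Fin.ext this))
      simp only at h5
      omega
  have hpos : ∀ i : Fin n, 1 ≤ i.val → x i = X i := by
    intro i hi
    apply Fin.ext
    by_cases h1 : i.val < q
    · rw [elow (q - 1 - i.val) i (by omega) hi, hX1 i h1]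
    · rw [ehigh (i.val - q) i (by omega), hX2 i (by omega)]
  ext i
  by_cases hi : 1 ≤ i.val
  · rw [hpos i hi]
  · have h0 : ∀ j, X j = x i → j = i := by
      intro j hj
      by_cases h1 : 1 ≤ j.val
      · rw [← hpos j h1] at hj
        exact x.injective hj
      · exact Fin.ext (by omega)
    have h1 := h0 (X.symm (x i)) (by simp)
    rw [Equiv.symm_apply_eq] at h1
    rw [h1]

theorem forall_below_self (hp : 0 < p) (hn : n = p + q)
    (hX : ∀ k, (X k).val = (k.val + p) % n) (i : Fin n) :
    (i ≤ X i → ∀ k < i, X k < X i) ∧ (X i ≤ i → ∀ k, X k < X i → k < i) := by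
  have hX1 : ∀ k : Fin n, (k.val < q ∧ (X k).val = k + p) ∨ (q ≤ k.val ∧ (X k).val = k - q) := by
    intro k
    have := k.isLt
    by_cases hk : k.val < q
    · exact Or.inl ⟨hk, by rw [hX, Nat.mod_eq_of_lt (by omega)]⟩
    · refine Or.inr ⟨by omega, ?_⟩
      rw [hX, Nat.mod_eq_sub_mod (by omega), Nat.mod_eq_of_lt (by omega)]
      omega
  have hi := hX1 i
  have := i.isLt
  refine ⟨fun h k hk => ?_, fun h k hk => ?_⟩ <;>
  · have h1 := hX1 k
    have := k.isLt
    simp only [Fin.lt_def, Fin.le_def] at *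
    omega

/-- By `alexander_eq` the difference is the Alexander grading up to a constant, so this singles out
the top state. -/
theorem belowCount_sub_le (hp : 0 < p) (hq : 0 < q) (hn : n = p + q)
    (hX : ∀ k, (X k).val = (k.val + p) % n) (x : State n) :
    belowCount X x - belowCount 1 x ≤ belowCount X X - belowCount 1 X ∧
    (belowCount X x - belowCount 1 x = belowCount X X - belowCount 1 X → x = X) ∧
    belowCount X X - belowCount 1 X = 0 := by
  have e : ∀ x : State n, belowCount X x - belowCount 1 x =
      ∑ i, ∑ k, ((if k < i ∧ X k < x i then (1 : ℚ) else 0) - if k < i ∧ k < x i then 1 else 0) := by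
    intro x
    simp only [belowCount, ← Finset.sum_sub_distrib]
    rfl
  have h0 : belowCount X X - belowCount 1 X = 0 := by
    rw [e]
    refine Finset.sum_eq_zero fun i _ => ?_
    exact (sum_below_eq_zero_iff X i (X i)).2.mpr (forall_below_self hp hn hX i)
  refine ⟨?_, fun h => ?_, h0⟩
  · rw [h0, e]
    exact Finset.sum_nonpos fun i _ => (sum_below_eq_zero_iff X i (x i)).1
  · rw [h0, e, Finset.sum_eq_zero_iff_of_nonpos
      (fun i _ => (sum_below_eq_zero_iff X i (x i)).1)] at h
    exact eq_of_forall_below hp hq hn hX x fun i =>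
      (sum_below_eq_zero_iff X i (x i)).2.mp (h i (Finset.mem_univ i))

/-- Places the diagonal state exactly `n - 1` below the top when q = 1, which is the number of steps
of the full staircase. -/
theorem belowCount_sub_one (hn : n = p + 1)
    (hX : ∀ k, (X k).val = (k.val + p) % n) :
    belowCount X 1 - belowCount (n := n) 1 1 = -((n : ℚ) - 1) := by
  have h0 : belowCount X 1 - belowCount (n := n) 1 1 = ∑ i : Fin n, ∑ k,
      ((if k < i ∧ X k < i then (1 : ℚ) else 0) - if k < i ∧ k < i then 1 else 0) := by
    simp only [belowCount, ← Finset.sum_sub_distrib]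
    rfl
  rw [h0]
  subst hn
  have e : ∀ i k : Fin (p + 1), ((if k < i ∧ X k < i then (1 : ℚ) else 0) - if k < i ∧ k < i then 1
      else 0) = if k = 0 then (if i = 0 then 0 else -1) else 0 := by
    intro i k
    have hk : (k.val = 0 ∧ (X k).val = p) ∨ (1 ≤ k.val ∧ (X k).val = k - 1) := by
      have := k.isLt
      by_cases h : k.val = 0
      · exact Or.inl ⟨h, by rw [hX, h, Nat.mod_eq_of_lt (by omega)]; omega⟩
      · refine Or.inr ⟨by omega, ?_⟩
        rw [hX, Nat.mod_eq_sub_mod (by omega), Nat.mod_eq_of_lt (by omega)]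
        omega
    have := i.isLt
    simp only [Fin.lt_def, Fin.ext_iff, Fin.val_zero]
    split_ifs <;> first | omega | norm_num
  simp only [e, Finset.sum_ite_eq', Finset.mem_univ, if_true]
  have : ∀ i : Fin (p + 1), (if i = 0 then (0 : ℚ) else -1) = -1 + if i = 0 then 1 else 0 := by
    intro i; split_ifs <;> norm_num
  simp only [this, Finset.sum_add_distrib, Finset.sum_ite_eq', Finset.mem_univ, if_true]
  simp

end Shift

/-! ### Reflection as transposition. -/

section Reflect

theorem reflect_reflect (x : State n) : reflect (reflect x) = x := by
  ext i
  have := (x i).isLt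
  rw [val_reflect, val_reflect]
  split_ifs <;> omega

theorem reflect_injective : Function.Injective (reflect (n := n)) :=
  Function.Involutive.injective reflect_reflect

theorem reflect_mul (x s : State n) : reflect (x * s) = reflect x * s := by
  simp [reflect, mul_assoc]

theorem sum_reflect {M : Type*} [AddCommMonoid M] (f : State n → M) :
    ∑ x, f (reflect x) = ∑ x, f x :=
  Equiv.sum_comp (Function.Involutive.toPerm reflect reflect_reflect) f

variable {x : State n} {r : Fin n × Fin n}

theorem isEmptyRect_reflect : IsEmptyRect (reflect (move x r)) r ↔ IsEmptyRect x r := by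
  rw [isEmptyRect_iff, isEmptyRect_iff]
  refine forall_congr' fun k => not_congr (and_congr_right fun hk => ?_)
  have h1 : k ≠ r.1 := by rintro rfl; exact not_cycBtw_left _ _ hk
  have h2 : k ≠ r.2 := by rintro rfl; exact not_cycBtw_right _ _ hk
  have e1 : move x r r.1 = x r.2 := by simp [move]
  have e2 : move x r r.2 = x r.1 := by simp [move]
  have e3 : move x r k = x k := by simp [move, Equiv.swap_apply_of_ne_of_ne h1 h2]
  have := (x r.1).isLt
  have := (x r.2).isLt
  have := (x k).isLt
  simp only [CycBtw, Fin.lt_def, val_reflect, e1, e2, e3]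
  split_ifs <;> omega

theorem dom_reflect (h : r.1 ≠ r.2) (k s : Fin n) :
    dom (reflect (move x r)) r (k, Fin.revPerm s) = dom x r (k, s) := by
  have e1 : move x r r.1 = x r.2 := by simp [move]
  have e2 : move x r r.2 = x r.1 := by simp [move]
  have key : Fin.revPerm s ∈ arc (reflect (move x r) r.1) (reflect (move x r) r.2) ↔
      s ∈ arc (x r.1) (x r.2) := by
    have h3 := x.injective.ne h
    have := (x r.1).isLt
    have := (x r.2).isLt
    have := s.isLt
    rw [mem_arc, mem_arc]
    simp only [Fin.lt_def, Fin.le_def, val_reflect, e1, e2, Fin.revPerm_apply, Fin.val_rev, Ne,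
      Fin.ext_iff] at *
    split_ifs <;> omega
  rw [dom_eq_ite, dom_eq_ite]
  simp only [key]

theorem avoidWeight_reflect (h : r.1 ≠ r.2) (S : State n) :
    avoidWeight (Fin.revPerm * S) (dom (reflect (move x r)) r) = avoidWeight S (dom x r) := by
  simp only [avoidWeight, Equiv.Perm.mul_apply, dom_reflect h]

/-- Reflection keeps the columns of a rectangle and reverses its direction; hence the transpose. -/
theorem avoidMatrix_reflect (S x y : State n) :
    avoidMatrix (Fin.revPerm * S) (reflect y) (reflect x) = avoidMatrix S x y := by
  classical
  simp only [avoidMatrix, rectMatrix, rect, Finset.filter_filter]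
  have key : ∀ r : Fin n × Fin n, reflect x = reflect y * Equiv.swap r.1 r.2 ↔ y = move x r := by
    intro r
    rw [← reflect_mul, reflect_injective.eq_iff, move]
    constructor
    · rintro rfl; simp [mul_assoc]
    · rintro rfl; simp [mul_assoc]
  refine Finset.sum_congr ?_ ?_
  · ext r
    simp only [Finset.mem_filter, Finset.mem_univ, true_and, key]
    constructor
    · rintro ⟨⟨h1, rfl⟩, h2⟩
      exact ⟨⟨h1, rfl⟩, isEmptyRect_reflect.mp h2⟩
    · rintro ⟨⟨h1, rfl⟩, h2⟩
      exact ⟨⟨h1, rfl⟩, isEmptyRect_reflect.mpr h2⟩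
  · intro r hr
    simp only [Finset.mem_filter, Finset.mem_univ, true_and] at hr
    obtain ⟨⟨h1, rfl⟩, _⟩ := hr
    exact avoidWeight_reflect h1 S

theorem vecMul_avoidMatrix_reflect (S : State n) (z : State n → ZMod 2) (x : State n) :
    Matrix.vecMul z (avoidMatrix (Fin.revPerm * S)) (reflect x) =
      Matrix.mulVec (avoidMatrix S) (fun y => z (reflect y)) x := by
  simp only [Matrix.vecMul, Matrix.mulVec, dotProduct]
  rw [← sum_reflect]
  refine Finset.sum_congr rfl fun y _ => ?_
  rw [avoidMatrix_reflect, mul_comm]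

theorem neg_neg (G : GridDiagram n) : G.neg.neg = G := by
  obtain ⟨O, X, h⟩ := G
  simp only [neg, mk.injEq]
  constructor <;>
  · ext i
    simp

end Reflect

/-! ### Gradings of nonzero matrix entries. -/

section Entries

variable {x y : State n}

theorem exists_rect_of_rectMatrix_ne_zero {φ : (Fin n × Fin n → ℕ) → ZMod 2}
    (h : rectMatrix φ x y ≠ 0) :
    ∃ i j, i ≠ j ∧ IsEmptyRect x (i, j) ∧ y = move x (i, j) ∧ φ (dom x (i, j)) ≠ 0 := by
  classical
  obtain ⟨r, hr, h2⟩ := Finset.exists_ne_zero_of_sum_ne_zero h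
  simp only [rect, Finset.mem_filter, Finset.mem_univ, true_and] at hr
  exact ⟨r.1, r.2, hr.1.1, hr.2, hr.1.2, h2⟩

theorem avoidWeight_ne_zero_iff {S : State n} {D : Fin n × Fin n → ℕ} :
    avoidWeight S D ≠ 0 ↔ ∀ k, D (k, S k) = 0 := by
  rw [avoidWeight]
  split_ifs with h <;> simp [h]

theorem hitWeight_ne_zero_iff {S : State n} {j : Fin n} {D : Fin n × Fin n → ℕ} :
    hitWeight S j D ≠ 0 ↔ D (j, S j) = 1 ∧ ∀ k, k ≠ j → D (k, S k) = 0 := by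
  rw [hitWeight]
  split_ifs with h <;> simp only [ne_eq, one_ne_zero, not_false_eq_true, not_true, true_iff,
    false_iff] <;> exact h

theorem exists_rect_of_throughMatrix_ne_zero {S : State n} {s : Fin n × Fin n}
    (h : throughMatrix S s x y ≠ 0) :
    ∃ i j, i ≠ j ∧ IsEmptyRect x (i, j) ∧ y = move x (i, j) ∧ (∀ k, dom x (i, j) (k, S k) = 0) ∧
      1 ≤ dom x (i, j) s := by
  obtain ⟨i, j, h1, h2, h3, h4⟩ := exists_rect_of_rectMatrix_ne_zero h
  refine ⟨i, j, h1, h2, h3, avoidWeight_ne_zero_iff.mp (left_ne_zero_of_mul h4), ?_⟩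
  by_contra h5
  apply right_ne_zero_of_mul h4
  simp [Nat.lt_one_iff.mp (not_le.mp h5)]

theorem exists_rect_of_hitMatrix_ne_zero {S : State n} {j : Fin n}
    (h : hitMatrix S j x y ≠ 0) :
    ∃ a b, a ≠ b ∧ IsEmptyRect x (a, b) ∧ y = move x (a, b) ∧ dom x (a, b) (j, S j) = 1 ∧
      ∀ k, k ≠ j → dom x (a, b) (k, S k) = 0 := by
  obtain ⟨i, j, h1, h2, h3, h4⟩ := exists_rect_of_rectMatrix_ne_zero h
  exact ⟨i, j, h1, h2, h3, hitWeight_ne_zero_iff.mp h4⟩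

/-- Along a rectangle the Alexander grading drops by the number of X's minus that of O's; here there
is no O and at least one X. -/
theorem alexander_of_throughMatrix_ne_zero (G : GridDiagram n) {i : Fin n}
    (h : throughMatrix G.O (i, G.X i) x y ≠ 0) : G.alexander y + 1 ≤ G.alexander x := by
  obtain ⟨a, b, h1, h2, rfl, h4, h5⟩ := exists_rect_of_throughMatrix_ne_zero h
  have h6 := alexander_sub_of_isEmptyRect G h1 h2
  simp only [h4, Nat.cast_zero, Finset.sum_const_zero, sub_zero] at h6
  have h7 : (dom x (a, b) (i, G.X i) : ℚ) ≤ ∑ k, (dom x (a, b) (k, G.X k) : ℚ) :=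
    Finset.single_le_sum (f := fun k => (dom x (a, b) (k, G.X k) : ℚ))
      (fun k _ => Nat.cast_nonneg _) (Finset.mem_univ i)
  have h8 : (1 : ℚ) ≤ dom x (a, b) (i, G.X i) := by exact_mod_cast h5
  linarith

theorem alexander_of_hitMatrix_ne_zero (G : GridDiagram n) {i : Fin n}
    (h : hitMatrix G.O i x y ≠ 0) : G.alexander y ≤ G.alexander x + 1 := by
  obtain ⟨a, b, h1, h2, rfl, h4, h5⟩ := exists_rect_of_hitMatrix_ne_zero h
  have h6 := alexander_sub_of_isEmptyRect G h1 h2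
  have h7 : (0 : ℚ) ≤ ∑ k, (dom x (a, b) (k, G.X k) : ℚ) :=
    Finset.sum_nonneg fun k _ => Nat.cast_nonneg _
  rw [Fintype.sum_eq_single (f := fun k => (dom x (a, b) (k, G.O k) : ℚ)) i
    (fun k hk => by simp [h5 k hk]), h4] at h6
  push_cast at h6
  linarith

theorem maslovOf_reflect_of_throughMatrix_ne_zero {S : State n} {s : Fin n × Fin n}
    (h : throughMatrix S s x y ≠ 0) :
    maslovOf (Fin.revPerm * S) (reflect x) = maslovOf (Fin.revPerm * S) (reflect y) - 1 := by
  obtain ⟨a, b, h1, h2, rfl, h4, h5⟩ := exists_rect_of_throughMatrix_ne_zero h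
  have h6 := maslovOf_sub_of_isEmptyRect h1 (isEmptyRect_reflect.mpr h2) (Fin.revPerm * S)
  have h7 : move (reflect (move x (a, b))) (a, b) = reflect x := by
    simp only [move, reflect_mul, mul_assoc, Equiv.swap_mul_self, mul_one]
  simp only [Equiv.Perm.mul_apply, dom_reflect (r := (a, b)) h1, h4, h7, Nat.cast_zero,
    Finset.sum_const_zero, mul_zero, sub_zero] at h6
  linarith

end Entries

/-! ### Homogeneous chains and their values at U = 1. -/

section Homogenize

open Polynomial

/-- The specialization of a chain at `U = 1`. -/
def specialize (c : Chain n) (x : State n) : ZMod 2 := (c x).eval 1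

/-- The homogeneous chain of Alexander grading `a` with a given specialization at `U = 1`. -/
noncomputable def homogenize (G : GridDiagram n) (a : ℚ) (z : State n → ZMod 2) : Chain n :=
  fun x => C (z x) * Polynomial.X ^ ⌊G.alexander x - a⌋₊

variable {G : GridDiagram n}

theorem specialize_homogenize (a : ℚ) (z : State n → ZMod 2) :
    specialize (homogenize G a z) = z := by
  funext x
  simp [specialize, homogenize]

theorem count_eq_zero_iff (S x : State n) (r : Fin n × Fin n) :
    count S x r = 0 ↔ ∀ k, dom x r (k, S k) = 0 := by
  rw [count_eq_sum_dom, Finset.sum_eq_zero_iff]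
  simp

open Classical in
theorem avoidMatrix_apply (S x y : State n) :
    avoidMatrix S x y =
      ∑ _r ∈ (rect x y).filter (fun r => IsEmptyRect x r ∧ count S x r = 0), 1 := by
  rw [avoidMatrix, rectMatrix, ← Finset.filter_filter, Finset.sum_filter (fun r => count S x r = 0)]
  refine Finset.sum_congr rfl fun _ _ => ?_
  simp only [avoidWeight, count_eq_zero_iff]

/-- At U = 1 the O-markings are forgotten and only the avoidance of 𝕏 remains. -/
theorem specialize_boundary (c : Chain n) :
    specialize (G.boundary c) = Matrix.vecMul (specialize c) (avoidMatrix G.X) := by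
  funext y
  simp only [specialize, boundary, LinearMap.coe_mk, AddHom.coe_mk, eval_finsetSum, eval_mul,
    Matrix.vecMul, dotProduct, avoidMatrix_apply, eval_pow, eval_X, one_pow]

theorem alexander_add_count {x y : State n} {r : Fin n × Fin n} (hr : r ∈ rect x y)
    (he : IsEmptyRect x r) (hX : count G.X x r = 0) :
    G.alexander y = G.alexander x + count G.O x r := by
  simp only [rect, Finset.mem_filter, Finset.mem_univ, true_and] at hr
  obtain ⟨h1, rfl⟩ := hr
  have := alexander_sub_of_isEmptyRect G h1 he
  have h2 : ∀ S, (count S x r : ℚ) = ∑ k, (dom x r (k, S k) : ℚ) := by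
    intro S
    rw [count_eq_sum_dom]
    push_cast
    rfl
  have h3 := h2 G.X
  rw [hX] at h3
  rw [h2 G.O]
  simp only [move] at this
  push_cast at h3
  linarith

/-- An X-free rectangle raises the Alexander grading by its number of O's, which is the exponent of
U in the differential. The hypothesis keeps the floor in `homogenize` from truncating. -/
theorem boundary_homogenize {a : ℚ} {z : State n → ZMod 2}
    (hz : ∀ x, z x ≠ 0 → ∃ m : ℕ, G.alexander x - a = m) :
    G.boundary (homogenize G a z) = homogenize G a (Matrix.vecMul z (avoidMatrix G.X)) := by
  classical
  funext y
  simp only [boundary, LinearMap.coe_mk, AddHom.coe_mk, homogenize, Matrix.vecMul, dotProduct,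
    map_sum, Finset.sum_mul]
  refine Finset.sum_congr rfl fun x _ => ?_
  by_cases hx : z x = 0
  · simp [hx]
  obtain ⟨m, hm⟩ := hz x hx
  rw [avoidMatrix_apply, map_mul, map_sum, mul_assoc, mul_assoc, Finset.mul_sum, Finset.sum_mul]
  congr 1
  refine Finset.sum_congr rfl fun r hr => ?_
  rw [Finset.mem_filter] at hr
  have h1 := alexander_add_count (G := G) hr.1 hr.2.1 hr.2.2
  have h2 : G.alexander y - a = ((m + count G.O x r : ℕ) : ℚ) := by
    push_cast
    linarith
  rw [hm, h2, Nat.floor_natCast, Nat.floor_natCast, pow_add]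
  simp

theorem AlexanderHomogeneous.coeff_eq {a : ℚ} {c : Chain n} (h : G.AlexanderHomogeneous a c)
    {x : State n} {m : ℕ} (hm : G.alexander x - a = m) : c x = C ((c x).coeff m) * Polynomial.X ^ m := by
  ext k
  rw [coeff_C_mul_X_pow]
  split_ifs with hk
  · rw [hk]
  · by_contra h2
    have h3 := h x k h2
    exact hk (by exact_mod_cast (show (k : ℚ) = m by linarith))

theorem AlexanderHomogeneous.exists_nat {a : ℚ} {c : Chain n} (h : G.AlexanderHomogeneous a c)
    {x : State n} (hx : c x ≠ 0) : ∃ m : ℕ, G.alexander x - a = m := by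
  obtain ⟨k, hk⟩ : ∃ k, (c x).coeff k ≠ 0 := by
    by_contra h2
    push Not at h2
    exact hx (Polynomial.ext fun k => by simpa using h2 k)
  exact ⟨k, by have := h x k hk; linarith⟩

theorem AlexanderHomogeneous.homogenize_specialize {a : ℚ} {c : Chain n}
    (h : G.AlexanderHomogeneous a c) : homogenize G a (specialize c) = c := by
  funext x
  by_cases hx : c x = 0
  · simp [homogenize, specialize, hx]
  obtain ⟨m, hm⟩ := h.exists_nat hx
  have h1 := h.coeff_eq hm
  have h2 : (c x).eval 1 = (c x).coeff m := by
    conv_lhs => rw [h1]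
    simp
  rw [homogenize, specialize, h2, hm, Nat.floor_natCast]
  exact h1.symm

theorem alexanderHomogeneous_homogenize {a : ℚ} {z : State n → ZMod 2}
    (hz : ∀ x, z x ≠ 0 → ∃ m : ℕ, G.alexander x - a = m) :
    G.AlexanderHomogeneous a (homogenize G a z) := by
  intro x k hk
  rw [homogenize, coeff_C_mul_X_pow] at hk
  split_ifs at hk with h1
  · obtain ⟨m, hm⟩ := hz x hk
    rw [hm, Nat.floor_natCast] at h1
    rw [h1, ← hm]
    ring
  · exact absurd rfl hk

/-- A preimage at U = 1 may involve states of grading below `a`; a sufficiently large power of U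
makes room for them. -/
theorem isUPowerBoundary_iff {a : ℚ} {c : Chain n} (h : G.AlexanderHomogeneous a c) :
    G.IsUPowerBoundary c ↔ ∃ u, Matrix.vecMul u (avoidMatrix G.X) = specialize c := by
  constructor
  · rintro ⟨k, z, hz⟩
    refine ⟨specialize z, ?_⟩
    rw [← specialize_boundary, hz]
    funext x
    simp [specialize]
  · rintro ⟨u, hu⟩
    -- For the zero chain, `a` need not differ from the gradings of the states by integers.
    by_cases h0 : ∀ x, c x = 0
    · refine ⟨0, 0, ?_⟩
      funext x
      simp [h0 x]
    push Not at h0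
    obtain ⟨x0, hx0⟩ := h0
    obtain ⟨m0, hm0⟩ := h.exists_nat hx0
    have hint : ∀ x, ∃ m : ℤ, G.alexander x - a = m := by
      intro x
      obtain ⟨m, hm⟩ := exists_int_alexander_sub G x x0
      exact ⟨m + m0, by push_cast; linarith⟩
    choose f hf using hint
    -- A crude bound: every state has grading at least `a - K`.
    set K : ℕ := ∑ x, (f x).natAbs with hK
    have hKf : ∀ x, 0 ≤ f x + K := by
      intro x
      have : (f x).natAbs ≤ K :=
        Finset.single_le_sum (f := fun x => (f x).natAbs) (fun _ _ => Nat.zero_le _)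
          (Finset.mem_univ x)
      omega
    have hb : ∀ x, ∃ m : ℕ, G.alexander x - (a - K) = m := by
      intro x
      refine ⟨(f x + K).toNat, ?_⟩
      have h1 : (((f x + K).toNat : ℤ) : ℚ) = ((f x + K : ℤ) : ℚ) := by
        rw [Int.toNat_of_nonneg (hKf x)]
      have h2 := hf x
      push_cast at h1
      rw [h1]
      linarith
    refine ⟨K, homogenize G (a - K) u, ?_⟩
    rw [boundary_homogenize fun x _ => hb x, hu]
    funext x
    by_cases hx : c x = 0
    · simp [homogenize, specialize, hx]
    · conv_rhs => rw [← h.homogenize_specialize]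
      obtain ⟨m, hm⟩ := h.exists_nat hx
      have h2 : G.alexander x - (a - K) = ((m + K : ℕ) : ℚ) := by push_cast; linarith
      simp only [homogenize, Pi.smul_apply, smul_eq_mul, hm, h2, Nat.floor_natCast, pow_add]
      ring

end Homogenize

/-! ### Translates of the diagonal as grid states. -/

theorem val_sub_eq_ite (u v : Fin n) :
    (u - v).val = if v.val ≤ u.val then u.val - v.val else n + u.val - v.val := by
  split_ifs with h
  · exact Fin.sub_val_of_le h
  · exact Fin.coe_sub_iff_lt.mpr (not_le.mp h)

/-- A rectangle out of the state `S` contains a square of `S`. -/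
theorem avoidMatrix_self_left (S y : State n) : avoidMatrix S S y = 0 := by
  by_contra h
  obtain ⟨i, j, h1, h2, rfl, h4⟩ := exists_rect_of_rectMatrix_ne_zero h
  have := avoidWeight_ne_zero_iff.mp h4 i
  rw [dom_eq_ite, if_pos ⟨left_mem_arc h1, left_mem_arc (S.injective.ne h1)⟩] at this
  exact one_ne_zero this

/-- The permutation matrix of `S` is a line on the torus. -/
def IsShift (S : State n) : Prop := ∀ a b c, S c ∈ arc (S a) (S b) ↔ c ∈ arc a b

variable {S : State n}

/-- A rectangle into `S` over the columns from `i` to `j` has the rows from `S j` to `S i`, and the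
line `S` meets these rows in the complementary columns. -/
theorem IsShift.dom_move (hS : IsShift S) {i j : Fin n} (hij : i ≠ j) (k : Fin n) :
    dom (move S (i, j)) (i, j) (k, S k) = 0 := by
  have e1 : move S (i, j) i = S j := by simp [move]
  have e2 : move S (i, j) j = S i := by simp [move]
  rw [dom_eq_ite, if_neg]
  rintro ⟨h1, h2⟩
  simp only [e1, e2] at h1 h2
  rw [hS] at h2
  have := arcInd_add_arcInd hij k
  simp [arcInd, h1, h2] at this

theorem IsShift.isEmptyRect_move (hS : IsShift S) {i j : Fin n} (hij : i ≠ j) :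
    IsEmptyRect (move S (i, j)) (i, j) := by
  rintro k ⟨h1, h2⟩
  rw [Finset.mem_erase] at h1 h2
  have h3 : k ≠ j := by rintro rfl; exact right_notMem_arc _ _ h1.2
  have h4 := hS.dom_move hij k
  have h5 : move S (i, j) k = S k := by
    simp [move, Equiv.swap_apply_of_ne_of_ne h1.1 h3]
  rw [dom_eq_ite, if_pos ⟨h1.2, by rw [← h5]; exact h2.2⟩] at h4
  exact one_ne_zero h4

theorem eq_move_of_eq_move {x y : State n} {r : Fin n × Fin n} (h : y = move x r) :
    x = move y r := by
  rw [h]; simp [move, mul_assoc]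

/-- Both rectangles from a neighbour into `S` are empty and avoid `S`, so they cancel modulo 2. -/
theorem IsShift.avoidMatrix_self_right (hS : IsShift S) (x : State n) : avoidMatrix S x S = 0 := by
  classical
  rw [avoidMatrix, rectMatrix]
  have hv : ∀ r ∈ rect x S, avoidWeight S (dom x r) = 1 ∧ IsEmptyRect x r := by
    intro r hr
    simp only [rect, Finset.mem_filter, Finset.mem_univ, true_and] at hr
    have h := eq_move_of_eq_move hr.2
    refine ⟨?_, by rw [h]; exact hS.isEmptyRect_move hr.1⟩
    rw [avoidWeight, if_pos]
    intro k
    rw [h]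
    exact hS.dom_move hr.1 k
  have hmem : ∀ r ∈ rect x S, r.swap ∈ rect x S := by
    intro r hr
    simp only [rect, Finset.mem_filter, Finset.mem_univ, true_and] at hr ⊢
    exact ⟨hr.1.symm, by rw [hr.2]; simp [Equiv.swap_comm r.1 r.2]⟩
  refine Finset.sum_involution (fun r _ => r.swap) ?_ ?_ ?_ (fun r _ => r.swap_swap)
  · intro r hr
    rw [Finset.mem_filter] at hr
    rw [(hv r hr.1).1, (hv _ (hmem r hr.1)).1]
    exact CharTwo.add_self_eq_zero _
  · intro r hr _ h
    rw [Finset.mem_filter] at hr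
    simp only [rect, Finset.mem_filter, Finset.mem_univ, true_and] at hr
    exact hr.1.1 (congrArg Prod.snd h)
  · intro r hr
    rw [Finset.mem_filter] at hr ⊢
    exact ⟨hmem r hr.1, (hv _ (hmem r hr.1)).2⟩

theorem IsShift.hitMatrix_self_right (hS : IsShift S) (j : Fin n) (x : State n) :
    hitMatrix S j x S = 0 := by
  by_contra h
  obtain ⟨a, b, h1, h2, h3, h4, h5⟩ := exists_rect_of_hitMatrix_ne_zero h
  rw [eq_move_of_eq_move h3, hS.dom_move h1] at h4
  exact zero_ne_one h4

section Neighbours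

variable [NeZero n]

/-- Translation of the rows. -/
def shift (s : Fin n) : State n := Equiv.addRight s

theorem shift_apply (s k : Fin n) : shift s k = k + s := rfl

theorem isShift_shift (s : Fin n) : IsShift (shift s) := by
  intro a b c
  simp only [arc, shift_apply, Finset.mem_filter, Finset.mem_univ, true_and,
    add_sub_add_right_eq_sub]

/-- Measure heights over the line `shift s`. For a rectangle off this line, the upper left corner
exceeds the lower right one by width plus height, hence by at least 2. The points of the final state
have constant height, except one more in column 0 and one less in column 1. -/
theorem eq_zero_one_of_avoid (hn : 2 ≤ n) {s t : Fin n} (h2 : 2 ≤ (t - s).val)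
    (h3 : (t - s).val + 2 ≤ n) {i j : Fin n} (hij : i ≠ j) {y : State n}
    (hy : move (shift t) (0, 1) = move y (i, j))
    (ha : ∀ k, dom y (i, j) (k, shift s k) = 0) : i = 0 ∧ j = 1 := by
  set z := move (shift t) (0, 1) with hz
  have hyz := eq_move_of_eq_move hy
  have yi : y i = z j := by rw [hyz]; simp [move]
  have yj : y j = z i := by rw [hyz]; simp [move]
  have one_val : (1 : Fin n).val = 1 := by
    rw [Fin.val_one', Nat.mod_eq_of_lt (by omega)]
  have zk : ∀ k, (k = 0 ∧ (z k - k - s).val = (t - s).val + 1) ∨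
      (k = 1 ∧ (z k - k - s).val + 1 = (t - s).val) ∨ (z k - k - s).val = (t - s).val := by
    intro k
    by_cases h0 : k = 0
    · refine Or.inl ⟨h0, ?_⟩
      have : z k - k - s = (t - s) + 1 := by
        rw [hz, h0]
        simp only [move, Equiv.Perm.mul_apply, Equiv.swap_apply_left, shift_apply]
        abel
      rw [this, Fin.val_add_eq_ite, one_val, if_neg (by omega)]
    by_cases h1 : k = 1
    · refine Or.inr (Or.inl ⟨h1, ?_⟩)
      have : z k - k - s = (t - s) - 1 := by
        rw [hz, h1]
        simp only [move, Equiv.Perm.mul_apply, Equiv.swap_apply_right, shift_apply]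
        abel
      rw [this, val_sub_eq_ite, one_val, if_pos (by omega)]
      omega
    · refine Or.inr (Or.inr ?_)
      have : z k - k - s = t - s := by
        rw [hz]
        simp only [move, Equiv.Perm.mul_apply, Equiv.swap_apply_of_ne_of_ne h0 h1, shift_apply]
        abel
      rw [this]
  have mem : ∀ k : Fin n, ¬ ((k - i).val < (j - i).val ∧ (k + s - z j).val < (z i - z j).val) := by
    intro k hk
    have h := ha k
    rw [dom_eq_ite, if_pos] at h
    · exact one_ne_zero h
    · simp only [arc, yi, yj, shift_apply, Finset.mem_filter, Finset.mem_univ, true_and]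
      exact hk
  have hw : 0 < (j - i).val := by
    rw [Nat.pos_iff_ne_zero]
    intro h
    exact hij (sub_eq_zero.mp (Fin.ext (by simpa using h))).symm
  have hh : 0 < (z i - z j).val := by
    rw [Nat.pos_iff_ne_zero]
    intro h
    exact hij (z.injective (sub_eq_zero.mp (Fin.ext (by simpa using h))))
  -- Avoidance is used in the bottom row and in the left column only. Below, `U` is the height of
  -- the lower left corner over the line, `W` the width and `H` the height of the rectangle; `A` and
  -- `B` are the heights of the upper left and lower right corners.
  have m1 := mem (z j - s)
  have m2 := mem i
  rw [show z j - s + s - z j = 0 by abel, show z j - s - i = z j - i - s by abel] at m1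
  rw [sub_self, show i + s - z j = 0 - (z j - i - s) by abel] at m2
  have e1 : z j - j - s = (z j - i - s) - (j - i) := by abel
  have e2 : z i - i - s = (z j - i - s) + (z i - z j) := by abel
  have e1 := congrArg Fin.val e1
  have e2 := congrArg Fin.val e2
  rw [val_sub_eq_ite (z j - i - s)] at e1
  rw [Fin.val_add_eq_ite] at e2
  have v0 : (0 : Fin n).val = 0 := rfl
  have m2v : 0 < (z j - i - s).val →
      (0 - (z j - i - s)).val = n - (z j - i - s).val := by
    intro h
    rw [val_sub_eq_ite, if_neg (by omega)]
    omega
  have b1 := (z j - i - s).isLt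
  have b2 := (z i - z j).isLt
  have b3 := (j - i).isLt
  have zi := zk i
  have zj := zk j
  rw [v0] at m1
  generalize (0 - (z j - i - s)).val = V at *
  generalize (z j - i - s).val = U at *
  generalize (z i - z j).val = H at *
  generalize (j - i).val = W at *
  generalize (z i - i - s).val = A at *
  generalize (z j - j - s).val = B at *
  generalize (t - s).val = T at *
  have hWU : W ≤ U := by omega
  rw [if_pos hWU] at e1
  have hUH : U + H ≤ n := by omega
  have hA : A = U + H := by
    split_ifs at e2 with h
    · omega
    · exact e2
  rcases zi with ⟨h, _⟩ | ⟨_, _⟩ | _ <;> rcases zj with ⟨_, _⟩ | ⟨h', _⟩ | _ <;>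
    first | exact ⟨h, h'⟩ | omega

/-- When the two lines are at distance at least 2 on both sides, the thin rectangle over column 0 is
the only one into this state that avoids `shift s`. -/
theorem avoidMatrix_mulVec_shift (hn : 2 ≤ n) {s t : Fin n} (h2 : 2 ≤ (t - s).val)
    (h3 : (t - s).val + 2 ≤ n) :
    Matrix.mulVec (avoidMatrix (shift s)) (Pi.single (move (shift t) (0, 1)) 1) =
      Pi.single (shift t) 1 := by
  classical
  have one_val : (1 : Fin n).val = 1 := by
    rw [Fin.val_one', Nat.mod_eq_of_lt (by omega)]
  have h01 : (0 : Fin n) ≠ 1 := by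
    rw [Ne, Fin.ext_iff, one_val]; simp
  funext y
  rw [Matrix.mulVec_single_one, Matrix.col_apply, Pi.single_apply]
  split_ifs with hy
  · subst hy
    rw [avoidMatrix, rectMatrix, Finset.sum_eq_single (0, 1)]
    · rw [avoidWeight, if_pos]
      intro k
      rw [dom_eq_ite, if_neg]
      simp only [arc, Finset.mem_filter, Finset.mem_univ, true_and, shift_apply, sub_zero, zero_add,
        add_sub_cancel_right, one_val]
      rintro ⟨h4, h5⟩
      have h6 : k = 0 := Fin.ext (by simpa using h4)
      subst h6
      rw [zero_add, Nat.lt_one_iff, val_sub_eq_ite] at h5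
      rw [val_sub_eq_ite] at h2
      have := t.isLt
      have := s.isLt
      split_ifs at * <;> omega
    · intro r hr hr1
      rw [Finset.mem_filter] at hr
      simp only [rect, Finset.mem_filter, Finset.mem_univ, true_and] at hr
      by_contra h
      obtain ⟨h4, h5⟩ := eq_zero_one_of_avoid hn h2 h3 (i := r.1) (j := r.2) hr.1.1 hr.1.2
        (avoidWeight_ne_zero_iff.mp h)
      exact hr1 (Prod.ext h4 h5)
    · intro h
      refine absurd ?_ h
      rw [Finset.mem_filter]
      refine ⟨by simp [rect, h01], ?_⟩
      rw [isEmptyRect_iff]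
      rintro k ⟨h4, _⟩
      simp only [CycBtw, Fin.lt_def, one_val, Fin.val_zero] at h4
      omega
  · by_contra h
    obtain ⟨i, j, h4, h5, h6, h7⟩ := exists_rect_of_rectMatrix_ne_zero h
    obtain ⟨rfl, rfl⟩ := eq_zero_one_of_avoid hn h2 h3 h4 h6 (avoidWeight_ne_zero_iff.mp h7)
    apply hy
    rw [eq_move_of_eq_move h6]
    simp [move, mul_assoc]

end Neighbours

/-! ### Linear algebra over 𝔽₂. -/

section LinearAlgebra

open Matrix

variable {α : Type*} [Fintype α]

/-- At an element of the support with the largest `Q` nothing cancels the diagonal entry. -/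
theorem vecMul_eq_zero_of_unitriangular {M : Matrix α α (ZMod 2)} {Q : α → ℚ}
    (h1 : ∀ x, M x x = 1) (h2 : ∀ x y, x ≠ y → M x y ≠ 0 → Q y < Q x) {v : α → ZMod 2}
    (hv : v ᵥ* M = 0) : v = 0 := by
  by_contra h
  obtain ⟨x0, hx0⟩ := Function.ne_iff.mp h
  obtain ⟨x, hx, hmax⟩ := Finset.exists_max_image (Finset.univ.filter fun x => v x ≠ 0) Q
    ⟨x0, by simpa using hx0⟩
  simp only [Finset.mem_filter, Finset.mem_univ, true_and] at hx hmax
  apply hx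
  have := congrFun hv x
  rw [vecMul, dotProduct, Fintype.sum_eq_single x, h1, mul_one] at this
  · exact this
  · intro w hw
    by_contra h3
    exact absurd (hmax w (left_ne_zero_of_mul h3))
      (not_le.mpr (h2 w x hw (right_ne_zero_of_mul h3)))

theorem exists_vecMul_eq_of_unitriangular {M : Matrix α α (ZMod 2)} {Q : α → ℚ}
    (h1 : ∀ x, M x x = 1) (h2 : ∀ x y, x ≠ y → M x y ≠ 0 → Q y < Q x) (z : α → ZMod 2) :
    ∃ v, v ᵥ* M = z := by
  have hinj : Function.Injective (vecMulLinear M) := by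
    rw [injective_iff_map_eq_zero]
    exact fun v hv => vecMul_eq_zero_of_unitriangular h1 h2 hv
  exact LinearMap.injective_iff_surjective.mp hinj z

/-- Finite-dimensional duality: the range of the dual map is the annihilator of the kernel. -/
theorem exists_mulVec_eq {D : Matrix α α (ZMod 2)} {c : α → ZMod 2}
    (h : ∀ z, z ᵥ* D = 0 → c ⬝ᵥ z = 0) : ∃ b, D *ᵥ b = c := by
  classical
  have h1 : dotProductBilin (ZMod 2) (ZMod 2) c ∈ LinearMap.range (vecMulLinear D).dualMap := by
    rw [LinearMap.range_dualMap_eq_dualAnnihilator_ker, Submodule.mem_dualAnnihilator]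
    exact fun z hz => h z hz
  obtain ⟨ψ, hψ⟩ := h1
  refine ⟨fun x => ψ (Pi.single x 1), ?_⟩
  funext y
  have h2 := LinearMap.congr_fun hψ (Pi.single y 1)
  have h3 : c ⬝ᵥ Pi.single y 1 = c y := by simp
  have h4 : ψ (D y) = c y := by
    rw [← h3]
    simp only [LinearMap.dualMap_apply, vecMulLinear_apply, single_one_vecMul] at h2
    exact h2
  rw [← h4, mulVec, dotProduct]
  conv_rhs => rw [pi_eq_sum_univ (D y), map_sum]
  refine Finset.sum_congr rfl fun x _ => ?_
  rw [map_smul, smul_eq_mul]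
  congr 2
  funext j
  simp [Pi.single_apply, eq_comm]

theorem add_eq_self_of_two {M : Type*} [AddCommGroup M] [Module (ZMod 2) M] (a : M) : a + a = 0 := by
  rw [← two_smul (ZMod 2) a, show (2 : ZMod 2) = 0 from rfl, zero_smul]

open Classical in
/-- Elimination for a pair of commuting matrices that are unitriangular, up to the involution `σ`,
from `L ∪ F'` to `Y`. -/
theorem exists_cycle_decomposition {D Φ : Matrix α α (ZMod 2)} (hD : D * D = 0)
    (hc : D * Φ = Φ * D) {F F' L Y : Set α} {σ : α → α} (Q : α → ℚ)
    (hF : ∀ x y, x ∈ F → D x y ≠ 0 → y ∈ F) (hF' : ∀ x y, x ∈ F' → D x y ≠ 0 → y ∈ F')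
    (hΦ : ∀ x y, x ∈ F' → Φ x y ≠ 0 → y ∈ F) (hLF : L ⊆ F)
    (hcover : ∀ x ∈ F, x ∈ Y ∨ x ∈ L ∨ x ∈ F') (hYF' : Disjoint Y F') (hLF' : Disjoint L F')
    (hσ : ∀ x, σ (σ x) = x) (hσY : ∀ x, σ x ∈ Y ↔ x ∈ L ∨ x ∈ F')
    (hL1 : ∀ x ∈ L, D x (σ x) = 1)
    (hL2 : ∀ x ∈ L, ∀ y ∈ Y, y ≠ σ x → D x y ≠ 0 → Q y < Q (σ x))
    (hF1 : ∀ x ∈ F', Φ x (σ x) = 1)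
    (hF2 : ∀ x ∈ F', ∀ y ∈ Y, y ≠ σ x → Φ x y ≠ 0 → Q y < Q (σ x))
    {z : α → ZMod 2} (hz : ∀ x, z x ≠ 0 → x ∈ F) (hzD : z ᵥ* D = 0) :
    ∃ u w f : α → ZMod 2, z = u ᵥ* D + w ᵥ* Φ + f ∧ (∀ x, w x ≠ 0 → x ∈ F') ∧ w ᵥ* D = 0 ∧
      ∀ x, f x ≠ 0 → x ∈ F' := by
  -- `T` collects the rows of `D` in `L` and those of `Φ` in `F'`. Its columns in `Y`, with rows
  -- permuted by `σ`, are completed by identity columns to the unitriangular matrix `M`.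
  set T : Matrix α α (ZMod 2) := fun x y =>
    if x ∈ L then D x y else if x ∈ F' then Φ x y else 0 with hT
  set M : Matrix α α (ZMod 2) := fun x y => if y ∈ Y then T (σ x) y else if x = y then 1 else 0
    with hM
  have hnot : ∀ {x}, x ∈ F' → x ∉ L := fun h h' => Set.disjoint_left.mp hLF' h' h
  have h1 : ∀ x, M x x = 1 := by
    intro x
    by_cases hx : x ∈ Y
    · have hx' := (hσY (σ x)).mp (by rwa [hσ])
      simp only [hM, hT, if_pos hx]
      rcases hx' with h | h
      · rw [if_pos h]
        simpa [hσ] using hL1 _ h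
      · rw [if_neg (hnot h), if_pos h]
        simpa [hσ] using hF1 _ h
    · simp [hM, hx]
  have h2 : ∀ x y, x ≠ y → M x y ≠ 0 → Q y < Q x := by
    intro x y hxy h
    by_cases hy : y ∈ Y
    · simp only [hM, hT, if_pos hy] at h
      split_ifs at h with h3 h4
      · simpa [hσ] using hL2 _ h3 y hy (by rw [hσ]; exact hxy.symm) h
      · simpa [hσ] using hF2 _ h4 y hy (by rw [hσ]; exact hxy.symm) h
      · exact absurd rfl h
    · simp only [hM, if_neg hy, if_neg hxy] at h
      exact absurd rfl h
  have hMT : ∀ (v : α → ZMod 2), ∀ y ∈ Y,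
      ((fun x => v (σ x)) ᵥ* M) y = (v ᵥ* T) y := by
    intro v y hy
    simp only [vecMul, dotProduct, hM, if_pos hy]
    exact Equiv.sum_comp (Function.Involutive.toPerm σ hσ) fun x => v x * T x y
  have hTsplit : ∀ (v : α → ZMod 2), v ᵥ* T = (fun x => if x ∈ L then v x else 0) ᵥ* D +
      (fun x => if x ∈ F' then v x else 0) ᵥ* Φ := by
    intro v
    funext y
    simp only [vecMul, dotProduct, Pi.add_apply, ← Finset.sum_add_distrib]
    refine Finset.sum_congr rfl fun x _ => ?_
    by_cases h : x ∈ F'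
    · simp [hT, h, hnot h]
    · by_cases h' : x ∈ L <;> simp [hT, h, h']
  -- Clears `z` on `Y`; the remainder `z2` then lives on `L` and `F'`, with parts `l` and `f`.
  obtain ⟨v', hv'⟩ := exists_vecMul_eq_of_unitriangular h1 h2 fun x => if x ∈ Y then z x else 0
  set v : α → ZMod 2 := fun x => v' (σ x) with hv
  have hvv : (fun x => v (σ x)) = v' := by funext x; simp [hv, hσ]
  set u : α → ZMod 2 := fun x => if x ∈ L then v x else 0 with hu
  set w : α → ZMod 2 := fun x => if x ∈ F' then v x else 0 with hw
  have hwF : ∀ x, w x ≠ 0 → x ∈ F' := by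
    intro x hx
    by_contra h
    exact hx (if_neg h)
  have huF : ∀ x, u x ≠ 0 → x ∈ F := by
    intro x hx
    by_contra h
    exact hx (if_neg fun h' => h (hLF h'))
  have supp : ∀ {A : Matrix α α (ZMod 2)} {P R : Set α} {a : α → ZMod 2},
      (∀ x, a x ≠ 0 → x ∈ P) → (∀ x y, x ∈ P → A x y ≠ 0 → y ∈ R) →
      ∀ y, (a ᵥ* A) y ≠ 0 → y ∈ R := by
    intro A P R a ha hA y hy
    obtain ⟨x, _, hx⟩ := Finset.exists_ne_zero_of_sum_ne_zero hy
    exact hA x y (ha x (left_ne_zero_of_mul hx)) (right_ne_zero_of_mul hx)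
  set z2 : α → ZMod 2 := z + (u ᵥ* D + w ᵥ* Φ) with hz2
  have hz2Y : ∀ y ∈ Y, z2 y = 0 := by
    intro y hy
    have h3 := hMT v y hy
    rw [hvv, hv', hTsplit] at h3
    simp only [if_pos hy] at h3
    rw [hz2, Pi.add_apply, ← h3]
    exact CharTwo.add_self_eq_zero _
  have hz2F : ∀ x, z2 x ≠ 0 → x ∈ F := by
    intro x hx
    by_contra h
    have e1 : z x = 0 := by by_contra h'; exact h (hz x h')
    have e2 : (u ᵥ* D) x = 0 := by by_contra h'; exact h (supp huF hF x h')
    have e3 : (w ᵥ* Φ) x = 0 := by by_contra h'; exact h (supp hwF hΦ x h')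
    exact hx (by simp [hz2, e1, e2, e3])
  set l : α → ZMod 2 := fun x => if x ∈ L then z2 x else 0 with hl
  set f : α → ZMod 2 := fun x => if x ∈ F' then z2 x else 0 with hf
  have hfF : ∀ x, f x ≠ 0 → x ∈ F' := by
    intro x hx
    by_contra h
    exact hx (if_neg h)
  have hz2lf : z2 = l + f := by
    funext x
    simp only [hl, hf, Pi.add_apply]
    by_cases h : x ∈ F'
    · simp [h, hnot h]
    · by_cases h' : x ∈ L
      · simp [h, h']
      · simp only [h, h', if_false, add_zero]
        by_contra h3
        rcases hcover x (hz2F x h3) with h4 | h4 | h4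
        · exact h3 (hz2Y x h4)
        · exact h' h4
        · exact h h4
  have hwDF := supp hwF hF'
  -- On `Y` the middle term vanishes, so this says that `T` kills `l + w ᵥ* D` there.
  -- Unitriangularity makes the sum zero, and the summands have disjoint supports, in `L` and in
  -- `F'`, so each is zero.
  have hzz : l ᵥ* D + f ᵥ* D + (w ᵥ* D) ᵥ* Φ = 0 := by
    rw [← add_vecMul, ← hz2lf, hz2, add_vecMul, add_vecMul, hzD, vecMul_vecMul, hD, vecMul_zero,
      vecMul_vecMul, vecMul_vecMul, hc, zero_add, zero_add]
    exact add_eq_self_of_two _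
  have hlw : (fun x => (l + w ᵥ* D) (σ x)) = 0 := by
    apply vecMul_eq_zero_of_unitriangular h1 h2
    funext y
    by_cases hy : y ∈ Y
    · rw [hMT _ y hy, hTsplit]
      have e1 : (fun x => if x ∈ L then (l + w ᵥ* D) x else 0) = l := by
        funext x
        by_cases h : x ∈ L
        · have : (w ᵥ* D) x = 0 := by
            by_contra h'
            exact hnot (hwDF x h') h
          simp [h, this]
        · simp [h, hl]
      have e2 : (fun x => if x ∈ F' then (l + w ᵥ* D) x else 0) = w ᵥ* D := by
        funext x
        by_cases h : x ∈ F'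
        · simp [h, hl, hnot h]
        · rw [if_neg h]
          by_contra h'
          exact h (hwDF x (Ne.symm h'))
      have e3 : (f ᵥ* D) y = 0 := by
        by_contra h'
        exact Set.disjoint_left.mp hYF' hy (supp hfF hF' y h')
      have := congrFun hzz y
      rw [Pi.add_apply, Pi.add_apply, e3, add_zero] at this
      rw [e1, e2, Pi.add_apply, this]
    · have e0 : σ y ∉ L ∧ σ y ∉ F' := by
        rw [← not_or, ← hσY, hσ]
        exact hy
      simp only [vecMul, dotProduct, hM, if_neg hy, mul_ite, mul_one, mul_zero, Finset.sum_ite_eq',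
        Finset.mem_univ, if_true, Pi.add_apply, Pi.zero_apply, hl, if_neg e0.1,
        zero_add]
      by_contra h'
      exact e0.2 (hwDF _ h')
  have hlw0 : ∀ x, (l + w ᵥ* D) x = 0 := by
    intro x
    have := congrFun hlw (σ x)
    simpa [hσ] using this
  have hl0 : l = 0 := by
    funext x
    by_cases h : x ∈ L
    · have h3 : (w ᵥ* D) x = 0 := by
        by_contra h'
        exact hnot (hwDF x h') h
      have := hlw0 x
      rwa [Pi.add_apply, h3, add_zero] at this
    · exact if_neg h
  refine ⟨u, w, f, ?_, hwF, ?_, hfF⟩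
  · rw [hl0, zero_add] at hz2lf
    rw [← hz2lf, hz2, add_left_comm, add_eq_self_of_two, add_zero]
  · funext x
    have := hlw0 x
    rwa [hl0, Pi.add_apply, Pi.zero_apply, zero_add] at this

end LinearAlgebra

/-! ### States containing an initial piece of the diagonal. -/

section Fixing

theorem mem_arc_of_succ {a b c : Fin n} (hab : a ≠ b)
    (hc : c.val + 1 = b.val ∨ b.val = 0 ∧ c.val + 1 = n) : c ∈ arc a b := by
  rw [mem_arc]
  simp only [Fin.le_def, Fin.lt_def, Ne, Fin.ext_iff] at *
  omega

theorem exists_succ_eq (b : Fin n) : ∃ c : Fin n, c.val + 1 = b.val ∨ b.val = 0 ∧ c.val + 1 = n := by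
  rcases Nat.eq_zero_or_pos b.val with h | h
  · exact ⟨⟨n - 1, by omega⟩, Or.inr ⟨h, by simp; omega⟩⟩
  · exact ⟨⟨b.val - 1, by omega⟩, Or.inl (by simp; omega)⟩

theorem eq_of_forall_mem_arc {a b m m' : Fin n} (hm : m'.val = m.val + 1) (hab : a ≠ b)
    (h : ∀ c ∈ arc a b, c = m) : a = m ∧ b = m' := by
  refine ⟨h a (left_mem_arc hab), ?_⟩
  obtain ⟨c, hc⟩ := exists_succ_eq b
  have := h c (mem_arc_of_succ hab hc)
  subst this
  ext
  omega

theorem dom_pos {x : State n} {i j a b : Fin n} (ha : a ∈ arc i j) (hb : b ∈ arc (x i) (x j)) :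
    dom x (i, j) (a, b) = 1 := by
  rw [dom_eq_ite, if_pos ⟨ha, hb⟩]

/-- A rectangle with lower left corner at this point contains the diagonal square `k`; one with
upper right corner there contains the preceding diagonal square. -/
theorem move_apply_of_fixed {x : State n} {i j k : Fin n} (hij : i ≠ j) (hk : x k = k)
    (h1 : dom x (i, j) (k, k) = 0)
    (h2 : ∀ c : Fin n, (c.val + 1 = k.val ∨ k.val = 0 ∧ c.val + 1 = n) → dom x (i, j) (c, c) = 0) :
    move x (i, j) k = k := by
  have hki : k ≠ i := by
    rintro rfl
    rw [dom_pos (left_mem_arc hij)] at h1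
    · exact one_ne_zero h1
    · have h3 := left_mem_arc (x.injective.ne hij)
      rw [hk] at h3 ⊢
      exact h3
  have hkj : k ≠ j := by
    rintro rfl
    obtain ⟨c, hc⟩ := exists_succ_eq k
    have h3 := h2 c hc
    rw [dom_pos (mem_arc_of_succ hij hc)] at h3
    · exact one_ne_zero h3
    · rw [hk]
      refine mem_arc_of_succ ?_ hc
      rw [← hk]
      exact fun h => hij (x.injective h)
  simp [move, Equiv.swap_apply_of_ne_of_ne hki hkj, hk]

/-- The states that contain the first `k` points of the diagonal. -/
def fixing (k : ℕ) : Set (State n) := {x | ∀ j : Fin n, j.val < k → x j = j}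

theorem fixing_of_avoidMatrix {k : ℕ} {x y : State n} (hx : x ∈ fixing k)
    (h : avoidMatrix 1 x y ≠ 0) : y ∈ fixing k := by
  obtain ⟨i, j, hij, -, rfl, h4⟩ := exists_rect_of_rectMatrix_ne_zero h
  have h5 := avoidWeight_ne_zero_iff.mp h4
  exact fun l hl => move_apply_of_fixed hij (hx l hl) (h5 l) fun c _ => h5 c

/-- The admitted diagonal square touches only the diagonal points `m` and `m + 1`, so the earlier
ones stay. -/
theorem fixing_of_hitMatrix {m : Fin n} (hm : m.val + 1 < n) {x y : State n}
    (hx : x ∈ fixing (m.val + 1)) (h : hitMatrix 1 m x y ≠ 0) : y ∈ fixing m.val := by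
  obtain ⟨i, j, hij, -, rfl, -, h5⟩ := exists_rect_of_hitMatrix_ne_zero h
  refine fun l hl => move_apply_of_fixed hij (hx l (by omega)) (h5 l ?_) fun c hc => h5 c ?_
  · rw [Ne, Fin.ext_iff]; omega
  · rw [Ne, Fin.ext_iff]; omega

theorem mem_rect_move {x : State n} {i j : Fin n} (hij : i ≠ j) {r : Fin n × Fin n} :
    r ∈ rect x (move x (i, j)) ↔ r = (i, j) ∨ r = (j, i) := by
  obtain ⟨a, b⟩ := r
  simp only [rect, Finset.mem_filter, Finset.mem_univ, true_and, move, mul_right_inj,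
    Prod.mk.injEq]
  constructor
  · rintro ⟨_, h⟩
    have h1 := Equiv.congr_fun h i
    have h2 := Equiv.congr_fun h j
    rw [Equiv.swap_apply_left] at h1
    by_cases ha : i = a
    · subst ha
      rw [Equiv.swap_apply_left] at h1
      exact Or.inl ⟨rfl, h1.symm⟩
    by_cases hb : i = b
    · subst hb
      rw [Equiv.swap_apply_right] at h1
      exact Or.inr ⟨h1.symm, rfl⟩
    rw [Equiv.swap_apply_of_ne_of_ne ha hb] at h1
    exact absurd h1.symm hij
  · rintro (⟨rfl, rfl⟩ | ⟨rfl, rfl⟩)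
    · exact ⟨hij, rfl⟩
    · exact ⟨hij.symm, Equiv.swap_comm _ _⟩

theorem rectMatrix_move_eq {φ : (Fin n × Fin n → ℕ) → ZMod 2} {x : State n} {i j : Fin n}
    (hij : i ≠ j) (h1 : IsEmptyRect x (i, j)) (h2 : φ (dom x (j, i)) = 0) :
    rectMatrix φ x (move x (i, j)) = φ (dom x (i, j)) := by
  classical
  rw [rectMatrix, Finset.sum_eq_single (i, j)]
  · intro r hr hr1
    rw [Finset.mem_filter, mem_rect_move hij] at hr
    rcases hr.1 with rfl | rfl
    · exact absurd rfl hr1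
    · exact h2
  · intro h
    refine absurd ?_ h
    rw [Finset.mem_filter, mem_rect_move hij]
    exact ⟨Or.inl rfl, h1⟩

end Fixing

/-! ### The ordering used for the elimination. -/

section OffDiagonal

/-- A grading which a rectangle without squares of the diagonal, except for the one in column `m`,
lowers by the number of its squares off the diagonal and outside the row and the column `m`, each
counted a positive number of times. -/
def offDiag (m : Fin n) (x : State n) : ℚ :=
  ∑ a ∈ Finset.univ.erase m, ∑ b ∈ Finset.univ.erase m,
    (maslovOf 1 x - maslovOf (Equiv.swap a b) x) / 2

variable {x : State n} {i j m : Fin n}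

/-- For `a, b ≠ m` the transposition and the identity agree in column `m`, so that square drops out
of the difference of the two Maslov functions. -/
theorem offDiag_sub (hij : i ≠ j) (he : IsEmptyRect x (i, j))
    (hd : ∀ k, k ≠ m → dom x (i, j) (k, k) = 0) :
    offDiag m x - offDiag m (move x (i, j)) =
      ∑ a ∈ Finset.univ.erase m, ∑ b ∈ Finset.univ.erase m, ∑ k ∈ Finset.univ.erase m,
        (dom x (i, j) (k, Equiv.swap a b k) : ℚ) := by
  rw [offDiag, offDiag, ← Finset.sum_sub_distrib]
  refine Finset.sum_congr rfl fun a ha => ?_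
  rw [← Finset.sum_sub_distrib]
  refine Finset.sum_congr rfl fun b hb => ?_
  have h1 := maslovOf_sub_of_isEmptyRect hij he 1
  have h2 := maslovOf_sub_of_isEmptyRect hij he (Equiv.swap a b)
  rw [← Finset.add_sum_erase _ _ (Finset.mem_univ m)] at h1 h2
  rw [Equiv.swap_apply_of_ne_of_ne (Finset.ne_of_mem_erase ha).symm
    (Finset.ne_of_mem_erase hb).symm] at h2
  rw [Finset.sum_eq_zero (s := Finset.univ.erase m)] at h1
  · simp only [Equiv.Perm.one_apply] at h1
    linarith
  · intro k hk
    simp [hd k (Finset.ne_of_mem_erase hk)]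

theorem offDiag_lt (hij : i ≠ j) (he : IsEmptyRect x (i, j))
    (hd : ∀ k, k ≠ m → dom x (i, j) (k, k) = 0) {a b : Fin n} (ha : a ≠ m) (hb : b ≠ m)
    (h : dom x (i, j) (a, b) ≠ 0) : offDiag m (move x (i, j)) < offDiag m x := by
  rw [← sub_pos, offDiag_sub hij he hd]
  refine Finset.sum_pos' (fun a _ => Finset.sum_nonneg fun b _ => Finset.sum_nonneg fun k _ =>
    Nat.cast_nonneg _) ⟨a, by simp [ha], ?_⟩
  refine Finset.sum_pos' (fun b _ => Finset.sum_nonneg fun k _ =>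
    Nat.cast_nonneg _) ⟨b, by simp [hb], ?_⟩
  refine Finset.sum_pos' (fun k _ => Nat.cast_nonneg _) ⟨a, by simp [ha], ?_⟩
  rw [Equiv.swap_apply_left]
  exact_mod_cast Nat.pos_of_ne_zero h

theorem offDiag_move_of_column {m' : Fin n} (hm : m'.val = m.val + 1)
    (he : IsEmptyRect x (m, m')) : offDiag m (move x (m, m')) = offDiag m x := by
  have hmm : m ≠ m' := by rw [Ne, Fin.ext_iff]; omega
  have h0 : ∀ k, k ≠ m → ∀ s, dom x (m, m') (k, s) = 0 := by
    intro k hk s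
    rw [dom_eq_ite, if_neg]
    rintro ⟨h, -⟩
    simp only [mem_arc, Fin.le_def, Fin.lt_def, Ne, Fin.ext_iff] at *
    omega
  have := offDiag_sub hmm he fun k hk => h0 k hk k
  rw [Finset.sum_eq_zero, sub_eq_zero] at this
  · exact this.symm
  · intro a _
    refine Finset.sum_eq_zero fun b _ => Finset.sum_eq_zero fun k hk => ?_
    rw [h0 k (Finset.ne_of_mem_erase hk), Nat.cast_zero]

theorem eq_of_dom_eq_zero {m' : Fin n} (hm : m'.val = m.val + 1) (hij : i ≠ j)
    (h : ∀ a b, a ≠ m → b ≠ m → dom x (i, j) (a, b) = 0) :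
    (i = m ∧ j = m') ∨ (x i = m ∧ x j = m') := by
  by_cases hC : ∀ c ∈ arc i j, c = m
  · exact Or.inl (eq_of_forall_mem_arc hm hij hC)
  · push Not at hC
    obtain ⟨a, ha, ham⟩ := hC
    refine Or.inr (eq_of_forall_mem_arc hm (x.injective.ne hij) fun b hb => ?_)
    by_contra hbm
    have := h a b ham hbm
    rw [dom_pos ha hb] at this
    exact one_ne_zero this

/-- A rectangle without squares of the diagonal, except for the one in column `m`, lowers
`offDiag m` unless it lies in the column `m` or in the row `m`. -/
theorem offDiag_lt_or {m' : Fin n} (hm : m'.val = m.val + 1) (hij : i ≠ j)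
    (he : IsEmptyRect x (i, j)) (hd : ∀ k, k ≠ m → dom x (i, j) (k, k) = 0) :
    offDiag m (move x (i, j)) < offDiag m x ∨ (i = m ∧ j = m') ∨ (x i = m ∧ x j = m') := by
  by_cases h : ∀ a b, a ≠ m → b ≠ m → dom x (i, j) (a, b) = 0
  · exact Or.inr (eq_of_dom_eq_zero hm hij h)
  · push Not at h
    obtain ⟨a, b, ha, hb, h⟩ := h
    exact Or.inl (offDiag_lt hij he hd ha hb h)

end OffDiagonal

/-! ### Pushing cycles along the diagonal. -/

section Decomposition

open Matrix

theorem le_apply_of_mem_fixing {m j : Fin n} {x : State n} (hx : x ∈ fixing m.val) (hj : m ≤ j) :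
    m ≤ x j := by
  by_contra h
  have h2 := hx (x j) (not_le.mp h)
  have := x.injective h2
  rw [this] at h
  exact h hj

/-- Cycles that contain the first points of the diagonal can be pushed further along the
diagonal. -/
theorem exists_cycle_decomposition_fixing (hn : 2 ≤ n) {m m' : Fin n} (hm : m'.val = m.val + 1)
    {z : State n → ZMod 2} (hz : ∀ x, z x ≠ 0 → x ∈ fixing m.val)
    (hzD : z ᵥ* avoidMatrix 1 = 0) :
    ∃ u w f : State n → ZMod 2, z = u ᵥ* avoidMatrix 1 + w ᵥ* hitMatrix 1 m + f ∧
      (∀ x, w x ≠ 0 → x ∈ fixing m'.val) ∧ w ᵥ* avoidMatrix 1 = 0 ∧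
      ∀ x, f x ≠ 0 → x ∈ fixing m'.val := by
  have hmn := m'.isLt
  have hmm : m ≠ m' := by rw [Ne, Fin.ext_iff]; omega
  have hlt : m < m' := by rw [Fin.lt_def]; omega
  have mem' : ∀ x : State n, x ∈ fixing m'.val ↔ x ∈ fixing m.val ∧ x m = m := by
    intro x
    constructor
    · intro h
      exact ⟨fun j hj => h j (by omega), h m (by omega)⟩
    · rintro ⟨h1, h2⟩ j hj
      rcases Nat.lt_or_ge j.val m.val with h | h
      · exact h1 j h
      · rw [show j = m from Fin.ext (by omega), h2]
  have fix : ∀ x : State n, x ∈ fixing m.val ↔ move x (m, m') ∈ fixing m.val := by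
    have key : ∀ x : State n, x ∈ fixing m.val → move x (m, m') ∈ fixing m.val := by
      intro x hx j hj
      rw [move, Equiv.Perm.mul_apply, Equiv.swap_apply_of_ne_of_ne, hx j hj]
      · exact fun h => absurd (congrArg Fin.val h) (by dsimp only; omega)
      · exact fun h => absurd (congrArg Fin.val h) (by dsimp only; omega)
    refine fun x => ⟨key x, fun h => ?_⟩
    simpa [move, mul_assoc] using key _ h
  -- Interchanging the points in columns `m` and `m'` carries `Y` onto the union of `L` and the
  -- states that also fix `m`. The thin rectangle over column `m` realizes this matching.
  set L : Set (State n) := {x | x ∈ fixing m.val ∧ m < x m ∧ x m < x m'} with hL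
  set Y : Set (State n) := {x | x ∈ fixing m.val ∧ (x m' = m ∨ m < x m' ∧ x m' < x m)} with hY
  have empty : ∀ x : State n, IsEmptyRect x (m, m') := by
    intro x
    rw [isEmptyRect_iff]
    rintro k ⟨h, -⟩
    simp only [CycBtw, Fin.lt_def] at h
    omega
  -- The complementary rectangle contains the last diagonal square, so it is excluded and the thin
  -- one counts once.
  have last : ∀ x : State n, x m < x m' →
      dom x (m', m) (⟨n - 1, by omega⟩, ⟨n - 1, by omega⟩) = 1 := by
    intro x hx
    refine dom_pos ?_ ?_ <;>
    · rw [mem_arc]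
      simp only [Fin.lt_def, Fin.le_def] at *
      omega
  have ltF : ∀ x : State n, x ∈ fixing m'.val → x m < x m' := by
    intro x hx
    have h := (mem' x).mp hx
    have h2 := le_apply_of_mem_fixing h.1 hlt.le
    rw [h.2]
    refine lt_of_le_of_ne h2 fun h3 => ?_
    rw [← h.2] at h3
    exact hmm (x.injective h3)
  have domcol : ∀ (x : State n) (k s : Fin n), k ≠ m → dom x (m, m') (k, s) = 0 := by
    intro x k s hk
    rw [dom_eq_ite, if_neg]
    rintro ⟨h, -⟩
    simp only [mem_arc, Fin.le_def, Fin.lt_def, Ne, Fin.ext_iff] at *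
    omega
  -- Apart from the matching rectangle, only one in row `m` could fail to lower `offDiag m`; the
  -- shape of `Y` rules it out.
  have tri : ∀ x : State n, (x ∈ L ∨ x ∈ fixing m'.val) → ∀ i j, i ≠ j → IsEmptyRect x (i, j) →
      (∀ k, k ≠ m → dom x (i, j) (k, k) = 0) → move x (i, j) ∈ Y →
      move x (i, j) ≠ move x (m, m') →
      offDiag m (move x (i, j)) < offDiag m (move x (m, m')) := by
    intro x hx i j hij he hd hy hne
    rw [offDiag_move_of_column hm (empty x)]
    rcases offDiag_lt_or hm hij he hd with h | ⟨rfl, rfl⟩ | ⟨h1, h2⟩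
    · exact h
    · exact absurd rfl hne
    exfalso
    have hyi : move x (i, j) i = x j := by simp [move]
    have hyj : move x (i, j) j = x i := by simp [move]
    have hyk : ∀ k, k ≠ i → k ≠ j → move x (i, j) k = x k := fun k h h' => by
      simp [move, Equiv.swap_apply_of_ne_of_ne h h']
    rw [h2] at hyi
    rw [h1] at hyj
    have hxm : x m = m ∨ m < x m ∧ x m < x m' := by
      rcases hx with hx | hx
      · exact Or.inr hx.2
      · exact Or.inl ((mem' x).mp hx).2
    rcases hy.2 with h3 | ⟨h3, h4⟩
    · have : m' = j := (move x (i, j)).injective (h3.trans hyj.symm)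
      subst this
      rcases hxm with h5 | ⟨h5, h6⟩
      · have : i = m := x.injective (h1.trans h5.symm)
        subst this
        exact hne rfl
      · rw [h2] at h6
        rw [Fin.lt_def] at h5 h6
        omega
    · have hjm : j ≠ m := by
        rintro rfl
        rw [hyj] at h4
        exact absurd (h3.trans h4) (lt_irrefl _)
      have hjm' : j ≠ m' := by
        rintro rfl
        rw [hyj] at h3
        exact lt_irrefl _ h3
      have him : i ≠ m := by
        rintro rfl
        rw [hyi] at h4
        rw [Fin.lt_def] at h3 h4
        omega
      rw [hyk m him.symm hjm.symm] at h4
      have h7 : m < x m ∧ x m < x m' := by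
        rcases hxm with h5 | h5
        · exact absurd (x.injective (h1.trans h5.symm)) him
        · exact h5
      have him' : i ≠ m' := by
        rintro rfl
        rw [h1] at h7
        exact absurd (h7.1.trans h7.2) (lt_irrefl _)
      rw [hyk m' him'.symm hjm'.symm] at h4
      exact absurd (h4.trans h7.2) (lt_irrefl _)
  refine exists_cycle_decomposition (avoidMatrix_mul_self hn 1) (avoidMatrix_mul_hitMatrix hn 1 m)
    (F := fixing m.val) (F' := fixing m'.val) (L := L) (Y := Y) (σ := fun x => move x (m, m'))
    (offDiag m) (fun x y => fixing_of_avoidMatrix) (fun x y => fixing_of_avoidMatrix) ?_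
    (fun x hx => hx.1) ?_ ?_ ?_ ?_ ?_ ?_ ?_ ?_ ?_ hz hzD
  · intro x y hx h
    rw [hm] at hx
    exact fixing_of_hitMatrix (by omega) hx h
  · intro x hx
    rw [mem']
    have h1 := le_apply_of_mem_fixing hx le_rfl
    have h2 := le_apply_of_mem_fixing hx hlt.le
    have h3 := x.injective.ne hmm
    simp only [hL, hY, Set.mem_ofPred_eq, hx, true_and, Fin.lt_def, Fin.le_def, Fin.ext_iff, Ne] at *
    omega
  · rw [Set.disjoint_left]
    intro x hx hx'
    have := ltF x hx'
    rw [mem'] at hx'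
    rcases hx.2 with h | ⟨h, h'⟩
    · exact hmm (x.injective (hx'.2.trans h.symm))
    · exact absurd (h'.trans this) (lt_irrefl _)
  · rw [Set.disjoint_left]
    intro x hx hx'
    rw [mem'] at hx'
    have := hx.2.1
    rw [hx'.2] at this
    exact lt_irrefl _ this
  · intro x
    simp [move, mul_assoc]
  · intro x
    have e1 : move x (m, m') m = x m' := by simp [move]
    have e2 : move x (m, m') m' = x m := by simp [move]
    rw [mem']
    simp only [hL, hY, Set.mem_ofPred_eq, ← fix, e1, e2]
    tauto
  · intro x hx
    rw [avoidMatrix, rectMatrix_move_eq hmm (empty x), avoidWeight, if_pos]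
    · intro k
      by_cases hk : k = m
      · rw [hk, dom_eq_ite, if_neg]
        rintro ⟨-, h⟩
        have h1 := hx.2.1
        have h2 := hx.2.2
        simp only [mem_arc, Fin.le_def, Fin.lt_def, Equiv.Perm.one_apply] at h h1 h2
        omega
      · exact domcol x k _ hk
    · rw [avoidWeight, if_neg]
      intro h
      have := h ⟨n - 1, by omega⟩
      rw [Equiv.Perm.one_apply, last x hx.2.2] at this
      exact one_ne_zero this
  · intro x hx y hy hne h
    obtain ⟨i, j, hij, he, rfl, h4⟩ := exists_rect_of_rectMatrix_ne_zero h
    exact tri x (Or.inl hx) i j hij he (fun k _ => avoidWeight_ne_zero_iff.mp h4 k) hy hne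
  · intro x hx
    have hlx := ltF x hx
    have hxm := ((mem' x).mp hx).2
    rw [hitMatrix, rectMatrix_move_eq hmm (empty x), hitWeight, if_pos]
    · refine ⟨dom_pos (left_mem_arc hmm) ?_, fun k hk => domcol x k _ hk⟩
      rw [Equiv.Perm.one_apply]
      rw [hxm] at hlx ⊢
      exact left_mem_arc hlx.ne
    · rw [hitWeight, if_neg]
      rintro ⟨-, h⟩
      have h5 := h ⟨n - 1, by omega⟩ (by rw [Ne, Fin.ext_iff]; simp; omega)
      rw [Equiv.Perm.one_apply, last x hlx] at h5
      exact one_ne_zero h5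
  · intro x hx y hy hne h
    obtain ⟨i, j, hij, he, rfl, -, h5⟩ := exists_rect_of_hitMatrix_ne_zero h
    exact tri x (Or.inr hx) i j hij he h5 hy hne

end Decomposition

open Matrix

theorem exists_ne_zero_of_mulVec {α : Type*} [Fintype α] {M : Matrix α α (ZMod 2)} {v : α → ZMod 2}
    {x : α} (h : (M *ᵥ v) x ≠ 0) : ∃ y, M x y ≠ 0 ∧ v y ≠ 0 := by
  obtain ⟨y, -, hy⟩ := Finset.exists_ne_zero_of_sum_ne_zero h
  exact ⟨y, left_ne_zero_of_mul hy, right_ne_zero_of_mul hy⟩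

theorem mulVec_mulVec_comm {α : Type*} [Fintype α] {A B : Matrix α α (ZMod 2)} (h : A * B = B * A)
    (v : α → ZMod 2) : B *ᵥ A *ᵥ v = A *ᵥ B *ᵥ v := by
  rw [mulVec_mulVec, mulVec_mulVec, h]

/-! ### Vanishing of cohomology in large Alexander gradings. -/

section Spanning

/-- Fixing one more diagonal point costs at most one hit operator, hence at most one unit of the
grading of `c`. In the end only the diagonal state is left, and it lies below the support of `c`. -/
theorem dotProduct_eq_zero_of_fixing (hn : 2 ≤ n) (G : GridDiagram n) (hO : G.O = 1) (k : ℕ)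
    (hk : k + 1 ≤ n) (c z : State n → ZMod 2) (hc : avoidMatrix 1 *ᵥ c = 0)
    (hA : ∀ x, c x ≠ 0 → G.alexander 1 + k < G.alexander x)
    (hz : ∀ x, z x ≠ 0 → x ∈ fixing (n - 1 - k)) (hzD : z ᵥ* avoidMatrix 1 = 0) :
    c ⬝ᵥ z = 0 := by
  induction k generalizing c z with
  | zero =>
    refine Finset.sum_eq_zero fun x _ => ?_
    by_contra h
    have h1 := hz x (right_ne_zero_of_mul h)
    have h2 := hA x (left_ne_zero_of_mul h)
    have hfix : ∀ j : Fin n, j.val + 1 < n → x j = j := fun j hj => h1 j (by omega)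
    have h3 : x = 1 := by
      ext j
      rw [Equiv.Perm.one_apply]
      by_cases hj : j.val + 1 < n
      · rw [hfix j hj]
      · have h4 : ¬ (x j).val + 1 < n := by
          intro h5
          have h6 := x.injective (hfix _ h5)
          rw [h6] at h5
          exact hj h5
        omega
    rw [h3] at h2
    simp at h2
  | succ k ih =>
    have hm : (⟨n - 1 - k, by omega⟩ : Fin n).val = (⟨n - 1 - (k + 1), by omega⟩ : Fin n).val + 1 := by
      simp only
      omega
    obtain ⟨u, w, f, rfl, hw, hwD, hf⟩ := exists_cycle_decomposition_fixing hn hm hz hzD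
    have hfD : f ᵥ* avoidMatrix 1 = 0 := by
      rw [add_vecMul, add_vecMul, vecMul_vecMul, avoidMatrix_mul_self hn, vecMul_zero,
        vecMul_vecMul, ← avoidMatrix_mul_hitMatrix hn, ← vecMul_vecMul, hwD, zero_vecMul, zero_add,
        zero_add] at hzD
      exact hzD
    rw [dotProduct_add, dotProduct_add]
    have e1 : c ⬝ᵥ (u ᵥ* avoidMatrix 1) = 0 := by
      rw [dotProduct_comm, ← dotProduct_mulVec, hc, dotProduct_zero]
    have e2 : c ⬝ᵥ f = 0 := by
      refine ih (by omega) c f hc (fun x hx => ?_) hf hfD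
      have := hA x hx
      push_cast at this
      linarith
    -- The hit operator moves across the pairing: its image of `c` is again a cocycle, with the
    -- grading bound lowered by one.
    have e3 : c ⬝ᵥ (w ᵥ* hitMatrix 1 ⟨n - 1 - (k + 1), by omega⟩) = 0 := by
      rw [dotProduct_comm, ← dotProduct_mulVec, dotProduct_comm]
      refine ih (by omega) _ w ?_ (fun x hx => ?_) hw hwD
      · rw [mulVec_mulVec, avoidMatrix_mul_hitMatrix hn, ← mulVec_mulVec, hc, mulVec_zero]
      · obtain ⟨y, h1, h2⟩ := exists_ne_zero_of_mulVec hx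
        rw [← hO] at h1
        have h3 := alexander_of_hitMatrix_ne_zero G h1
        have h4 := hA y h2
        push_cast at h4
        linarith
    rw [e1, e2, e3, add_zero, add_zero]

/-- Cocycles of sufficiently large Alexander grading are coboundaries. -/
theorem exists_mulVec_avoidMatrix_eq (hn : 2 ≤ n) (G : GridDiagram n) (hO : G.O = 1)
    {c : State n → ZMod 2} (hc : avoidMatrix 1 *ᵥ c = 0)
    (hA : ∀ x, c x ≠ 0 → G.alexander 1 + (n - 1) < G.alexander x) :
    ∃ b, avoidMatrix 1 *ᵥ b = c := by
  refine exists_mulVec_eq fun z hz => dotProduct_eq_zero_of_fixing hn G hO (n - 1) (by omega) c z hc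
    (fun x hx => ?_) (fun x _ j hj => by omega) hz
  rw [Nat.cast_sub (by omega), Nat.cast_one]
  exact hA x hx

end Spanning

/-! ### Nontriviality of the staircase. -/

section Clifford

variable [NeZero n] (s : Fin n)

/-- The image of the state `1` under successive compositions with rectangles through the squares
`(- m s, - m s + s)`. -/
noncomputable def staircase : ℕ → State n → ZMod 2
  | 0 => Pi.single 1 1
  | m + 1 => throughMatrix 1 (-((m + 1) • s), -((m + 1) • s) + s) *ᵥ staircase m

omit [NeZero n] in
theorem isShift_one : IsShift (1 : State n) := fun _ _ _ => Iff.rfl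

omit [NeZero n] in
theorem mulVec_single_eq_zero {M : Matrix (State n) (State n) (ZMod 2)} {S : State n}
    (h : ∀ x, M x S = 0) : M *ᵥ Pi.single S 1 = 0 := by
  funext x
  rw [mulVec_single_one, col_apply, h]
  rfl

theorem avoidMatrix_mulVec_staircase (hn : 2 ≤ n) (m : ℕ) :
    avoidMatrix 1 *ᵥ staircase s m = 0 := by
  induction m with
  | zero => exact mulVec_single_eq_zero isShift_one.avoidMatrix_self_right
  | succ m ih =>
    rw [staircase, ← mulVec_mulVec_comm (avoidMatrix_mul_throughMatrix hn _ _), ih, mulVec_zero]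

/-- The Clifford relation applied to a cocycle. The new square lies in the column of the O-marking
`-((m + 1) • s)` and in the row of the O-marking `-(m • s)`; hence the two coefficients. -/
theorem hitMatrix_mulVec_staircase_succ (hn : 2 ≤ n) (j : Fin n) (m : ℕ) :
    ∃ b, hitMatrix 1 j *ᵥ staircase s (m + 1) =
      ((if -((m + 1) • s) = j then 1 else 0) + (if -(m • s) = j then 1 else 0) : ZMod 2) •
        staircase s m + throughMatrix 1 (-((m + 1) • s), -((m + 1) • s) + s) *ᵥ
          hitMatrix 1 j *ᵥ staircase s m + avoidMatrix 1 *ᵥ b := by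
  have h := hitMatrix_mul_throughMatrix hn 1 j (-((m + 1) • s), -((m + 1) • s) + s)
  refine ⟨hitThroughMatrix 1 j (-((m + 1) • s), -((m + 1) • s) + s) *ᵥ staircase s m, ?_⟩
  have h2 := congrArg (fun M => M *ᵥ staircase s m) h
  have e : -((m + 1) • s) + s = -(m • s) := by
    rw [succ_nsmul]; abel
  simp only [add_mulVec, smul_mulVec, one_mulVec, ← mulVec_mulVec,
    avoidMatrix_mulVec_staircase s hn m, mulVec_zero, add_zero, Equiv.Perm.one_apply] at h2
  rw [e] at h2 ⊢
  rw [staircase, e]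
  set a := hitMatrix 1 j *ᵥ throughMatrix 1 (-((m + 1) • s), -(m • s)) *ᵥ staircase s m
  set b := throughMatrix 1 (-((m + 1) • s), -(m • s)) *ᵥ hitMatrix 1 j *ᵥ staircase s m
  rw [add_right_comm]
  exact (by rw [add_assoc, add_eq_self_of_two, add_zero] : a = a + b + b).trans
    (congrArg (· + b) h2)

variable {s} (hs : ∀ k : ℕ, 0 < k → k < n → k • s ≠ 0)

include hs

theorem nsmul_ne {k l : ℕ} (hkl : k < l) (hl : l < n) : -(k • s) ≠ -(l • s) := by
  intro h
  apply hs (l - k) (by omega) (by omega)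
  rw [sub_nsmul _ hkl.le, neg_inj.mp h]
  abel

/-- The first `l` steps of the walk do not meet the marking `-(m • s)`, so its hit operator passes
through them, up to coboundaries, to the diagonal state, which it kills. -/
theorem exists_hitMatrix_mulVec_staircase (hn : 2 ≤ n) {l m : ℕ} (hlm : l < m) (hm : m < n) :
    ∃ b, hitMatrix 1 (-(m • s)) *ᵥ staircase s l = avoidMatrix 1 *ᵥ b := by
  induction l with
  | zero =>
    exact ⟨0, by rw [mulVec_zero]; exact mulVec_single_eq_zero (isShift_one.hitMatrix_self_right _)⟩
  | succ l ih =>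
    obtain ⟨b, hb⟩ := ih (by omega)
    obtain ⟨b', hb'⟩ := hitMatrix_mulVec_staircase_succ s hn (-(m • s)) l
    rw [if_neg (nsmul_ne hs hlm hm), if_neg (nsmul_ne hs (by omega) hm), add_zero, zero_smul,
      zero_add, hb, mulVec_mulVec_comm (avoidMatrix_mul_throughMatrix hn _ _), ← mulVec_add] at hb'
    exact ⟨_, hb'⟩

/-- The hit operator of the newest marking undoes the last step modulo coboundaries. This descends
to the diagonal state, which is no coboundary since no O-free rectangle starts there. -/
theorem avoidMatrix_mulVec_ne_staircase (hn : 2 ≤ n) {m : ℕ} (hm : m < n) (b : State n → ZMod 2) :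
    avoidMatrix 1 *ᵥ b ≠ staircase s m := by
  induction m generalizing b with
  | zero =>
    intro h
    have := congrFun h 1
    rw [staircase, Pi.single_eq_same] at this
    obtain ⟨y, hy, -⟩ := exists_ne_zero_of_mulVec (this.trans_ne one_ne_zero)
    exact hy (avoidMatrix_self_left 1 y)
  | succ m ih =>
    intro h
    obtain ⟨b', hb'⟩ := exists_hitMatrix_mulVec_staircase hs hn (Nat.lt_succ_self m) hm
    obtain ⟨b'', hb''⟩ := hitMatrix_mulVec_staircase_succ s hn (-((m + 1) • s)) m
    rw [if_pos rfl, if_neg (nsmul_ne hs (Nat.lt_succ_self m) hm), add_zero, one_smul, hb', ← h,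
      mulVec_mulVec_comm (avoidMatrix_mul_hitMatrix hn _ _),
      mulVec_mulVec_comm (avoidMatrix_mul_throughMatrix hn _ _), add_assoc, ← mulVec_add] at hb''
    refine ih (by omega) (hitMatrix 1 (-((m + 1) • s)) *ᵥ b +
      (throughMatrix 1 (-((m + 1) • s), -((m + 1) • s) + s) *ᵥ b' + b'')) ?_
    rw [mulVec_add, hb'', add_assoc, add_eq_self_of_two, add_zero]

end Clifford

/-! ### Gradings of the staircase and its X-counterpart. -/

section Support

variable [NeZero n] {G : GridDiagram n} (hO : G.O = 1) {s : Fin n} (hX : ∀ i, G.X i = i + s)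

include hO hX

theorem alexander_of_staircase_ne_zero {m : ℕ} {x : State n} (h : staircase s m x ≠ 0) :
    G.alexander 1 + m ≤ G.alexander x := by
  induction m generalizing x with
  | zero =>
    rw [staircase, Pi.single_apply] at h
    split_ifs at h with h1
    · rw [h1]; simp
    · exact absurd rfl h
  | succ m ih =>
    obtain ⟨y, h1, h2⟩ := exists_ne_zero_of_mulVec h
    rw [← hX, ← hO] at h1
    have h3 := alexander_of_throughMatrix_ne_zero G h1
    have h4 := ih h2
    push_cast
    linarith

-- Used for Maslov homogeneity: every step uses rectangles avoiding the diagonal, whose reflection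
-- carries the X-markings of `-G`.
omit hO hX in
theorem maslovOf_of_staircase_ne_zero {m : ℕ} {x : State n} (h : staircase s m x ≠ 0) :
    maslovOf (Fin.revPerm * 1) (reflect x) = maslovOf (Fin.revPerm * 1) (reflect (1 : State n)) - m := by
  induction m generalizing x with
  | zero =>
    rw [staircase, Pi.single_apply] at h
    split_ifs at h with h1
    · rw [h1]; simp
    · exact absurd rfl h
  | succ m ih =>
    obtain ⟨y, h1, h2⟩ := exists_ne_zero_of_mulVec h
    have h3 := maslovOf_reflect_of_throughMatrix_ne_zero h1
    have h4 := ih h2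
    push_cast
    linarith

/-- The analogue of `staircase` for rectangles with exactly one X-marking and arbitrary
O-markings. -/
noncomputable def hitStaircase (G : GridDiagram n) (s : Fin n) : ℕ → State n → ZMod 2
  | 0 => Pi.single 1 1
  | m + 1 => hitMatrix G.X (-((m + 1) • s)) *ᵥ hitStaircase G s m

omit hO hX in
omit [NeZero n] in
theorem alexander_of_hitMatrix_X_ne_zero {i : Fin n} {x y : State n}
    (h : hitMatrix G.X i x y ≠ 0) : G.alexander x ≤ G.alexander y + 1 := by
  obtain ⟨a, b, h1, h2, rfl, h4, h5⟩ := exists_rect_of_hitMatrix_ne_zero h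
  have h6 := alexander_sub_of_isEmptyRect G h1 h2
  have h7 : (0 : ℚ) ≤ ∑ k, (dom x (a, b) (k, G.O k) : ℚ) :=
    Finset.sum_nonneg fun k _ => Nat.cast_nonneg _
  rw [Fintype.sum_eq_single (f := fun k => (dom x (a, b) (k, G.X k) : ℚ)) i
    (fun k hk => by simp [h5 k hk]), h4] at h6
  push_cast at h6
  linarith

omit hO hX in
theorem alexander_of_hitStaircase_ne_zero {m : ℕ} {x : State n} (h : hitStaircase G s m x ≠ 0) :
    G.alexander x ≤ G.alexander 1 + m := by
  induction m generalizing x with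
  | zero =>
    rw [hitStaircase, Pi.single_apply] at h
    split_ifs at h with h1
    · rw [h1]; simp
    · exact absurd rfl h
  | succ m ih =>
    obtain ⟨y, h1, h2⟩ := exists_ne_zero_of_mulVec h
    have h3 := alexander_of_hitMatrix_X_ne_zero h1
    have h4 := ih h2
    push_cast
    linarith

-- When the grading drops by one there is one more X than O. Then containing the X in column `i` and
-- no O is the same as having this X as the only one.
omit hO hX in
omit [NeZero n] in
theorem throughMatrix_eq_hitMatrix {i : Fin n} {x y : State n}
    (h : G.alexander x = G.alexander y + 1) :
    throughMatrix G.O (i, G.X i) x y = hitMatrix G.X i x y := by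
  classical
  rw [throughMatrix, hitMatrix, rectMatrix, rectMatrix]
  refine Finset.sum_congr rfl fun r hr => ?_
  rw [Finset.mem_filter] at hr
  simp only [rect, Finset.mem_filter, Finset.mem_univ, true_and] at hr
  obtain ⟨⟨h1, rfl⟩, h2⟩ := hr
  have h3 := alexander_sub_of_isEmptyRect G h1 h2
  have h4 : (∑ k, dom x r (k, G.X k) : ℕ) = 1 + ∑ k, dom x r (k, G.O k) := by
    have : ((∑ k, dom x r (k, G.X k) : ℕ) : ℚ) = ((1 + ∑ k, dom x r (k, G.O k) : ℕ) : ℚ) := by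
      push_cast
      simp only [move] at h3
      linarith
    exact_mod_cast this
  have h5 : dom x r (i, G.X i) ≤ 1 := by
    rw [dom_eq_ite]
    split_ifs <;> simp
  have h6 := Finset.add_sum_erase Finset.univ (fun k => dom x r (k, G.X k)) (Finset.mem_univ i)
  have hOz : (∀ k, dom x r (k, G.O k) = 0) ↔ ∑ k, dom x r (k, G.O k) = 0 := by
    simp [Finset.sum_eq_zero_iff]
  have hXz : (∀ k, k ≠ i → dom x r (k, G.X k) = 0) ↔
      ∑ k ∈ Finset.univ.erase i, dom x r (k, G.X k) = 0 := by
    simp [Finset.sum_eq_zero_iff]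
  rw [avoidWeight, hitWeight]
  simp only [hOz, hXz]
  interval_cases hd : dom x r (i, G.X i)
  · simp
  · simp only [Nat.cast_one, mul_one, true_and]
    refine if_congr ?_ rfl rfl
    omega

/-- One chain is supported at or above this grading and the other at or below it, so only steps
between the extremal gradings matter, where the two operators agree. -/
theorem staircase_eq_hitStaircase {m : ℕ} {x : State n} (h : G.alexander x = G.alexander 1 + m) :
    staircase s m x = hitStaircase G s m x := by
  induction m generalizing x with
  | zero => rfl
  | succ m ih =>
    rw [staircase, hitStaircase, mulVec, mulVec, dotProduct, dotProduct]
    refine Finset.sum_congr rfl fun y _ => ?_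
    rw [← hX, ← hO]
    push_cast at h
    rcases lt_trichotomy (G.alexander y) (G.alexander 1 + m) with hy | hy | hy
    · have e1 : staircase s m y = 0 := by
        by_contra h1
        exact absurd (alexander_of_staircase_ne_zero hO hX h1) (not_le.mpr hy)
      have e2 : hitMatrix G.X (-((m + 1) • s)) x y = 0 := by
        by_contra h1
        have := alexander_of_hitMatrix_X_ne_zero h1
        linarith
      rw [e1, e2, mul_zero, zero_mul]
    · rw [ih hy, throughMatrix_eq_hitMatrix]
      linarith
    · have e1 : hitStaircase G s m y = 0 := by
        by_contra h1
        exact absurd (alexander_of_hitStaircase_ne_zero h1) (not_le.mpr hy)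
      have e2 : throughMatrix G.O (-((m + 1) • s), G.X (-((m + 1) • s))) x y = 0 := by
        by_contra h1
        have := alexander_of_throughMatrix_ne_zero G h1
        linarith
      rw [e1, e2, mul_zero, zero_mul]

omit hO hX in
theorem exists_mulVec_eq_hitStaircase (hn : 2 ≤ n) {w : State n → ZMod 2}
    (hw : avoidMatrix G.X *ᵥ w = Pi.single 1 1) (m : ℕ) :
    ∃ b, avoidMatrix G.X *ᵥ b = hitStaircase G s m := by
  induction m with
  | zero => exact ⟨w, hw⟩
  | succ m ih =>
    obtain ⟨b, hb⟩ := ih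
    refine ⟨hitMatrix G.X (-((m + 1) • s)) *ᵥ b, ?_⟩
    rw [mulVec_mulVec, avoidMatrix_mul_hitMatrix hn, ← mulVec_mulVec, hb, hitStaircase]

end Support

open Matrix

/-! ### Nontorsion cycles at U = 1. -/

section Cycle

variable {G : GridDiagram n} {a : ℚ}

theorem exists_nat_of_le {x y : State n} {k : ℕ} (ha : a = G.alexander y + k)
    (h : a ≤ G.alexander x) : ∃ m : ℕ, G.alexander x - a = m := by
  obtain ⟨m, hm⟩ := exists_int_alexander_sub G x y
  have h1 : (0 : ℚ) ≤ ((m - k : ℤ) : ℚ) := by push_cast; linarith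
  obtain ⟨l, hl⟩ := Int.eq_ofNat_of_zero_le (Int.cast_nonneg_iff.mp h1)
  refine ⟨l, ?_⟩
  have h2 : ((m - k : ℤ) : ℚ) = ((l : ℤ) : ℚ) := by rw [hl]
  push_cast at h2
  linarith

theorem AlexanderHomogeneous.le_alexander {c : Chain n} (h : G.AlexanderHomogeneous a c)
    {x : State n} (hx : specialize c x ≠ 0) : a ≤ G.alexander x := by
  obtain ⟨m, hm⟩ := h.exists_nat (x := x) fun h0 => hx (by simp [specialize, h0])
  have : (0 : ℚ) ≤ m := Nat.cast_nonneg _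
  linarith

theorem AlexanderHomogeneous.boundary_eq_zero_iff {c : Chain n} (h : G.AlexanderHomogeneous a c) :
    G.boundary c = 0 ↔ specialize c ᵥ* avoidMatrix G.X = 0 := by
  constructor
  · intro h0
    rw [← specialize_boundary, h0]
    funext x
    simp [specialize]
  · intro h0
    rw [← h.homogenize_specialize, boundary_homogenize, h0]
    · funext x
      simp [homogenize]
    · exact fun x hx => h.exists_nat fun h0 => hx (by simp [specialize, h0])

theorem AlexanderHomogeneous.boundary_eq_zero (hn : 2 ≤ n) {c : Chain n}
    (h : G.AlexanderHomogeneous a c) (hc : G.IsUPowerBoundary c) : G.boundary c = 0 := by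
  rw [h.boundary_eq_zero_iff]
  obtain ⟨u, hu⟩ := (isUPowerBoundary_iff h).mp hc
  rw [← hu, vecMul_vecMul, avoidMatrix_mul_self hn, vecMul_zero]

theorem IsNontorsionCycle.vecMul_ne {c : Chain n} (h : G.IsNontorsionCycle a c)
    (u : State n → ZMod 2) : u ᵥ* avoidMatrix G.X ≠ specialize c :=
  fun hu => h.2.2.2 ((isUPowerBoundary_iff h.2.1).mpr ⟨u, hu⟩)

theorem IsNontorsionCycle.exists_specialize_ne_zero {c : Chain n} (h : G.IsNontorsionCycle a c) :
    ∃ x, specialize c x ≠ 0 := by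
  by_contra h0
  push Not at h0
  refine h.vecMul_ne 0 ?_
  rw [zero_vecMul]
  funext x
  rw [h0]
  rfl

theorem isNontorsionCycle_homogenize {z : State n → ZMod 2} {μ : ℚ}
    (hA : ∀ x, z x ≠ 0 → ∃ m : ℕ, G.alexander x - a = m)
    (hM : ∀ x, z x ≠ 0 → maslovOf G.X x = μ) (hz : z ᵥ* avoidMatrix G.X = 0)
    (hne : ∀ u, u ᵥ* avoidMatrix G.X ≠ z) : G.IsNontorsionCycle a (homogenize G a z) := by
  have h := alexanderHomogeneous_homogenize hA
  -- By the definition of A, the Maslov grading is 2A plus the Maslov function of 𝕏 plus n - 1, and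
  -- the exponent of U is A - a.
  refine ⟨?_, h, ⟨2 * a + μ + (n - 1), ?_⟩, ?_⟩
  · rw [h.boundary_eq_zero_iff, specialize_homogenize, hz]
  · intro x k hk
    have h1 := h x k hk
    have h2 : z x ≠ 0 := by
      intro h0
      simp [homogenize, h0] at hk
    rw [maslov, ← hM x h2, ← h1, alexander]
    ring
  · rw [isUPowerBoundary_iff h, specialize_homogenize]
    rintro ⟨u, hu⟩
    exact hne u hu

theorem vecMul_avoidMatrix_reflect_eq_iff (S : State n) (u v : State n → ZMod 2) :
    u ᵥ* avoidMatrix (Fin.revPerm * S) = (fun x => v (reflect x)) ↔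
      avoidMatrix S *ᵥ (fun x => u (reflect x)) = v := by
  constructor
  · intro h
    funext x
    rw [← vecMul_avoidMatrix_reflect, h]
    simp only [reflect_reflect]
  · intro h
    funext x
    rw [← h, ← vecMul_avoidMatrix_reflect, reflect_reflect]

theorem single_reflect (x : State n) :
    (Pi.single (reflect x) 1 : State n → ZMod 2) =
      fun y => (Pi.single x 1 : State n → ZMod 2) (reflect y) := by
  funext y
  rw [Pi.single_apply, Pi.single_apply]
  refine if_congr ⟨?_, ?_⟩ rfl rfl
  · rintro rfl; rw [reflect_reflect]
  · rintro h; rw [← h, reflect_reflect]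

end Cycle

/-! ### Diagrams with a single state of largest grading. -/

section TopState

variable {G : GridDiagram n} {x₀ : State n}

theorem eq_single_of_ne_zero {z : State n → ZMod 2} {x₀ : State n}
    (h : ∀ x, z x ≠ 0 → x = x₀) (hz : ∃ x, z x ≠ 0) : z = Pi.single x₀ 1 := by
  obtain ⟨x, hx⟩ := hz
  have := h x hx
  subst this
  have key : ∀ t : ZMod 2, t ≠ 0 → t = 1 := by decide
  funext y
  rw [Pi.single_apply]
  split_ifs with hy
  · rw [hy, key _ hx]
  · by_contra h'
    exact hy (h y h')

theorem coeff_homogenize_single (G : GridDiagram n) (x y : State n) :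
    (homogenize G (G.alexander x) (Pi.single x 1) y).coeff 0 =
      (Pi.single x 1 : State n → ZMod 2) y := by
  rw [homogenize, Pi.single_apply]
  split_ifs with h
  · simp [h]
  · simp

variable (hmax : ∀ x, G.alexander x₀ ≤ G.alexander x → x = x₀)
  (hcyc : Pi.single x₀ 1 ᵥ* avoidMatrix G.X = 0)
  (hne : ∀ u, u ᵥ* avoidMatrix G.X ≠ Pi.single x₀ 1)

include hmax

theorem AlexanderHomogeneous.specialize_eq_single {c : Chain n}
    (h : G.AlexanderHomogeneous (G.alexander x₀) c) (hc : ∃ x, specialize c x ≠ 0) :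
    specialize c = Pi.single x₀ 1 :=
  eq_single_of_ne_zero (fun x hx => hmax x (h.le_alexander hx)) hc

include hcyc hne

theorem isTauCycle_of_top :
    G.IsTauCycle (G.alexander x₀) (homogenize G (G.alexander x₀) (Pi.single x₀ 1)) := by
  have hx : ∀ x, (Pi.single x₀ 1 : State n → ZMod 2) x ≠ 0 → x = x₀ := by
    intro x hx
    by_contra h
    exact hx (Pi.single_eq_of_ne h 1)
  refine ⟨isNontorsionCycle_homogenize (μ := maslovOf G.X x₀) ?_ ?_ hcyc hne, ?_⟩
  · intro x h
    exact ⟨0, by rw [hx x h]; simp⟩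
  · intro x h
    rw [hx x h]
  · intro b d hd
    obtain ⟨x, h⟩ := hd.exists_specialize_ne_zero
    have h1 := hd.2.1.le_alexander h
    by_contra h2
    have h3 := hmax x ((not_le.mp h2).le.trans h1)
    rw [h3] at h1
    exact h2 h1

theorem IsTauCycle.eq_of_top {a : ℚ} {c : Chain n} (h : G.IsTauCycle a c) :
    a = G.alexander x₀ ∧ c = homogenize G (G.alexander x₀) (Pi.single x₀ 1) := by
  have h0 := isTauCycle_of_top hmax hcyc hne
  have ha : a = G.alexander x₀ := le_antisymm (h0.2 _ _ h.1) (h.2 _ _ h0.1)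
  subst ha
  refine ⟨rfl, ?_⟩
  rw [← h.1.2.1.specialize_eq_single hmax h.1.exists_specialize_ne_zero,
    h.1.2.1.homogenize_specialize]

theorem isTransport_top : G.IsTransport
    (homogenize G.neg (G.alexander x₀) (Pi.single (reflect x₀) 1)) := by
  refine ⟨G.alexander x₀, ⟨_, isTauCycle_of_top hmax hcyc hne⟩,
    alexanderHomogeneous_homogenize fun x hx => ⟨0, ?_⟩, ?_⟩
  · have : x = reflect x₀ := by
      by_contra h
      exact hx (Pi.single_eq_of_ne h 1)
    rw [this, alexander_neg_reflect]
    simp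
  · intro c hc
    obtain ⟨-, rfl⟩ := hc.eq_of_top hmax hcyc hne
    rw [pairing, Fintype.sum_eq_single x₀]
    · rw [← alexander_neg_reflect, coeff_homogenize_single, alexander_neg_reflect,
        coeff_homogenize_single, Pi.single_eq_same, Pi.single_eq_same, one_mul]
    · intro x hx
      rw [coeff_homogenize_single, Pi.single_eq_of_ne hx, zero_mul]

/-- The grading leaves room for the reflected top state only, and the chain is nonzero because it
pairs to 1. -/
theorem IsTransport.eq_of_top {d : Chain n} (h : G.IsTransport d) :
    G.neg.AlexanderHomogeneous (G.alexander x₀) d ∧ specialize d = Pi.single (reflect x₀) 1 := by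
  obtain ⟨a, ⟨c, hc⟩, hd, hp⟩ := h
  obtain ⟨rfl, rfl⟩ := hc.eq_of_top hmax hcyc hne
  refine ⟨hd, ?_⟩
  have h1 : ∀ x, G.neg.alexander (reflect x₀) ≤ G.neg.alexander x → x = reflect x₀ := by
    intro x hx
    rw [← reflect_reflect x, alexander_neg_reflect, alexander_neg_reflect] at hx
    rw [← hmax _ hx, reflect_reflect]
  rw [← alexander_neg_reflect] at hd
  refine hd.specialize_eq_single h1 ?_
  by_contra h0
  push Not at h0
  have hd0 : d = 0 := by
    rw [← hd.homogenize_specialize]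
    funext x
    rw [homogenize, h0]
    simp
  have := hp _ hc
  rw [hd0] at this
  simp [pairing] at this

theorem tauInIm_iff_of_top :
    G.TauInIm ↔ ∃ u, avoidMatrix G.O *ᵥ u = Pi.single x₀ 1 := by
  have key : (∃ u, u ᵥ* avoidMatrix G.neg.X = Pi.single (reflect x₀) 1) ↔
      ∃ u, avoidMatrix G.O *ᵥ u = Pi.single x₀ 1 := by
    rw [single_reflect]
    constructor
    · rintro ⟨u, hu⟩
      exact ⟨_, (vecMul_avoidMatrix_reflect_eq_iff _ _ _).mp hu⟩
    · rintro ⟨u, hu⟩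
      refine ⟨fun x => u (reflect x), (vecMul_avoidMatrix_reflect_eq_iff _ _ _).mpr ?_⟩
      simpa only [reflect_reflect] using hu
  rw [← key]
  constructor
  · rintro ⟨d, hd, hb⟩
    obtain ⟨h1, h2⟩ := hd.eq_of_top hmax hcyc hne
    rw [isUPowerBoundary_iff h1, h2] at hb
    exact hb
  · intro h
    have h0 := isTransport_top hmax hcyc hne
    refine ⟨_, h0, ?_⟩
    rw [isUPowerBoundary_iff (h0.eq_of_top hmax hcyc hne).1, specialize_homogenize]
    exact h

theorem tauInKer_of_top (h : avoidMatrix G.O *ᵥ Pi.single x₀ 1 = 0) : G.TauInKer := by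
  have h0 := isTransport_top hmax hcyc hne
  refine ⟨_, h0, ?_⟩
  rw [(h0.eq_of_top hmax hcyc hne).1.boundary_eq_zero_iff, specialize_homogenize, single_reflect]
  refine (vecMul_avoidMatrix_reflect_eq_iff G.O _ 0).mpr ?_
  simpa only [reflect_reflect] using h

end TopState

open Matrix

/-! ### Diagrams whose markings are two parallel lines. -/

section Shift

variable [NeZero n]

theorem shift_zero : shift (0 : Fin n) = 1 := by
  ext k
  simp [shift_apply]

omit [NeZero n] in
theorem finRotate_pow_apply (k : ℕ) (i : Fin n) : ((finRotate n ^ k) i).val = (i.val + k) % n := by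
  induction k with
  | zero => simp [Nat.mod_eq_of_lt i.isLt]
  | succ k ih =>
    rw [pow_succ', Equiv.Perm.mul_apply, finRotate_apply, Fin.val_add, ih, Fin.val_one']
    simp [← add_assoc]

theorem val_nsmul (k : ℕ) (s : Fin n) : (k • s).val = (k * s.val) % n := by
  induction k with
  | zero => simp
  | succ k ih =>
    rw [succ_nsmul, Fin.val_add, ih, Nat.mod_add_mod, Nat.succ_mul]

theorem nsmul_ne_zero_of_coprime {s : Fin n} (h : n.Coprime s.val) (k : ℕ) (hk : 0 < k)
    (hkn : k < n) : k • s ≠ 0 := by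
  intro h0
  have h1 := congrArg Fin.val h0
  rw [val_nsmul] at h1
  have h2 : n ∣ k * s.val := Nat.dvd_of_mod_eq_zero h1
  exact absurd (Nat.le_of_dvd hk (h.dvd_of_dvd_mul_right h2)) (by omega)

end Shift

section ShiftDiagram

variable [NeZero n] {G : GridDiagram n} {s : Fin n} (hO : G.O = 1) (hX : G.X = shift s)
  (hn : 2 ≤ n) (hs : ∀ k : ℕ, 0 < k → k < n → k • s ≠ 0)

omit [NeZero n] in
theorem single_X_vecMul (G : GridDiagram n) : Pi.single G.X 1 ᵥ* avoidMatrix G.X = 0 := by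
  funext y
  rw [single_one_vecMul]
  exact avoidMatrix_self_left G.X y

include hX

theorem vecMul_ne_single_X (u : State n → ZMod 2) : u ᵥ* avoidMatrix G.X ≠ Pi.single G.X 1 := by
  intro h
  have h1 := congrFun h G.X
  rw [Pi.single_eq_same] at h1
  obtain ⟨y, -, hy⟩ := Finset.exists_ne_zero_of_sum_ne_zero (h1.trans_ne one_ne_zero)
  rw [hX] at hy
  exact right_ne_zero_of_mul hy ((isShift_shift s).avoidMatrix_self_right y)

include hO hn hs

theorem isTauCycle_neg : G.neg.IsTauCycle (G.alexander 1 + (n - 1))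
    (homogenize G.neg (G.alexander 1 + (n - 1)) fun x => staircase s (n - 1) (reflect x)) := by
  have hXi : ∀ i, G.X i = i + s := fun i => by rw [hX]; rfl
  have hc : ((n - 1 : ℕ) : ℚ) = (n : ℚ) - 1 := by
    rw [Nat.cast_sub (by omega), Nat.cast_one]
  have hA : ∀ x, G.neg.alexander x = G.alexander (reflect x) := fun x => by
    rw [← alexander_neg_reflect G (reflect x), reflect_reflect]
  refine ⟨isNontorsionCycle_homogenize
    (μ := maslovOf (Fin.revPerm * 1) (reflect (1 : State n)) - (n - 1 : ℕ)) ?_ ?_ ?_ ?_, ?_⟩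
  · intro x hx
    refine exists_nat_of_le (G := G.neg) (y := reflect 1) (k := n - 1) ?_ ?_
    · rw [alexander_neg_reflect, hc]
    · have := alexander_of_staircase_ne_zero hO hXi hx
      rw [hc] at this
      rw [hA]
      exact this
  · intro x hx
    have := maslovOf_of_staircase_ne_zero hx
    rw [reflect_reflect] at this
    simp only [neg, hO]
    exact this
  · refine (vecMul_avoidMatrix_reflect_eq_iff G.O _ 0).mpr ?_
    simp only [reflect_reflect, hO]
    exact avoidMatrix_mulVec_staircase s hn _
  · intro u hu
    have h1 := (vecMul_avoidMatrix_reflect_eq_iff G.O _ _).mp hu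
    rw [hO] at h1
    exact avoidMatrix_mulVec_ne_staircase hs hn (by omega) _ h1
  · intro b d hd
    -- At U = 1, a class of larger grading would reflect to a cocycle above A(1) + n - 1, hence to a
    -- coboundary.
    by_contra hb
    have h1 := (hd.2.1.boundary_eq_zero_iff).mp hd.1
    have h2 : specialize d = fun x => specialize d (reflect (reflect x)) := by
      simp only [reflect_reflect]
    have h3 := (vecMul_avoidMatrix_reflect_eq_iff G.O _ 0).mp h1
    rw [hO] at h3
    obtain ⟨w, hw⟩ := exists_mulVec_avoidMatrix_eq hn G hO h3 fun x hx => by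
      have := hd.2.1.le_alexander hx
      rw [alexander_neg_reflect] at this
      linarith
    refine hd.vecMul_ne (fun x => w (reflect x)) ?_
    rw [h2]
    refine (vecMul_avoidMatrix_reflect_eq_iff G.O _ (fun x => specialize d (reflect x))).mpr ?_
    simp only [reflect_reflect, hO]
    exact hw

/-- The pairing modulo U sees only the grading A(1) + n - 1, where the staircase equals
`hitStaircase`. The latter is a coboundary for `avoidMatrix G.X`, so it is orthogonal to every cycle
of `G`. -/
theorem not_tauInKer_neg {w : State n → ZMod 2} (hw : avoidMatrix G.X *ᵥ w = Pi.single 1 1) :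
    ¬ G.neg.TauInKer := by
  have hXi : ∀ i, G.X i = i + s := fun i => by rw [hX]; rfl
  have hc : ((n - 1 : ℕ) : ℚ) = (n : ℚ) - 1 := by
    rw [Nat.cast_sub (by omega), Nat.cast_one]
  have h0 := isTauCycle_neg hO hX hn hs
  rintro ⟨d, ⟨a, ⟨c, hca⟩, hd, hp⟩, hb⟩
  have ha : a = G.alexander 1 + (n - 1) := le_antisymm (h0.2 _ _ hca.1) (hca.2 _ _ h0.1)
  subst ha
  rw [neg_neg] at hd hb
  obtain ⟨b, hb'⟩ := exists_mulVec_eq_hitStaircase (s := s) hn hw (n - 1)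
  have h1 := hp _ h0
  have h2 : specialize d ⬝ᵥ hitStaircase G s (n - 1) = 0 := by
    rw [← hb', dotProduct_mulVec, (hd.boundary_eq_zero_iff).mp hb, zero_dotProduct]
  refine zero_ne_one (h2.symm.trans (Eq.trans ?_ h1))
  rw [pairing, ← sum_reflect, dotProduct]
  refine Finset.sum_congr rfl fun x _ => ?_
  simp only [homogenize, reflect_reflect, alexander_neg_reflect]
  by_cases hx : G.alexander x = G.alexander 1 + (n - 1)
  · have e1 : staircase s (n - 1) x = hitStaircase G s (n - 1) x :=
      staircase_eq_hitStaircase hO hXi (by rw [hc]; exact hx)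
    have e2 : specialize d x = (d x).coeff 0 := by
      have := hd.coeff_eq (x := x) (m := 0) (by rw [hx]; simp)
      rw [specialize, this]
      simp
    rw [e1, e2, hx, sub_self, Nat.floor_zero, pow_zero, mul_one, Polynomial.coeff_C_zero, mul_comm]
  · have e1 : (d x).coeff 0 = 0 := by
      by_contra h
      apply hx
      have := hd x 0 h
      simpa using this
    rw [e1, mul_zero]
    by_contra h
    have h3 := hd.le_alexander (left_ne_zero_of_mul h)
    have h4 := alexander_of_hitStaircase_ne_zero (right_ne_zero_of_mul h)
    rw [hc] at h4
    exact hx (le_antisymm h4 h3)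

variable (hmax : ∀ x, G.alexander G.X ≤ G.alexander x → x = G.X)
  (h1 : G.alexander G.X = G.alexander 1 + (n - 1))

include hmax h1

/-- The gradings leave only the top state, and the staircase is nonzero because it is no coboundary.
-/
theorem staircase_eq_single : staircase s (n - 1) = Pi.single G.X 1 := by
  have hXi : ∀ i, G.X i = i + s := fun i => by rw [hX]; rfl
  refine eq_single_of_ne_zero (fun x hx => hmax x ?_) ?_
  · have := alexander_of_staircase_ne_zero hO hXi hx
    rw [Nat.cast_sub (by omega), Nat.cast_one] at this
    rw [h1]
    exact this
  · by_contra h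
    push Not at h
    refine avoidMatrix_mulVec_ne_staircase hs hn (m := n - 1) (by omega) 0 ?_
    rw [mulVec_zero]
    exact (funext h).symm

theorem epsilon_eq_zero : G.epsilon = 0 := by
  have hst := staircase_eq_single hO hX hn hs hmax h1
  have h2 := single_X_vecMul G
  have h3 := vecMul_ne_single_X hX
  rw [epsilon, if_neg, if_pos]
  · refine tauInKer_of_top hmax h2 h3 ?_
    rw [hO, ← hst]
    exact avoidMatrix_mulVec_staircase s hn _
  · rw [tauInIm_iff_of_top hmax h2 h3, hO, ← hst]
    rintro ⟨u, hu⟩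
    exact avoidMatrix_mulVec_ne_staircase hs hn (by omega) u hu

theorem epsilon_neg_eq_zero : G.neg.epsilon = 0 := by
  have hst := staircase_eq_single hO hX hn hs hmax h1
  have h4 : ∀ x, G.neg.alexander (reflect G.X) ≤ G.neg.alexander x → x = reflect G.X := by
    intro x hx
    rw [← reflect_reflect x, alexander_neg_reflect, alexander_neg_reflect] at hx
    rw [← hmax _ hx, reflect_reflect]
  have h2 : Pi.single (reflect G.X) 1 ᵥ* avoidMatrix G.neg.X = 0 := by
    rw [single_reflect]
    refine (vecMul_avoidMatrix_reflect_eq_iff G.O _ 0).mpr ?_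
    simp only [reflect_reflect]
    rw [hO, ← hst]
    exact avoidMatrix_mulVec_staircase s hn _
  have h3 : ∀ u, u ᵥ* avoidMatrix G.neg.X ≠ Pi.single (reflect G.X) 1 := by
    intro u hu
    rw [single_reflect] at hu
    have h5 := (vecMul_avoidMatrix_reflect_eq_iff G.O _ _).mp hu
    rw [hO, ← hst] at h5
    exact avoidMatrix_mulVec_ne_staircase hs hn (by omega) _ h5
  rw [epsilon, if_neg, if_pos]
  · refine tauInKer_of_top h4 h2 h3 ?_
    refine mulVec_single_eq_zero fun x => ?_
    rw [← reflect_reflect x]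
    exact (avoidMatrix_reflect _ _ _).trans (avoidMatrix_self_left _ _)
  · rw [tauInIm_iff_of_top h4 h2 h3]
    rintro ⟨u, hu⟩
    have h5 := congrFun hu (reflect G.X)
    rw [Pi.single_eq_same] at h5
    obtain ⟨y, hy, -⟩ := exists_ne_zero_of_mulVec (h5.trans_ne one_ne_zero)
    rw [← reflect_reflect y] at hy
    apply hy
    refine (avoidMatrix_reflect _ _ _).trans ?_
    rw [hX]
    exact (isShift_shift s).avoidMatrix_self_right _

end ShiftDiagram

/-! ### The torus knot diagrams. -/

section Torus

variable {p q : ℕ} (hp : 0 < p) (hq : 0 < q)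

theorem tauInIm_imp_tauInKer (hn : 2 ≤ n) {G : GridDiagram n} (h : G.TauInIm) : G.TauInKer := by
  obtain ⟨d, hd, hb⟩ := h
  have hd' := hd
  obtain ⟨a, -, ha, -⟩ := hd'
  exact ⟨d, hd, ha.boundary_eq_zero hn hb⟩

theorem torus_X_apply (k : Fin (p + q)) : ((torus p q hp hq).X k).val = (k.val + p) % (p + q) :=
  have : NeZero (p + q) := ⟨by omega⟩
  finRotate_pow_apply p k

theorem torus_X [NeZero (p + q)] : (torus p q hp hq).X = shift ⟨p, by omega⟩ := by
  ext k
  rw [torus_X_apply, shift_apply, Fin.val_add]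

theorem torus_alexander_max (x : State (p + q))
    (h : (torus p q hp hq).alexander (torus p q hp hq).X ≤ (torus p q hp hq).alexander x) :
    x = (torus p q hp hq).X := by
  obtain ⟨h1, h2, -⟩ := belowCount_sub_le hp hq rfl (torus_X_apply hp hq) x
  rw [alexander_eq, alexander_eq] at h
  simp only [show (torus p q hp hq).O = 1 from rfl] at h
  exact h2 (by linarith)

theorem torus_alexander_X (hq1 : q = 1) : (torus p q hp hq).alexander (torus p q hp hq).X =
    (torus p q hp hq).alexander 1 + (((p + q : ℕ) : ℚ) - 1) := by
  subst hq1
  obtain ⟨-, -, h3⟩ := belowCount_sub_le hp hq rfl (torus_X_apply hp hq) 1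
  have h4 := belowCount_sub_one rfl (torus_X_apply hp hq)
  rw [alexander_eq, alexander_eq]
  simp only [show (torus p 1 hp hq).O = 1 from rfl]
  linarith

theorem torus_nsmul_ne_zero [NeZero (p + q)] (hpq : p.Coprime q) (k : ℕ) (hk : 0 < k)
    (hkn : k < p + q) : k • (⟨p, by omega⟩ : Fin (p + q)) ≠ 0 :=
  nsmul_ne_zero_of_coprime (by simpa [Nat.coprime_comm] using hpq) k hk hkn

theorem torus_exists_isTauCycle : ∃ a c, (torus p q hp hq).IsTauCycle a c := by
  have : NeZero (p + q) := ⟨by omega⟩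
  exact ⟨_, _, isTauCycle_of_top (torus_alexander_max hp hq) (single_X_vecMul _)
    (vecMul_ne_single_X (torus_X hp hq))⟩

theorem torus_neg_exists_isTauCycle (hpq : p.Coprime q) :
    ∃ a c, (torus p q hp hq).neg.IsTauCycle a c := by
  have : NeZero (p + q) := ⟨by omega⟩
  exact ⟨_, _, isTauCycle_neg rfl (torus_X hp hq) (by omega) (torus_nsmul_ne_zero hq hpq)⟩

theorem torus_epsilon_eq_neg_one (hp2 : 2 ≤ p) (hq2 : 2 ≤ q) : (torus p q hp hq).epsilon = -1 := by
  have : NeZero (p + q) := ⟨by omega⟩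
  rw [epsilon, if_pos]
  rw [tauInIm_iff_of_top (torus_alexander_max hp hq) (single_X_vecMul _)
    (vecMul_ne_single_X (torus_X hp hq)), torus_X, show (torus p q hp hq).O = 1 from rfl,
    ← shift_zero]
  exact ⟨_, avoidMatrix_mulVec_shift (by omega) (by simpa using hp2) (by simpa using hq2)⟩

theorem torus_epsilon_eq_zero (hpq : p.Coprime q) (hq1 : q = 1) : (torus p q hp hq).epsilon = 0 :=
  have : NeZero (p + q) := ⟨by omega⟩
  epsilon_eq_zero rfl (torus_X hp hq) (by omega) (torus_nsmul_ne_zero hq hpq)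
    (torus_alexander_max hp hq) (torus_alexander_X hp hq hq1)

theorem torus_neg_epsilon_eq_zero (hpq : p.Coprime q) (hq1 : q = 1) :
    (torus p q hp hq).neg.epsilon = 0 :=
  have : NeZero (p + q) := ⟨by omega⟩
  epsilon_neg_eq_zero rfl (torus_X hp hq) (by omega) (torus_nsmul_ne_zero hq hpq)
    (torus_alexander_max hp hq) (torus_alexander_X hp hq hq1)

theorem torus_neg_epsilon_eq_one (hpq : p.Coprime q) (hp2 : 2 ≤ p) (hq2 : 2 ≤ q) :
    (torus p q hp hq).neg.epsilon = 1 := by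
  have : NeZero (p + q) := ⟨by omega⟩
  -- Seen from 𝕏, the diagonal is the translate by q, so the adjacent-points lemma applies with the
  -- two lines exchanged.
  have hv : ((0 : Fin (p + q)) - ⟨p, by omega⟩).val = q := by
    rw [val_sub_eq_ite, if_neg (by simp; omega)]
    simp
  have hk : ¬ (torus p q hp hq).neg.TauInKer := by
    refine not_tauInKer_neg rfl (torus_X hp hq) (by omega) (torus_nsmul_ne_zero hq hpq)
      (w := Pi.single (move (shift 0) (0, 1)) 1) ?_
    rw [torus_X, ← shift_zero]
    exact avoidMatrix_mulVec_shift (by omega) (by rw [hv]; exact hq2) (by rw [hv]; omega)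
  rw [epsilon, if_neg fun h => hk (tauInIm_imp_tauInKer (by omega) h), if_neg hk]

end Torus

end GridDiagram

theorem theorem1p2 (p : ℕ) (q : ℤ) (hp : 0 < p) (hq : q ≠ 0) (hpq : p.Coprime q.natAbs) :
    (∃ a c, (GridDiagram.negTorus p q hp hq).IsTauCycle a c) ∧
    (p ≠ 1 → 1 < q → (GridDiagram.negTorus p q hp hq).epsilon = -1) ∧
    (|q| = 1 → (GridDiagram.negTorus p q hp hq).epsilon = 0) ∧
    (p ≠ 1 → q < -1 → (GridDiagram.negTorus p q hp hq).epsilon = 1) := by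
  have hq' := Int.natAbs_pos.mpr hq
  rcases lt_or_ge 0 q with h | h
  · rw [GridDiagram.negTorus, if_pos h]
    exact ⟨GridDiagram.torus_exists_isTauCycle hp hq',
      fun h1 h2 => GridDiagram.torus_epsilon_eq_neg_one hp hq' (by omega) (by omega),
      fun h1 => GridDiagram.torus_epsilon_eq_zero hp hq' hpq (by rw [Int.abs_eq_natAbs] at h1; omega),
      fun h1 h2 => by omega⟩
  · rw [GridDiagram.negTorus, if_neg h.not_gt]
    exact ⟨GridDiagram.torus_neg_exists_isTauCycle hp hq' hpq,
      fun h1 h2 => by omega,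
      fun h1 => GridDiagram.torus_neg_epsilon_eq_zero hp hq' hpq
        (by rw [Int.abs_eq_natAbs] at h1; omega),
      fun h1 h2 => GridDiagram.torus_neg_epsilon_eq_one hp hq' hpq (by omega) (by omega)⟩
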